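/- Let $\sigma:W\to\Sigma$ be a smooth fiber bundle, where $(W,I)$ is a complex manifold, $(\Sigma,j)$ is a closed (compact, without boundary) Riemann surface and $\sigma$ is holomorphic; let $V=\ker d\sigma$. Let $\Omega$ be a CRMS form on $W$, i.e. a smooth closed 3-form such that for all $w\in W$: $\Omega(v_1,v_2,v_3)=0$ for $v_1,v_2,v_3\in V_w$; for $\xi\in T_wW$ with $d\sigma(\xi)\ne0$ the form $\Omega(\xi,\cdot,\cdot)$ is non-degenerate on $V_w$; and $\Omega(I\xi,v_1,v_2)=-\Omega(\xi,v_1,Iv_2)$ for $\xi\in T_wW$, $v_1,v_2\in V_w$. Assume $\Omega=d\Theta$ for a smooth 2-form $\Theta$. Fix a Riemannian metric $h$ on $\Sigma$ in the conformal class of $j$; a smooth inner product $g$ on the fibers of $V$ and a map $\mathfrak J:\sigma^*T\Sigma\setminus 0\to\mathrm{End}(V)$ (extended by $\mathfrak J(0)=0$) such that for all $\xi\in T_wW$ with $\rho=d\sigma(\xi)\neq0$ one has $\mathfrak J(\rho)^2=-|\rho|_h^2\,\mathrm{Id}$, $\Omega(\xi,\cdot,\cdot)|_{V_w}=g(\cdot,\mathfrak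 J(\rho)\cdot)$ and $\mathfrak J(j\rho)=I\mathfrak J(\rho)$; and an Ehresmann connection on $\sigma$. For a smooth section $Z$ of $\sigma$ and $\rho\in T\Sigma$ let $\nabla_\rho Z\in V_Z$ be the vertical part of $dZ(\rho)$. Let $\mathcal A(Z)=\int_\Sigma Z^*\Theta$ on the space $\Gamma(\sigma)$ of smooth sections, whose tangent space at $Z$ is $\Gamma(Z^*V)$, and use on $\Gamma(Z^*V)$ the $L^2$-metric $\int_\Sigma g(\cdot,\cdot)\,d\mathcal V_h$. Then: (1) $\mathfrak J_\nabla Z(\rho):=\mathfrak J(\rho)(-I\nabla_\rho-\nabla_{j\rho})Z$ depends on $\rho\in T_t\Sigma$ only through $|\rho|_h$. Hence there is a globally well-defined first-order operator $\mathfrak J_\nabla$, mapping $Z\in\Gamma(\sigma)$ to $\mathfrak J_\nabla Z\in\Gamma(Z^*V)$, with $\mathfrak J_\nabla Z=\mathfrak J_\nabla Z(\rho)$ for every unit vector $\rho$. There is also a globally well-defined smooth vertical vector field $\alpha$ on $W$ such that $g(v,\alpha)=-\Omega(v,\hat\rho_1,\hat\rho_2)$ for all vertical $v$, where $\hat\rho_1,\hat\rho_2$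 are the horizontal lifts of any positive orthonormal frame $\rho_1,\rho_2=j\rho_1$ of $T\Sigma$. Put $\alpha(Z)=\alpha\circ Z$. (2) For every $Z\in\Gamma(\sigma)$ the $L^2$-gradient of $\mathcal A$ at $Z$ exists, is unique, and is $\mathrm{grad}\,\mathcal A(Z)=\mathfrak J_\nabla Z-\alpha(Z)$. (3) For $w\in W$, $\rho_s\in\mathbb R$ and $\rho\in T_{\sigma(w)}\Sigma$ put $\widetilde I(\rho_s,\rho)=\rho_sI-\mathfrak J(\rho)\in\mathrm{End}(V_w)$. If $\rho_s^2+|\rho|_h^2=1$, then $\widetilde I(\rho_s,\rho)^2=-\mathrm{Id}$. (4) Let $Z$ be a smooth section of $\mathrm{pr}_\Sigma^*W\to\mathbb R\times\Sigma$, and use the pulled back connection to define $\nabla_vZ$. For an orthonormal frame $v_1,v_2,v_3$ of $\mathbb R\times\Sigma$ with metric $ds^2+h$, the sum $\sum_{l=1}^3\widetilde I(v_l)\nabla_{v_l}Z$ does not depend on the frame. The following are equivalent: $Z$ is a negative gradient line of $\mathcal A$, i.e. $\partial_sZ=-\mathrm{grad}\,\mathcal A(Z(s,\cdot))$ for all $s$;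 $\nabla_{\partial_s}Z+\mathfrak J_\nabla Z=\alpha(Z)$ everywhere; $Z$ satisfies the perturbed Fueter equation $\sum_{l=1}^3\widetilde I(v_l)\nabla_{v_l}Z=I\alpha(Z)$ in every frame $\{\partial_s,\rho,j\rho\}$ with $|\rho|_h=1$; $Z$ satisfies this equation in every orthonormal frame. -/

import Mathlib

open Set Filter Topology MeasureTheory
open scoped Manifold ContDiff Bundle


namespace CRMS

/-! ### Differential forms on manifolds without boundary -/

section Forms

variable {E : Type*} [NormedAddCommGroup E] [NormedSpace ℝ E]
  {M : Type*} [TopologicalSpace M] [ChartedSpace E M]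
  {E' : Type*} [NormedAddCommGroup E'] [NormedSpace ℝ E']
  {N : Type*} [TopologicalSpace N] [ChartedSpace E' N]

variable (E M) in
/-- Real-valued differential `k`-forms (no regularity imposed) on a manifold modelled on `E`. -/
abbrev DForm (k : ℕ) := ∀ x : M, TangentSpace 𝓘(ℝ, E) x [⋀^Fin k]→L[ℝ] ℝ

/-- The coordinate expression of `η` in the chart at `x₀`: its pull-back by the inverse chart. -/
noncomputable def inChart {k : ℕ} (η : DForm E M k) (x₀ : M) (y : E) : E [⋀^Fin k]→L[ℝ] ℝ :=
  (η ((extChartAt 𝓘(ℝ, E) x₀).symm y)).compContinuousLinearMap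
    (mfderiv 𝓘(ℝ, E) 𝓘(ℝ, E) (extChartAt 𝓘(ℝ, E) x₀).symm y)

/-- Smoothness of a form: all its coordinate expressions are smooth. -/
noncomputable def IsSmoothForm {k : ℕ} (η : DForm E M k) : Prop :=
  ∀ x₀ : M, ContDiffOn ℝ ∞ (inChart η x₀) (extChartAt 𝓘(ℝ, E) x₀).target

/-- `Ω = dΘ`: this holds for the coordinate expressions in every chart. -/
noncomputable def IsExtDeriv {k : ℕ} (Θ : DForm E M k) (Ω : DForm E M (k + 1)) : Prop :=
  ∀ x₀ : M, ∀ y ∈ (extChartAt 𝓘(ℝ, E) x₀).target, inChart Ω x₀ y = extDeriv (inChart Θ x₀) y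

/-- The pull-back `f^* η` of a form by a map. -/
noncomputable def pullback {k : ℕ} (f : N → M) (η : DForm E M k) : DForm E' N k := fun t =>
  (η (f t)).compContinuousLinearMap (mfderiv 𝓘(ℝ, E') 𝓘(ℝ, E) f t)

end Forms

/-! ### Complex manifolds -/

section Complex

variable {E : Type*} [NormedAddCommGroup E] [NormedSpace ℂ E]
  {W : Type*} [TopologicalSpace W] [ChartedSpace E W]

/-- A complex manifold is a real manifold for the same atlas. -/
instance realManifold [IsManifold 𝓘(ℂ, E) ω W] : IsManifold 𝓘(ℝ, E) ω W := by
  refine isManifold_of_contDiffOn 𝓘(ℝ, E) ω W ?_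
  intro e e' he he'
  have h := (contDiffGroupoid ω 𝓘(ℂ, E)).compatible he he'
  rw [contDiffGroupoid, mem_groupoid_of_pregroupoid] at h
  exact ContDiffOn.restrict_scalars ℝ h.1

instance realSurface {S : Type*} [TopologicalSpace S] [ChartedSpace ℂ S]
    [IsManifold 𝓘(ℂ, ℂ) ω S] : IsManifold 𝓘(ℝ, ℂ) ω S := realManifold

variable (E) in
/-- The almost complex structure on the tangent spaces of a complex manifold: multiplication by `i`
in the holomorphic chart at the point through which Mathlib identifies `T_wW` with `E`. -/
noncomputable def cplx (w : W) : TangentSpace 𝓘(ℝ, E) w →L[ℝ] TangentSpace 𝓘(ℝ, E) w :=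
  ((Complex.I • ContinuousLinearMap.id ℂ E).restrictScalars ℝ : E →L[ℝ] E)

variable {S : Type*} [TopologicalSpace S] [ChartedSpace ℂ S]

variable (E) in
/-- The vertical space `V_w = ker dσ_w`. -/
noncomputable def Vert (σ : W → S) (w : W) : Submodule ℝ (TangentSpace 𝓘(ℝ, E) w) :=
  (mfderiv 𝓘(ℝ, E) 𝓘(ℝ, ℂ) σ w).ker

theorem mfderiv_cplx {σ : W → S} (hσ : MDifferentiable 𝓘(ℂ, E) 𝓘(ℂ, ℂ) σ) (w : W)
    (ξ : TangentSpace 𝓘(ℝ, E) w) :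
    mfderiv 𝓘(ℝ, E) 𝓘(ℝ, ℂ) σ w (cplx E w ξ) =
      cplx ℂ (σ w) (mfderiv 𝓘(ℝ, E) 𝓘(ℝ, ℂ) σ w ξ) := by
  obtain ⟨hc, hd⟩ := (hσ w).hasMFDerivAt
  set L : E →L[ℂ] ℂ := mfderiv 𝓘(ℂ, E) 𝓘(ℂ, ℂ) σ w with hL
  have hr : HasMFDerivAt 𝓘(ℝ, E) 𝓘(ℝ, ℂ) σ w (L.restrictScalars ℝ) :=
    ⟨hc, HasFDerivWithinAt.restrictScalars ℝ hd⟩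
  rw [hr.mfderiv]
  exact L.map_smul Complex.I ξ

/-- The restriction of `I` to the vertical space; it preserves it as `σ` is holomorphic. -/
noncomputable def vertI {σ : W → S} (hσ : MDifferentiable 𝓘(ℂ, E) 𝓘(ℂ, ℂ) σ) (w : W) :
    Module.End ℝ (Vert E σ w) :=
  (cplx E w).toLinearMap.restrict (p := Vert E σ w) (q := Vert E σ w) (by
    intro v hv
    have hv' : mfderiv 𝓘(ℝ, E) 𝓘(ℝ, ℂ) σ w v = 0 := hv
    change mfderiv 𝓘(ℝ, E) 𝓘(ℝ, ℂ) σ w (cplx E w v) = 0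
    rw [mfderiv_cplx hσ, hv', map_zero])

end Complex

/-! ### Integration over a closed Riemann surface -/

section Integration

variable {S : Type*} [TopologicalSpace S] [ChartedSpace ℂ S] [IsManifold 𝓘(ℂ, ℂ) ω S]
  [T2Space S] [CompactSpace S]

variable (S) in
/-- A smooth partition of unity subordinate to the holomorphic charts. -/
noncomputable def chartPartition : SmoothPartitionOfUnity S 𝓘(ℝ, ℂ) S univ :=
  (SmoothPartitionOfUnity.exists_isSubordinate_chartAt_source 𝓘(ℝ, ℂ) S).choose

/-- The integral of a 2-form over the closed surface, with the orientation for which holomorphic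
coordinates `t₁ + i t₂` are positive. -/
noncomputable def integral (η : DForm ℂ S 2) : ℝ :=
  ∑ᶠ i : S, ∫ y in (extChartAt 𝓘(ℝ, ℂ) i).target,
    chartPartition S i ((extChartAt 𝓘(ℝ, ℂ) i).symm y) * inChart η i y ![1, Complex.I]

end Integration

/-! ### Conformal metrics and their area forms -/

section Metric

theorem cplx_cplx {E : Type*} [NormedAddCommGroup E] [NormedSpace ℂ E]
    {W : Type*} [TopologicalSpace W] [ChartedSpace E W] (w : W) (v : TangentSpace 𝓘(ℝ, E) w) :
    cplx E w (cplx E w v) = -v := by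
  have key : ∀ u : E, Complex.I • (Complex.I • u) = -u := fun u => by
    rw [smul_smul, Complex.I_mul_I, neg_one_smul]
  exact key v

variable {S : Type*} [TopologicalSpace S] [ChartedSpace ℂ S] [IsManifold 𝓘(ℂ, ℂ) ω S]

variable (S) in
/-- A Riemannian metric in the conformal class of the complex structure `j`. -/
structure ConformalMetric extends
    Bundle.ContMDiffRiemannianMetric 𝓘(ℝ, ℂ) ∞ ℂ (fun t : S => TangentSpace 𝓘(ℝ, ℂ) t) where
  conformal : ∀ (t : S) (a b : TangentSpace 𝓘(ℝ, ℂ) t),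
    inner t (cplx ℂ t a) (cplx ℂ t b) = inner t a b

theorem ConformalMetric.inner_cplx_self (h : ConformalMetric S) (t : S)
    (a : TangentSpace 𝓘(ℝ, ℂ) t) : h.inner t (cplx ℂ t a) a = 0 := by
  have h1 := h.conformal t (cplx ℂ t a) a
  rw [cplx_cplx, map_neg, neg_apply, h.symm t a] at h1
  linarith

/-- The volume form `dV_h(a, b) = h(ja, b)`; it is `1` on the positive orthonormal frames
`(ρ, jρ)`. -/
noncomputable def ConformalMetric.areaForm (h : ConformalMetric S) : DForm ℂ S 2 := fun t =>
  { toFun := fun v => h.inner t (cplx ℂ t (v 0)) (v 1)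
    map_update_add' := by
      intro _ m i x y
      fin_cases i <;> simp
    map_update_smul' := by
      intro _ m i c x
      fin_cases i <;> simp
    cont := by
      have h0 : Continuous fun v : Fin 2 → TangentSpace 𝓘(ℝ, ℂ) t =>
          h.inner t (cplx ℂ t (v 0)) :=
        (h.inner t).continuous.comp ((cplx ℂ t).continuous.comp (continuous_apply 0))
      exact isBoundedBilinearMap_apply (𝕜 := ℝ) (E := ℂ) (F := ℝ) |>.continuous.comp
        (h0.prodMk (continuous_apply 1))
    map_eq_zero_of_eq' := by
      intro v i j hv hij
      have h01 : v 0 = v 1 := by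
        fin_cases i <;> fin_cases j
        · exact absurd rfl hij
        · exact hv
        · exact hv.symm
        · exact absurd rfl hij
      change h.inner t (cplx ℂ t (v 0)) (v 1) = 0
      rw [h01]
      exact h.inner_cplx_self t (v 1) }

end Metric

/-! ### CRMS bundles -/

section Bundle

variable {E : Type*} [NormedAddCommGroup E] [NormedSpace ℂ E]
  {W : Type*} [TopologicalSpace W] [ChartedSpace E W]
  {S : Type*} [TopologicalSpace S] [ChartedSpace ℂ S]
  {B : Type*} [NormedAddCommGroup B] [NormedSpace ℝ B]

variable (E B) in
/-- `σ : W → S` is a smooth fibre bundle with typical fibre the manifold `F` (modelled on `B`):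
it has diffeomorphic local trivializations around every point of the base. -/
noncomputable def IsSmoothFiberBundle (F : Type*) [TopologicalSpace F] [ChartedSpace B F] (σ : W → S) : Prop :=
  ∀ t : S, ∃ e : Bundle.Trivialization F σ, t ∈ e.baseSet ∧
    ContMDiffOn 𝓘(ℝ, E) (𝓘(ℝ, ℂ).prod 𝓘(ℝ, B)) ∞ e e.source ∧
    ContMDiffOn (𝓘(ℝ, ℂ).prod 𝓘(ℝ, B)) 𝓘(ℝ, E) ∞ e.toOpenPartialHomeomorph.symm e.target

/-- A complex-regularized multisymplectic (CRMS) 3-form on the total space of `σ : W → S`. -/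
structure IsCRMS (σ : W → S) (Ω : DForm E W 3) : Prop where
  smooth : IsSmoothForm Ω
  closed : IsExtDeriv Ω 0
  horizontal : ∀ (w : W) (v₁ v₂ v₃ : Vert E σ w), Ω w ![v₁, v₂, v₃] = 0
  nondegenerate : ∀ (w : W) (ξ : TangentSpace 𝓘(ℝ, E) w), mfderiv 𝓘(ℝ, E) 𝓘(ℝ, ℂ) σ w ξ ≠ 0 →
    ∀ v₁ : Vert E σ w, (∀ v₂ : Vert E σ w, Ω w ![ξ, v₁, v₂] = 0) → v₁ = 0
  compatible : ∀ (w : W) (ξ : TangentSpace 𝓘(ℝ, E) w) (v₁ v₂ : Vert E σ w),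
    Ω w ![cplx E w ξ, v₁, v₂] = -Ω w ![ξ, v₁, cplx E w v₂]

variable [IsManifold 𝓘(ℂ, E) ω W]

/-- The vector field `X` on `W` is smooth on the open set `U`. -/
noncomputable def SmoothFieldOn (X : ∀ w : W, TangentSpace 𝓘(ℝ, E) w) (U : Set W) : Prop :=
  ContMDiffOn 𝓘(ℝ, E) 𝓘(ℝ, E).tangent ∞ (fun w => (⟨w, X w⟩ : TangentBundle 𝓘(ℝ, E) W)) U

variable (E) in
/-- An Ehresmann connection on `σ`, given by its smooth vertical projection `TW → V`. -/
structure Connection (σ : W → S) where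
  proj : ∀ w : W, TangentSpace 𝓘(ℝ, E) w →ₗ[ℝ] Vert E σ w
  proj_vert : ∀ (w : W) (v : Vert E σ w), proj w v = v
  smooth : ∀ (U : Set W) (X : ∀ w : W, TangentSpace 𝓘(ℝ, E) w), IsOpen U → SmoothFieldOn X U →
    SmoothFieldOn (fun w => (proj w (X w) : TangentSpace 𝓘(ℝ, E) w)) U

/-- An inner product `g` on the fibres of `V` together with a map `𝔍 : σ^*TS ∖ 0 → End V` (extended
by `0` on the zero section), compatible with the form `Ω` and the metric `h`. Smoothness of `𝔍`
need not be required: it follows from `form_eq`. -/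
structure CompatibleMetric [IsManifold 𝓘(ℂ, ℂ) ω S] {σ : W → S}
    (hσ : MDifferentiable 𝓘(ℂ, E) 𝓘(ℂ, ℂ) σ) (Ω : DForm E W 3) (h : ConformalMetric S) where
  g : ∀ w : W, Vert E σ w →ₗ[ℝ] Vert E σ w →ₗ[ℝ] ℝ
  symm : ∀ (w : W) (u v : Vert E σ w), g w u v = g w v u
  pos : ∀ (w : W) (v : Vert E σ w), v ≠ 0 → 0 < g w v v
  smooth : ∀ (U : Set W) (X Y : ∀ w : W, Vert E σ w), IsOpen U →
    SmoothFieldOn (fun w => (X w : TangentSpace 𝓘(ℝ, E) w)) U →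
    SmoothFieldOn (fun w => (Y w : TangentSpace 𝓘(ℝ, E) w)) U →
    ContMDiffOn 𝓘(ℝ, E) 𝓘(ℝ, ℝ) ∞ (fun w => g w (X w) (Y w)) U
  J : ∀ w : W, TangentSpace 𝓘(ℝ, ℂ) (σ w) → Module.End ℝ (Vert E σ w)
  J_zero : ∀ w : W, J w 0 = 0
  J_sq : ∀ (w : W) (ρ : TangentSpace 𝓘(ℝ, ℂ) (σ w)), ρ ≠ 0 →
    J w ρ * J w ρ = -(h.inner (σ w) ρ ρ • (1 : Module.End ℝ (Vert E σ w)))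
  form_eq : ∀ (w : W) (ξ : TangentSpace 𝓘(ℝ, E) w), mfderiv 𝓘(ℝ, E) 𝓘(ℝ, ℂ) σ w ξ ≠ 0 →
    ∀ v₁ v₂ : Vert E σ w,
      Ω w ![ξ, v₁, v₂] = g w v₁ (J w (mfderiv 𝓘(ℝ, E) 𝓘(ℝ, ℂ) σ w ξ) v₂)
  J_cplx : ∀ (w : W) (ρ : TangentSpace 𝓘(ℝ, ℂ) (σ w)), ρ ≠ 0 →
    J w (cplx ℂ (σ w) ρ) = vertI hσ w * J w ρ

end Bundle

/-! ### Sections, and families of sections -/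

section Sections

variable {E : Type*} [NormedAddCommGroup E] [NormedSpace ℂ E]
  {W : Type*} [TopologicalSpace W] [ChartedSpace E W]
  {S : Type*} [TopologicalSpace S] [ChartedSpace ℂ S]

variable (E) in
/-- `Γ(σ)`: the smooth sections of `σ`. -/
structure SmoothSection (σ : W → S) where
  toFun : S → W
  smooth : ContMDiff 𝓘(ℝ, ℂ) 𝓘(ℝ, E) ∞ toFun
  isSection : ∀ t : S, σ (toFun t) = t

variable (E) in
/-- Smooth sections of `pr_S^* W → ℝ × S`, i.e. smooth one-parameter families of sections. -/
structure SectionFamily (σ : W → S) where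
  toFun : ℝ → S → W
  smooth : ContMDiff (𝓘(ℝ, ℝ).prod 𝓘(ℝ, ℂ)) 𝓘(ℝ, E) ∞ (fun p : ℝ × S => toFun p.1 p.2)
  isSection : ∀ (s : ℝ) (t : S), σ (toFun s t) = t

variable {σ : W → S}

/-- The section `Z(s, ·)`. -/
abbrev SectionFamily.slice (Z : SectionFamily E σ) (s : ℝ) : SmoothSection E σ where
  toFun := Z.toFun s
  smooth := Z.smooth.comp (contMDiff_const.prodMk contMDiff_id)
  isSection := Z.isSection s

/-- The derivative `∂_s Z(s, t)`. -/
noncomputable def SectionFamily.velocity (Z : SectionFamily E σ) (s : ℝ) (t : S) :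
    TangentSpace 𝓘(ℝ, E) (Z.toFun s t) :=
  mfderiv 𝓘(ℝ, ℝ) 𝓘(ℝ, E) (fun r => Z.toFun r t) s (1 : ℝ)

/-- Transport of tangent vectors along an equality of base points. -/
noncomputable def transport {t t' : S} (h : t = t') (ρ : TangentSpace 𝓘(ℝ, ℂ) t) : TangentSpace 𝓘(ℝ, ℂ) t' :=
  h ▸ ρ

variable [IsManifold 𝓘(ℂ, E) ω W]

/-- `Γ(Z^*V)`: smoothness of a vertical vector field along `Z`. -/
noncomputable def SmoothSection.SmoothAlong (Z : SmoothSection E σ) (X : ∀ t : S, Vert E σ (Z.toFun t)) : Prop :=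
  ContMDiff 𝓘(ℝ, ℂ) 𝓘(ℝ, E).tangent ∞
    (fun t => (⟨Z.toFun t, (X t : TangentSpace 𝓘(ℝ, E) (Z.toFun t))⟩ : TangentBundle 𝓘(ℝ, E) W))

/-- `∇_ρ Z`: the vertical projection of `dZ(ρ)`. -/
noncomputable def SmoothSection.nabla (Z : SmoothSection E σ) (P : Connection E σ) (t : S)
    (ρ : TangentSpace 𝓘(ℝ, ℂ) t) : Vert E σ (Z.toFun t) :=
  P.proj (Z.toFun t) (mfderiv 𝓘(ℝ, ℂ) 𝓘(ℝ, E) Z.toFun t ρ)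

/-- `∇_v Z` for a section `Z` of the bundle `pr_S^* W` over `ℝ × S`, with the pulled back
connection, and for `v = (ρ_s, ρ)` in `T_{(s,t)}(ℝ × S) = ℝ × T_tS`. -/
noncomputable def SectionFamily.nabla (Z : SectionFamily E σ) (P : Connection E σ) (s : ℝ) (t : S)
    (v : ℝ × TangentSpace 𝓘(ℝ, ℂ) t) : Vert E σ (Z.toFun s t) :=
  P.proj (Z.toFun s t) (mfderiv (𝓘(ℝ, ℝ).prod 𝓘(ℝ, ℂ)) 𝓘(ℝ, E)
    (fun p : ℝ × S => Z.toFun p.1 p.2) (s, t) (v : ℝ × ℂ))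

end Sections

/-! ### The operators of Floer theory -/

section Operators

variable {E : Type*} [NormedAddCommGroup E] [NormedSpace ℂ E]
  {W : Type*} [TopologicalSpace W] [ChartedSpace E W] [IsManifold 𝓘(ℂ, E) ω W]
  {S : Type*} [TopologicalSpace S] [ChartedSpace ℂ S] [IsManifold 𝓘(ℂ, ℂ) ω S]
  {σ : W → S} {hσ : MDifferentiable 𝓘(ℂ, E) 𝓘(ℂ, ℂ) σ} {Ω : DForm E W 3} {h : ConformalMetric S}

/-- `𝔍_∇ Z(ρ) = 𝔍(ρ)(-I ∇_ρ - ∇_{jρ}) Z`. -/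
noncomputable def jNablaAt (G : CompatibleMetric hσ Ω h) (P : Connection E σ) (Z : SmoothSection E σ) (t : S)
    (ρ : TangentSpace 𝓘(ℝ, ℂ) t) : Vert E σ (Z.toFun t) :=
  G.J (Z.toFun t) (transport (Z.isSection t).symm ρ)
    (-(vertI hσ (Z.toFun t) (Z.nabla P t ρ)) - Z.nabla P t (cplx ℂ t ρ))

/-- `α` is the vertical vector field on `W` with `g(v, α) = -Ω(v, ρ₁, ρ₂)` for vertical `v`, where
`ρ₁, ρ₂` are the horizontal lifts `ξ₁, ξ₂` of any positive orthonormal frame `ρ₁`, `ρ₂ = jρ₁`. -/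
noncomputable def IsCurvatureTerm (G : CompatibleMetric hσ Ω h) (P : Connection E σ)
    (α : ∀ w : W, Vert E σ w) : Prop :=
  ∀ (w : W) (ξ₁ ξ₂ : TangentSpace 𝓘(ℝ, E) w), P.proj w ξ₁ = 0 → P.proj w ξ₂ = 0 →
    h.inner (σ w) (mfderiv 𝓘(ℝ, E) 𝓘(ℝ, ℂ) σ w ξ₁) (mfderiv 𝓘(ℝ, E) 𝓘(ℝ, ℂ) σ w ξ₁) = 1 →
    mfderiv 𝓘(ℝ, E) 𝓘(ℝ, ℂ) σ w ξ₂ = cplx ℂ (σ w) (mfderiv 𝓘(ℝ, E) 𝓘(ℝ, ℂ) σ w ξ₁) →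
    ∀ v : Vert E σ w, G.g w v (α w) = -Ω w ![v, ξ₁, ξ₂]

/-- `Ĩ(ρ_s, ρ) = ρ_s I - 𝔍(ρ)`, an endomorphism of `V_w`. -/
noncomputable def fueterStructure (G : CompatibleMetric hσ Ω h) (w : W) (a : ℝ)
    (ρ : TangentSpace 𝓘(ℝ, ℂ) (σ w)) : Module.End ℝ (Vert E σ w) :=
  a • vertI hσ w - G.J w ρ

/-- Orthonormal frames of `T_{(s,t)}(ℝ × S) = ℝ × T_tS` for the metric `ds² + h`. -/
noncomputable def IsOrthonormalFrame (h : ConformalMetric S) (t : S)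
    (v : Fin 3 → ℝ × TangentSpace 𝓘(ℝ, ℂ) t) : Prop :=
  ∀ k l : Fin 3, (v k).1 * (v l).1 + h.inner t (v k).2 (v l).2 = if k = l then 1 else 0

/-- The Fueter operator `∑_l Ĩ(v_l) ∇_{v_l} Z` at the point `(s, t)`, computed in the frame `v`. -/
noncomputable def fueterOperator (G : CompatibleMetric hσ Ω h) (P : Connection E σ) (Z : SectionFamily E σ)
    (s : ℝ) (t : S) (v : Fin 3 → ℝ × TangentSpace 𝓘(ℝ, ℂ) t) : Vert E σ (Z.toFun s t) :=
  ∑ l : Fin 3, fueterStructure G (Z.toFun s t) (v l).1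
    (transport (Z.isSection s t).symm (v l).2) (Z.nabla P s t (v l))

variable [T2Space S] [CompactSpace S]

/-- The action `𝒜(Z) = ∫_S Z^*Θ`. -/
noncomputable def action (Θ : DForm E W 2) (Z : SmoothSection E σ) : ℝ :=
  integral (pullback Z.toFun Θ)

/-- The `L²`-metric on `Γ(Z^*V)`: the integral of `g(X, Y) dV_h`. -/
noncomputable def l2Inner (G : CompatibleMetric hσ Ω h) (Z : SmoothSection E σ)
    (X Y : ∀ t : S, Vert E σ (Z.toFun t)) : ℝ :=
  integral (fun t => G.g (Z.toFun t) (X t) (Y t) • h.areaForm t)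

/-- `X ∈ Γ(Z^*V)` is the `L²`-gradient of the action at `Z`: for every tangent vector
`Y ∈ Γ(Z^*V)` and every smooth family of sections through `Z` with velocity `Y` at `0`, the
derivative of the action along the family is the `L²`-inner product of `X` and `Y`. -/
noncomputable def IsGradient (G : CompatibleMetric hσ Ω h) (Θ : DForm E W 2) (Z : SmoothSection E σ)
    (X : ∀ t : S, Vert E σ (Z.toFun t)) : Prop :=
  Z.SmoothAlong X ∧
  ∀ Y : ∀ t : S, Vert E σ (Z.toFun t), Z.SmoothAlong Y →
  ∀ γ : SectionFamily E σ,
    (∀ t : S, (⟨γ.toFun 0 t, γ.velocity 0 t⟩ : TangentBundle 𝓘(ℝ, E) W) =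
      ⟨Z.toFun t, (Y t : TangentSpace 𝓘(ℝ, E) (Z.toFun t))⟩) →
    HasDerivAt (fun r : ℝ => action Θ (γ.slice r)) (l2Inner G Z X Y) 0

/-- `Z : ℝ × S → W` is a negative gradient line: `∂_s Z = -grad 𝒜(Z(s, ·))` for all `s`. -/
noncomputable def IsNegGradientLine (G : CompatibleMetric hσ Ω h) (Θ : DForm E W 2)
    (Z : SectionFamily E σ) : Prop :=
  ∀ s : ℝ, ∃ X : ∀ t : S, Vert E σ (Z.toFun s t), IsGradient G Θ (Z.slice s) X ∧
    ∀ t : S, Z.velocity s t = -(X t : TangentSpace 𝓘(ℝ, E) (Z.toFun s t))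

end Operators

end CRMS

set_option linter.unusedSectionVars false

namespace CRMS

/-! ### Pointwise linear algebra -/

section Algebra

variable {M : Type*} [AddCommGroup M] [Module ℝ M] [TopologicalSpace M]

/-! The pointwise part of the theorem is quaternionic linear algebra. `Ω` is linear in its first
slot and `σ` is a submersion, so `Ω(ξ,·,·) = g(·,𝔍(ρ)·)` forces `𝔍` to be linear in `ρ` (`J_add`,
`J_smul`). As `jρ` is as long as `ρ`, both `𝔍(ρ)` and `I𝔍(ρ)` square to `-|ρ|²`, hence `I` and
`𝔍(ρ)` anticommute (`JL_anti`). This yields the rotation invariance of `𝔍_∇Z(ρ)`, the identity `Ĩ² =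
-1`, and the fact that in a frame `∂_s, ρ, jρ` the Fueter operator is `I(∇_s Z + 𝔍_∇ Z)`
(`fueterOperator_adapted`). In a general frame it is the metric trace of the bilinear map `(u, v) ↦
Ĩ(u)∇_v Z`, so the frame does not matter (`sum_orthonormal_eq`).

The gradient rests on the pointwise identity `|ρ|² g(v, 𝔍_∇Z - α) = Ω(v, dZ ρ, dZ jρ)` of
`g_jNabla`. To obtain it, split `dZ` into horizontal and vertical parts: the purely horizontal term
produces `α`, the mixed terms produce `𝔍_∇Z`, and the purely vertical term vanishes. Along a family
of sections with velocity `v`, the homotopy formula writes the derivative of `Z^*Θ` as `Ω(v, dZ,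
dZ)` plus the differential of the 1-form `Θ(v, dZ)` (`fderiv_pullFlat`). The exact term integrates
to zero by Stokes' theorem, proved with a partition of unity in `finsum_integral_curl_eq_zero`. What
is left is the `L²`-product with `𝔍_∇Z - α` (`hasDerivAt_action_l2Inner`).

Both `α` and `𝔍_∇Z` are defined by pointwise choices. Their smoothness is read off from their inner
products with smooth vertical fields, by solving a nondegenerate linear system
(`smoothAlongAt_of_g`).

For uniqueness of the gradient there must be enough families of sections: local trivializations
realise every vertical vector as a velocity (`exists_family`), and a cut-off then localises the
variation where its product with the difference of two candidates is positive (`IsGradient.unique`).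
-/

theorem form_swap01 (η : M [⋀^Fin 3]→L[ℝ] ℝ) (a b c : M) : η ![b, a, c] = -η ![a, b, c] := by
  have h := η.toAlternatingMap.map_swap ![a, b, c] (i := 0) (j := 1) (by decide)
  have e : (![a, b, c] ∘ Equiv.swap (0 : Fin 3) 1) = ![b, a, c] := by
    ext i; fin_cases i <;> rfl
  rw [e] at h
  exact h

theorem form_swap12 (η : M [⋀^Fin 3]→L[ℝ] ℝ) (a b c : M) : η ![a, c, b] = -η ![a, b, c] := by
  have h := η.toAlternatingMap.map_swap ![a, b, c] (i := 1) (j := 2) (by decide)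
  have e : (![a, b, c] ∘ Equiv.swap (1 : Fin 3) 2) = ![a, c, b] := by
    ext i; fin_cases i <;> rfl
  rw [e] at h
  exact h

theorem form_add0 (η : M [⋀^Fin 3]→L[ℝ] ℝ) (a a' b c : M) :
    η ![a + a', b, c] = η ![a, b, c] + η ![a', b, c] := η.vecCons_add _ _ _

theorem form_smul0 (η : M [⋀^Fin 3]→L[ℝ] ℝ) (r : ℝ) (a b c : M) :
    η ![r • a, b, c] = r * η ![a, b, c] := η.vecCons_smul _ _ _

theorem form_add1 (η : M [⋀^Fin 3]→L[ℝ] ℝ) (a b b' c : M) :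
    η ![a, b + b', c] = η ![a, b, c] + η ![a, b', c] := by
  rw [form_swap01, form_add0, form_swap01 η a b, form_swap01 η a b']; ring

theorem form_smul1 (η : M [⋀^Fin 3]→L[ℝ] ℝ) (r : ℝ) (a b c : M) :
    η ![a, r • b, c] = r * η ![a, b, c] := by
  rw [form_swap01, form_smul0, form_swap01 η a b]; ring

theorem form_add2 (η : M [⋀^Fin 3]→L[ℝ] ℝ) (a b c c' : M) :
    η ![a, b, c + c'] = η ![a, b, c] + η ![a, b, c'] := by
  rw [form_swap12, form_add1, form_swap12 η a b c, form_swap12 η a b c']; ring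

theorem form_smul2 (η : M [⋀^Fin 3]→L[ℝ] ℝ) (r : ℝ) (a b c : M) :
    η ![a, b, r • c] = r * η ![a, b, c] := by
  rw [form_swap12, form_smul1, form_swap12 η a b c]; ring

variable {V : Type*} [AddCommGroup V] [Module ℝ V]

/-- The two squares agree, `IJIJ = J²`, and `J²` is a nonzero scalar, so `J` can be cancelled to
give `IJI = J`. Multiplying by `I` on the left and using `I² = -1` gives the claim. -/
theorem anticommute_of_sq {I J : Module.End ℝ V} {q : ℝ} (hq : q ≠ 0)
    (hJ : J * J = -(q • 1)) (hIJ : (I * J) * (I * J) = -(q • 1)) (hI : I * I = -1) :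
    I * J = -(J * I) := by
  have h1 : I * J * I * J = J * J := by rw [hJ, ← hIJ]; simp only [mul_assoc]
  have h2 : I * J * I = J := by
    have h3 : I * J * I * (J * J) = J * (J * J) := by
      rw [← mul_assoc, h1, mul_assoc]
    rw [hJ] at h3
    have h4 : q • (I * J * I) = q • J := by simpa using h3
    exact smul_right_injective _ hq h4
  have h5 : I * (I * J * I) = I * J := by rw [h2]
  rw [← h5, mul_assoc, ← mul_assoc, hI]; simp

variable {T : Type*} [AddCommGroup T] [Module ℝ T]

/-- Rotating `ρ` by a unit complex number does not change `J(ρ)(-I ∇_ρ - ∇_{jρ})`. -/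
theorem rotate_invariance (I : Module.End ℝ V) (J : T →ₗ[ℝ] Module.End ℝ V) (D : T →ₗ[ℝ] V)
    (j : T →ₗ[ℝ] T) (ρ : T) (a b : ℝ) (hab : a ^ 2 + b ^ 2 = 1) (hj : j (j ρ) = -ρ)
    (hI : I * I = -1) (hJ : J (j ρ) = I * J ρ) (hanti : I * J ρ = -(J ρ * I)) :
    J (a • ρ + b • j ρ) (-(I (D (a • ρ + b • j ρ))) - D (j (a • ρ + b • j ρ))) =
      J ρ (-(I (D ρ)) - D (j ρ)) := by
  have hI' : ∀ v, I (I v) = -v := fun v => by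
    have := congrArg (fun f => f v) hI; simpa using this
  have hJ' : ∀ v, J (j ρ) v = I (J ρ v) := fun v => by rw [hJ]; rfl
  have ha' : ∀ v, J ρ (I v) = -I (J ρ v) := fun v => by
    have := congrArg (fun f => f v) hanti
    simp at this
    rw [this, neg_neg]
  -- With `z = a + bI`, the operator becomes `z J(ρ)` and its argument becomes `z` times the old
  -- one. Anticommutation moves the second `z` across `J(ρ)` as its conjugate, and `z` times its
  -- conjugate is `a² + b² = 1`.
  simp only [map_add, map_smul, hj, LinearMap.add_apply, LinearMap.smul_apply, hJ', map_neg,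
    map_sub, ha', hI', neg_neg]
  have hb : b ^ 2 = 1 - a ^ 2 := by linarith
  match_scalars <;> ring_nf <;> linarith

/-- The cross terms combine to the anticommutator of `I` and `J`, which vanishes; the squares
contribute `-a² - q`. -/
theorem fuet_sq {I J : Module.End ℝ V} {a q : ℝ} (haq : a ^ 2 + q = 1) (hI : I * I = -1)
    (hJ : J * J = -(q • 1)) (hanti : I * J = -(J * I)) :
    (a • I - J) * (a • I - J) = -1 := by
  have h1 : (a • I - J) * (a • I - J) =
      (a ^ 2) • (I * I) - a • (I * J + J * I) + J * J := by
    simp only [sub_mul, mul_sub, smul_mul_assoc, mul_smul_comm, smul_add, pow_two]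
    module
  rw [h1, hI, hJ, hanti]
  have : q = 1 - a ^ 2 := by linarith
  rw [this]
  simp only [neg_add_cancel, smul_zero, sub_zero, smul_neg]
  module

open Matrix in
-- The trace of a bilinear map with respect to `q`. Neither symmetry nor positivity of `q` is
-- needed, only that both families are `q`-orthonormal. The dimension is a successor, so the index
-- type is nonempty and the rank condition yields finite dimension.
theorem sum_orthonormal_eq {n : ℕ} (q : T →ₗ[ℝ] T →ₗ[ℝ] ℝ) (hdim : Module.finrank ℝ T = n + 1)
    (C : T →ₗ[ℝ] T →ₗ[ℝ] V) (v v' : Fin (n + 1) → T)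
    (hv : ∀ k l, q (v k) (v l) = if k = l then 1 else 0)
    (hv' : ∀ k l, q (v' k) (v' l) = if k = l then 1 else 0) :
    ∑ l, C (v l) (v l) = ∑ l, C (v' l) (v' l) := by
  have hli : LinearIndependent ℝ v := by
    rw [Fintype.linearIndependent_iff]
    intro g hg i
    have := congrArg (fun x => q x (v i)) hg
    simpa [hv] using this
  let bs := basisOfLinearIndependentOfCardEqFinrank hli (by simp [hdim])
  have hbs : ∀ i, bs i = v i := fun i => by simp [bs]
  let A : Matrix (Fin (n + 1)) (Fin (n + 1)) ℝ := fun k l => q (v' k) (v l)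
  have hexp : ∀ k, v' k = ∑ l, A k l • v l := by
    intro k
    have h1 := bs.sum_repr (v' k)
    simp only [hbs] at h1
    have h2 : ∀ l, A k l = bs.repr (v' k) l := by
      intro l
      have h3 := congrArg (fun x => q x (v l)) h1
      simp only [map_sum, map_smul, LinearMap.sum_apply, LinearMap.smul_apply, hv,
        smul_eq_mul, mul_ite, mul_one, mul_zero, Finset.sum_ite_eq', Finset.mem_univ, if_true] at h3
      exact h3.symm
    simp only [h2]
    exact h1.symm
  have hA : A * Aᵀ = 1 := by
    ext k m
    rw [mul_apply, one_apply, ← hv' k m]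
    conv_rhs => rw [hexp m]
    simp only [A, map_sum, map_smul, smul_eq_mul]
    exact Finset.sum_congr rfl fun _ _ => mul_comm _ _
  -- Orthonormality of `v'` controls the rows of the transition matrix, whereas the double sum below
  -- contracts over its columns; for square matrices a one-sided inverse is two-sided.
  have hA' : Aᵀ * A = 1 := mul_eq_one_comm.mp hA
  have hA2 : ∀ l m, ∑ k, A k l * A k m = if l = m then 1 else 0 := by
    intro l m
    have := congrFun (congrFun hA' l) m
    rw [mul_apply, one_apply] at this
    exact this
  symm
  calc ∑ k, C (v' k) (v' k) = ∑ k, ∑ l, ∑ m, (A k l * A k m) • C (v l) (v m) := by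
        refine Finset.sum_congr rfl fun k _ => ?_
        conv_lhs => rw [hexp k]
        simp only [map_sum, map_smul, LinearMap.sum_apply, LinearMap.smul_apply, Finset.smul_sum,
          smul_smul]
        rw [Finset.sum_comm]
        refine Finset.sum_congr rfl fun l _ => Finset.sum_congr rfl fun m _ => ?_
        rw [mul_comm]
    _ = ∑ l, ∑ m, (∑ k, A k l * A k m) • C (v l) (v m) := by
        rw [Finset.sum_comm]
        refine Finset.sum_congr rfl fun l _ => ?_
        rw [Finset.sum_comm]
        simp [Finset.sum_smul]
    _ = ∑ l, C (v l) (v l) := by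
        simp [hA2]

end Algebra

/-! ### Pointwise geometry of a CRMS bundle -/

section Pointwise

variable {E : Type*} [NormedAddCommGroup E] [NormedSpace ℂ E]
  {W : Type*} [TopologicalSpace W] [ChartedSpace E W]
  {S : Type*} [TopologicalSpace S] [ChartedSpace ℂ S] {σ : W → S}

theorem vertI_sq (hσ : MDifferentiable 𝓘(ℂ, E) 𝓘(ℂ, ℂ) σ) (w : W) :
    vertI hσ w * vertI hσ w = -1 := by
  ext v
  exact cplx_cplx w (v : TangentSpace 𝓘(ℝ, E) w)

theorem vertI_vertI (hσ : MDifferentiable 𝓘(ℂ, E) 𝓘(ℂ, ℂ) σ) (w : W) (v : Vert E σ w) :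
    vertI hσ w (vertI hσ w v) = -v := by
  have := congrArg (fun f => f v) (vertI_sq hσ w)
  simpa using this

theorem mdifferentiable_real (hσ : MDifferentiable 𝓘(ℂ, E) 𝓘(ℂ, ℂ) σ) :
    MDifferentiable 𝓘(ℝ, E) 𝓘(ℝ, ℂ) σ := fun w => by
  obtain ⟨hc, hd⟩ := hσ w
  exact ⟨hc, hd.restrictScalars ℝ⟩

/-- A trivialization provides a local section through `w` with constant fibre component;
differentiating `σ ∘ s = id` gives a right inverse of `dσ`. -/
theorem mfderiv_surjective {B : Type*} [NormedAddCommGroup B] [NormedSpace ℝ B]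
    {F : Type*} [TopologicalSpace F] [ChartedSpace B F]
    (hσ : MDifferentiable 𝓘(ℂ, E) 𝓘(ℂ, ℂ) σ) (hb : IsSmoothFiberBundle E B F σ) (w : W) :
    Function.Surjective (mfderiv 𝓘(ℝ, E) 𝓘(ℝ, ℂ) σ w) := by
  obtain ⟨e, he, -, hs⟩ := hb (σ w)
  have hw : w ∈ e.source := e.mem_source.2 he
  let s : S → W := fun t => e.toOpenPartialHomeomorph.symm (t, (e w).2)
  have hsw : s (σ w) = w := by
    have : (σ w, (e w).2) = e w := Prod.ext (e.coe_fst hw).symm rfl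
    simp only [s, this]
    exact e.toOpenPartialHomeomorph.left_inv hw
  have hmem : ∀ t ∈ e.baseSet, (t, (e w).2) ∈ e.target := fun t ht => e.mem_target.2 ht
  have hsd : MDifferentiableAt 𝓘(ℝ, ℂ) 𝓘(ℝ, E) s (σ w) := by
    have h1 : ContMDiffAt (𝓘(ℝ, ℂ).prod 𝓘(ℝ, B)) 𝓘(ℝ, E) ∞ e.toOpenPartialHomeomorph.symm
        (σ w, (e w).2) :=
      (hs _ (hmem _ he)).contMDiffAt (e.open_target.mem_nhds (hmem _ he))
    have h2 : ContMDiffAt 𝓘(ℝ, ℂ) (𝓘(ℝ, ℂ).prod 𝓘(ℝ, B)) ∞ (fun t : S => (t, (e w).2)) (σ w) :=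
      contMDiffAt_id.prodMk contMDiffAt_const
    exact (h1.comp (σ w) h2).mdifferentiableAt (by simp)
  have hcomp : σ ∘ s =ᶠ[𝓝 (σ w)] id := by
    filter_upwards [e.open_baseSet.mem_nhds he] with t ht
    exact e.proj_symm_apply (hmem t ht)
  have h3 := mfderiv_comp (σ w) (mdifferentiable_real hσ (s (σ w))) hsd
  rw [hcomp.mfderiv_eq, mfderiv_id, hsw] at h3
  intro v
  refine ⟨mfderiv 𝓘(ℝ, ℂ) 𝓘(ℝ, E) s (σ w) v, ?_⟩
  exact (congrArg (fun f => f v) h3).symm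

variable [IsManifold 𝓘(ℂ, E) ω W] [IsManifold 𝓘(ℂ, ℂ) ω S]
  {hσ : MDifferentiable 𝓘(ℂ, E) 𝓘(ℂ, ℂ) σ} {Ω : DForm E W 3} {h : ConformalMetric S}

namespace CompatibleMetric

variable (G : CompatibleMetric hσ Ω h)

/-- For vertical `ξ` both sides vanish: the left because all three vectors are vertical, the right
because `𝔍(0) = 0`. Removing the case distinction is what makes linearity in `ξ` usable. -/
theorem form_eq_all (hΩ : IsCRMS σ Ω) (w : W) (ξ : TangentSpace 𝓘(ℝ, E) w) (v₁ v₂ : Vert E σ w) :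
    Ω w ![ξ, v₁, v₂] = G.g w v₁ (G.J w (mfderiv 𝓘(ℝ, E) 𝓘(ℝ, ℂ) σ w ξ) v₂) := by
  by_cases hξ : mfderiv 𝓘(ℝ, E) 𝓘(ℝ, ℂ) σ w ξ = 0
  · rw [hξ, G.J_zero]
    simpa using hΩ.horizontal w ⟨ξ, hξ⟩ v₁ v₂
  · exact G.form_eq w ξ hξ v₁ v₂

theorem ext_of_g {w : W} {u u' : Vert E σ w} (huu : ∀ v, G.g w v u = G.g w v u') : u = u' := by
  by_contra hne
  have h1 := G.pos w (u - u') (sub_ne_zero.2 hne)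
  rw [map_sub, huu, sub_self] at h1
  exact lt_irrefl _ h1

variable {G} in
-- Linearity is not part of the structure: it is inherited from the first slot of `Ω`. Surjectivity
-- of `dσ` lifts the base vectors, and `g` is nondegenerate.
theorem J_add (hΩ : IsCRMS σ Ω) {w : W}
    (hs : Function.Surjective (mfderiv 𝓘(ℝ, E) 𝓘(ℝ, ℂ) σ w)) (ρ ρ' : TangentSpace 𝓘(ℝ, ℂ) (σ w)) :
    G.J w (ρ + ρ') = G.J w ρ + G.J w ρ' := by
  obtain ⟨ξ, rfl⟩ := hs ρ
  obtain ⟨ξ', rfl⟩ := hs ρ'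
  refine LinearMap.ext fun u => G.ext_of_g fun v => ?_
  rw [← map_add, ← G.form_eq_all hΩ, form_add0, G.form_eq_all hΩ, G.form_eq_all hΩ,
    LinearMap.add_apply, map_add]

variable {G} in
theorem J_smul (hΩ : IsCRMS σ Ω) {w : W}
    (hs : Function.Surjective (mfderiv 𝓘(ℝ, E) 𝓘(ℝ, ℂ) σ w)) (c : ℝ)
    (ρ : TangentSpace 𝓘(ℝ, ℂ) (σ w)) :
    G.J w (c • ρ) = c • G.J w ρ := by
  obtain ⟨ξ, rfl⟩ := hs ρ
  refine LinearMap.ext fun u => G.ext_of_g fun v => ?_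
  rw [← map_smul, ← G.form_eq_all hΩ, form_smul0, G.form_eq_all hΩ,
    LinearMap.smul_apply, map_smul, smul_eq_mul]

/-- The map `𝔍` at `w`, as a linear map on the tangent space at a point equal to `σ w`. -/
noncomputable def JL (hΩ : IsCRMS σ Ω)
    (hs : ∀ w, Function.Surjective (mfderiv 𝓘(ℝ, E) 𝓘(ℝ, ℂ) σ w)) (w : W) {t : S} (ht : t = σ w) :
    TangentSpace 𝓘(ℝ, ℂ) t →ₗ[ℝ] Module.End ℝ (Vert E σ w) where
  toFun ρ := G.J w (transport ht ρ)
  map_add' ρ ρ' := by subst ht; exact J_add hΩ (hs w) ρ ρ'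
  map_smul' c ρ := by subst ht; exact J_smul hΩ (hs w) c ρ

variable (hΩ : IsCRMS σ Ω) (hs : ∀ w, Function.Surjective (mfderiv 𝓘(ℝ, E) 𝓘(ℝ, ℂ) σ w))

theorem JL_cplx (w : W) {t : S} (ht : t = σ w) (ρ : TangentSpace 𝓘(ℝ, ℂ) t) :
    G.JL hΩ hs w ht (cplx ℂ t ρ) = vertI hσ w * G.JL hΩ hs w ht ρ := by
  subst ht
  by_cases hρ : ρ = 0
  · subst hρ; simp
  · exact G.J_cplx w ρ hρ

theorem JL_sq (w : W) {t : S} (ht : t = σ w) (ρ : TangentSpace 𝓘(ℝ, ℂ) t) :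
    G.JL hΩ hs w ht ρ * G.JL hΩ hs w ht ρ = -(h.inner t ρ ρ • (1 : Module.End ℝ (Vert E σ w))) := by
  subst ht
  by_cases hρ : ρ = 0
  · subst hρ; simp
  · exact G.J_sq w ρ hρ

end CompatibleMetric

variable (G : CompatibleMetric hσ Ω h)
  (hΩ : IsCRMS σ Ω) (hs : ∀ w, Function.Surjective (mfderiv 𝓘(ℝ, E) 𝓘(ℝ, ℂ) σ w))

theorem ConformalMetric.pos' (h : ConformalMetric S) {t : S} {ρ : TangentSpace 𝓘(ℝ, ℂ) t} (hρ : ρ ≠ 0) :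
    0 < h.inner t ρ ρ := h.pos t ρ hρ

/-- Conformality of `h` gives `|jρ| = |ρ|`, so `𝔍(jρ) = I𝔍(ρ)` has the same square as `𝔍(ρ)` and
`anticommute_of_sq` applies. -/
theorem CompatibleMetric.JL_anti (w : W) {t : S} (ht : t = σ w) (ρ : TangentSpace 𝓘(ℝ, ℂ) t) :
    vertI hσ w * G.JL hΩ hs w ht ρ = -(G.JL hΩ hs w ht ρ * vertI hσ w) := by
  by_cases hρ : ρ = 0
  · subst hρ; simp
  · refine anticommute_of_sq (h.pos' hρ).ne' (G.JL_sq hΩ hs w ht ρ) ?_ (vertI_sq hσ w)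
    rw [← G.JL_cplx hΩ hs, G.JL_sq hΩ hs, h.conformal]

/-- Each tangent space of the surface is a complex line, so the coefficients are the real and
imaginary parts of the quotient `ρ' / ρ`; the norm formula holds because `ρ` and `jρ` are orthogonal
of equal length. -/
theorem exists_rotation {t : S} {ρ : TangentSpace 𝓘(ℝ, ℂ) t} (hρ : ρ ≠ 0)
    (ρ' : TangentSpace 𝓘(ℝ, ℂ) t) : ∃ a b : ℝ, ρ' = a • ρ + b • cplx ℂ t ρ ∧
      h.inner t ρ' ρ' = (a ^ 2 + b ^ 2) * h.inner t ρ ρ := by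
  have key : ∀ z z' : ℂ, z ≠ 0 → ∃ c : ℂ, z' = c.re • z + c.im • (Complex.I • z) := by
    intro z z' hz
    refine ⟨z' / z, ?_⟩
    conv_lhs => rw [← div_mul_cancel₀ z' hz, ← Complex.re_add_im (z' / z)]
    simp only [Complex.real_smul, smul_eq_mul]
    ring
  obtain ⟨c, hc⟩ := key ρ ρ' hρ
  have h3 : ρ' = c.re • ρ + c.im • cplx ℂ t ρ := hc
  refine ⟨c.re, c.im, h3, ?_⟩
  have h4 : h.inner t ρ (cplx ℂ t ρ) = 0 := by rw [h.symm]; exact h.inner_cplx_self t ρ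
  rw [h3]
  simp only [map_add, map_smul, add_apply, smul_apply, h.conformal, h.inner_cplx_self, h4,
    smul_eq_mul]
  ring

/-- The covariant derivative of a section, as a linear map. -/
noncomputable def SmoothSection.nablaL (Z : SmoothSection E σ) (P : Connection E σ) (t : S) :
    TangentSpace 𝓘(ℝ, ℂ) t →ₗ[ℝ] Vert E σ (Z.toFun t) :=
  (P.proj (Z.toFun t)).comp (mfderiv 𝓘(ℝ, ℂ) 𝓘(ℝ, E) Z.toFun t).toLinearMap

include hΩ hs in
theorem jNablaAt_eq_of_norm_eq (P : Connection E σ) (Z : SmoothSection E σ) (t : S)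
    (ρ ρ' : TangentSpace 𝓘(ℝ, ℂ) t) (hρ : h.inner t ρ ρ = h.inner t ρ' ρ') :
    jNablaAt G P Z t ρ = jNablaAt G P Z t ρ' := by
  by_cases h0 : ρ = 0
  · have h1 : ρ' = 0 := by
      by_contra h2
      have := h.pos' h2
      rw [← hρ, h0] at this
      simp at this
    rw [h0, h1]
  · obtain ⟨a, b, hab, hn⟩ := exists_rotation (h := h) h0 ρ'
    have hab1 : a ^ 2 + b ^ 2 = 1 := by
      rw [← hρ] at hn
      exact mul_right_cancel₀ (h.pos' h0).ne' (by rw [← hn, one_mul])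
    have key := rotate_invariance (vertI hσ (Z.toFun t))
      (G.JL hΩ hs (Z.toFun t) (Z.isSection t).symm) (Z.nablaL P t)
      (cplx ℂ t).toLinearMap ρ a b hab1 (cplx_cplx t ρ) (vertI_sq hσ _)
      (G.JL_cplx hΩ hs _ _ ρ) (G.JL_anti hΩ hs _ _ ρ)
    rw [hab]
    exact key.symm

include hΩ hs in
theorem fueterStructure_sq (w : W) (a : ℝ) (ρ : TangentSpace 𝓘(ℝ, ℂ) (σ w))
    (ha : a ^ 2 + h.inner (σ w) ρ ρ = 1) :
    fueterStructure G w a ρ * fueterStructure G w a ρ = -1 :=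
  fuet_sq ha (vertI_sq hσ w) (G.JL_sq hΩ hs w rfl ρ) (G.JL_anti hΩ hs w rfl ρ)

/-- The covariant derivative of a family of sections, as a linear map. -/
noncomputable def SectionFamily.nablaL (Z : SectionFamily E σ) (P : Connection E σ) (s : ℝ) (t : S) :
    (ℝ × TangentSpace 𝓘(ℝ, ℂ) t) →ₗ[ℝ] Vert E σ (Z.toFun s t) :=
  (P.proj (Z.toFun s t)).comp (mfderiv (𝓘(ℝ, ℝ).prod 𝓘(ℝ, ℂ)) 𝓘(ℝ, E)
    (fun p : ℝ × S => Z.toFun p.1 p.2) (s, t)).toLinearMap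

include hΩ hs in
-- `Ĩ(u)∇_v Z` is bilinear in `(u, v)`, because `𝔍` is linear in `ρ`; the operator is its trace for
-- the metric `ds² + h`.
theorem fueterOperator_eq_of_orthonormal (P : Connection E σ) (Z : SectionFamily E σ) (s : ℝ) (t : S)
    (v v' : Fin 3 → ℝ × TangentSpace 𝓘(ℝ, ℂ) t)
    (hv : IsOrthonormalFrame h t v) (hv' : IsOrthonormalFrame h t v') :
    fueterOperator G P Z s t v = fueterOperator G P Z s t v' := by
  let T := ℝ × TangentSpace 𝓘(ℝ, ℂ) t
  let hin : TangentSpace 𝓘(ℝ, ℂ) t →ₗ[ℝ] TangentSpace 𝓘(ℝ, ℂ) t →ₗ[ℝ] ℝ :=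
    LinearMap.mk₂ ℝ (fun a b => h.inner t a b) (by simp) (by simp) (by simp) (by simp)
  let q : T →ₗ[ℝ] T →ₗ[ℝ] ℝ :=
    (LinearMap.mul ℝ ℝ).compl₁₂ (LinearMap.fst ℝ ℝ _) (LinearMap.fst ℝ ℝ _) +
      hin.compl₁₂ (LinearMap.snd ℝ ℝ _) (LinearMap.snd ℝ ℝ _)
  have hdim : Module.finrank ℝ T = 2 + 1 := by
    have : Module.finrank ℝ (ℝ × ℂ) = 2 + 1 := by simp
    exact this
  let JJ : T →ₗ[ℝ] Module.End ℝ (Vert E σ (Z.toFun s t)) :=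
    (LinearMap.fst ℝ ℝ _).smulRight (vertI hσ (Z.toFun s t)) -
      (G.JL hΩ hs (Z.toFun s t) (Z.isSection s t).symm).comp (LinearMap.snd ℝ ℝ _)
  exact sum_orthonormal_eq q hdim (JJ.compl₂ (Z.nablaL P s t)) v v' hv hv'

theorem SectionFamily.mfderiv_apply (Z : SectionFamily E σ) (s : ℝ) (t : S) (a : ℝ)
    (ρ : TangentSpace 𝓘(ℝ, ℂ) t) :
    mfderiv (𝓘(ℝ, ℝ).prod 𝓘(ℝ, ℂ)) 𝓘(ℝ, E) (fun p : ℝ × S => Z.toFun p.1 p.2) (s, t)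
      ((a, ρ) : ℝ × ℂ) = a • Z.velocity s t + mfderiv 𝓘(ℝ, ℂ) 𝓘(ℝ, E) (Z.toFun s) t ρ := by
  have hd : MDifferentiableAt (𝓘(ℝ, ℝ).prod 𝓘(ℝ, ℂ)) 𝓘(ℝ, E)
      (fun p : ℝ × S => Z.toFun p.1 p.2) (s, t) := Z.smooth.mdifferentiableAt (by simp)
  have h1 := mfderiv_prod_eq_add_apply (p := (s, t)) (v := ((a, ρ) : ℝ × ℂ)) hd
  refine h1.trans ?_
  congr 1
  exact Eq.trans (congrArg _ (mul_one a).symm)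
    ((mfderiv 𝓘(ℝ, ℝ) 𝓘(ℝ, E) (fun r => Z.toFun r t) s).map_smul a (1 : ℝ))

/-- `σ(Z(r, t)) = t` is constant in `r`. -/
theorem SectionFamily.velocity_mem_vert (hσ : MDifferentiable 𝓘(ℂ, E) 𝓘(ℂ, ℂ) σ)
    (Z : SectionFamily E σ) (s : ℝ) (t : S) :
    Z.velocity s t ∈ Vert E σ (Z.toFun s t) := by
  have hd : MDifferentiableAt 𝓘(ℝ, ℝ) 𝓘(ℝ, E) (fun r => Z.toFun r t) s :=
    (Z.smooth.comp (contMDiff_id.prodMk contMDiff_const) :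
      ContMDiff 𝓘(ℝ, ℝ) 𝓘(ℝ, E) ∞ (fun r => Z.toFun r t)).mdifferentiableAt (by simp)
  have h1 := mfderiv_comp s (mdifferentiable_real hσ (Z.toFun s t)) hd
  have h2 : σ ∘ (fun r => Z.toFun r t) = fun _ => t := funext fun r => Z.isSection r t
  rw [h2] at h1
  have h3 := mfderiv_const (I := 𝓘(ℝ, ℝ)) (I' := 𝓘(ℝ, ℂ)) (x := s) (c := t)
  have h4 := congrArg (fun f => f (1 : ℝ)) (h1.symm.trans h3)
  exact h4

theorem SectionFamily.nabla_ds (hσ : MDifferentiable 𝓘(ℂ, E) 𝓘(ℂ, ℂ) σ) (P : Connection E σ)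
    (Z : SectionFamily E σ) (s : ℝ) (t : S) :
    (Z.nabla P s t (1, 0) : TangentSpace 𝓘(ℝ, E) (Z.toFun s t)) = Z.velocity s t := by
  have h1 : Z.nabla P s t (1, 0) = P.proj _ (Z.velocity s t) := by
    refine congrArg (P.proj (Z.toFun s t)) ((Z.mfderiv_apply s t 1 0).trans ?_)
    rw [one_smul, map_zero, add_zero]
  rw [h1, P.proj_vert _ ⟨Z.velocity s t, Z.velocity_mem_vert hσ s t⟩]

theorem SectionFamily.nabla_slice (P : Connection E σ)
    (Z : SectionFamily E σ) (s : ℝ) (t : S) (ρ : TangentSpace 𝓘(ℝ, ℂ) t) :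
    Z.nabla P s t (0, ρ) = (Z.slice s).nabla P t ρ := by
  refine congrArg (P.proj (Z.toFun s t)) ((Z.mfderiv_apply s t 0 ρ).trans ?_)
  rw [zero_smul, zero_add]

include hΩ hs in
-- By the relations between `I` and `𝔍`, `I𝔍(ρ)(-I∇_ρ - ∇_{jρ})` equals `-𝔍(ρ)∇_ρ - 𝔍(jρ)∇_{jρ}`,
-- which is the part of the sum tangent to the surface. The vector `ρ` may have any length here.
theorem fueterOperator_adapted (P : Connection E σ) (Z : SectionFamily E σ) (s : ℝ) (t : S)
    (ρ : TangentSpace 𝓘(ℝ, ℂ) t) :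
    fueterOperator G P Z s t ![(1, 0), (0, ρ), (0, cplx ℂ t ρ)] =
      vertI hσ (Z.toFun s t) (Z.nabla P s t (1, 0) + jNablaAt G P (Z.slice s) t ρ) := by
  set I := vertI hσ (Z.toFun s t)
  set J := G.JL hΩ hs (Z.toFun s t) (Z.isSection s t).symm
  have e1 : fueterOperator G P Z s t ![(1, 0), (0, ρ), (0, cplx ℂ t ρ)] =
      ((1 : ℝ) • I - J 0) (Z.nabla P s t (1, 0)) + ((0 : ℝ) • I - J ρ) (Z.nabla P s t (0, ρ)) +
        ((0 : ℝ) • I - J (cplx ℂ t ρ)) (Z.nabla P s t (0, cplx ℂ t ρ)) := by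
    rw [fueterOperator, Fin.sum_univ_three]
    rfl
  have e2 : jNablaAt G P (Z.slice s) t ρ =
      J ρ (-(I ((Z.slice s).nabla P t ρ)) - (Z.slice s).nabla P t (cplx ℂ t ρ)) := rfl
  have hI : ∀ v, I (I v) = -v := vertI_vertI hσ _
  have hJ : ∀ v, J (cplx ℂ t ρ) v = I (J ρ v) := fun v => by
    rw [G.JL_cplx hΩ hs]; rfl
  have ha : ∀ v, J ρ (I v) = -I (J ρ v) := fun v => by
    have := congrArg (fun f => f v) (G.JL_anti hΩ hs (Z.toFun s t) (Z.isSection s t).symm ρ)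
    simp only [Module.End.mul_apply, LinearMap.neg_apply] at this
    rw [eq_neg_iff_add_eq_zero, add_comm, ← eq_neg_iff_add_eq_zero]
    exact this
  rw [e1, e2, Z.nabla_slice, Z.nabla_slice]
  simp only [map_zero, sub_zero, one_smul, zero_smul, zero_sub, LinearMap.neg_apply, hJ, map_sub,
    map_neg, map_add, ha, neg_neg, hI]
  abel

theorem isOrthonormalFrame_adapted (t : S) (ρ : TangentSpace 𝓘(ℝ, ℂ) t) (hρ : h.inner t ρ ρ = 1) :
    IsOrthonormalFrame h t ![(1, 0), (0, ρ), (0, cplx ℂ t ρ)] := by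
  have h4 : h.inner t ρ (cplx ℂ t ρ) = 0 := by rw [h.symm]; exact h.inner_cplx_self t ρ
  intro k l
  fin_cases k <;> fin_cases l <;> simp [hρ, h.conformal, h.inner_cplx_self, h4]

theorem exists_unit (h : ConformalMetric S) (t : S) :
    ∃ ρ : TangentSpace 𝓘(ℝ, ℂ) t, h.inner t ρ ρ = 1 := by
  let ρ₀ : TangentSpace 𝓘(ℝ, ℂ) t := (1 : ℂ)
  have h0 : ρ₀ ≠ 0 := one_ne_zero (α := ℂ)
  have hp := h.pos' h0
  refine ⟨(Real.sqrt (h.inner t ρ₀ ρ₀))⁻¹ • ρ₀, ?_⟩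
  simp only [map_smul, smul_apply, smul_eq_mul]
  rw [← mul_assoc, ← mul_inv, Real.mul_self_sqrt hp.le, inv_mul_cancel₀ hp.ne']

end Pointwise

/-! ### Vector fields along maps, in charts -/

section Along

variable {E : Type*} [NormedAddCommGroup E] [NormedSpace ℝ E]
  {M : Type*} [TopologicalSpace M] [ChartedSpace E M]

/-- The coordinate expression at `x` of tangent vectors, in the chart at `x₀`. -/
noncomputable def toChart (x₀ x : M) : TangentSpace 𝓘(ℝ, E) x →L[ℝ] E :=
  mfderiv 𝓘(ℝ, E) 𝓘(ℝ, E) (extChartAt 𝓘(ℝ, E) x₀) x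

/-- The tangent vector at `x` with a given coordinate expression in the chart at `x₀`. -/
noncomputable def ofChart (x₀ x : M) : E →L[ℝ] TangentSpace 𝓘(ℝ, E) x :=
  (mfderiv 𝓘(ℝ, E) 𝓘(ℝ, E) (extChartAt 𝓘(ℝ, E) x₀).symm (extChartAt 𝓘(ℝ, E) x₀ x) : E →L[ℝ] E)

variable [IsManifold 𝓘(ℝ, E) ω M]

theorem toChart_ofChart {x₀ x : M} (hx : x ∈ (chartAt E x₀).source) (e : E) :
    toChart x₀ x (ofChart x₀ x e) = e := by
  have h1 := mfderiv_extChartAt_comp_mfderivWithin_extChartAt_symm' (I := 𝓘(ℝ, E)) (x := x₀) (y := x)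
    (by rwa [extChartAt_source])
  rw [modelWithCornersSelf_coe, range_id, mfderivWithin_univ] at h1
  exact congrArg (fun f => f e) h1

theorem ofChart_toChart {x₀ x : M} (hx : x ∈ (chartAt E x₀).source) (v : TangentSpace 𝓘(ℝ, E) x) :
    ofChart x₀ x (toChart x₀ x v) = v := by
  have h1 := mfderivWithin_extChartAt_symm_comp_mfderiv_extChartAt' (I := 𝓘(ℝ, E)) (x := x₀) (y := x)
    (by rwa [extChartAt_source])
  rw [modelWithCornersSelf_coe, range_id, mfderivWithin_univ] at h1
  exact congrArg (fun f => f v) h1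

variable {E' : Type*} [NormedAddCommGroup E'] [NormedSpace ℝ E'] {H' : Type*} [TopologicalSpace H']
  {I' : ModelWithCorners ℝ E' H'} {N : Type*} [TopologicalSpace N] [ChartedSpace H' N]
  {f : N → M} {X Y : ∀ n, TangentSpace 𝓘(ℝ, E) (f n)} {n₀ : N}

variable (I') in
/-- The vector field `X` along `f` is smooth at the point `n₀`. -/
def SmoothAlongAt (f : N → M) (X : ∀ n, TangentSpace 𝓘(ℝ, E) (f n)) (n₀ : N) : Prop :=
  ContMDiffAt I' 𝓘(ℝ, E).tangent ∞ (fun n => (⟨f n, X n⟩ : TangentBundle 𝓘(ℝ, E) M)) n₀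

/-- The trivialization of the tangent bundle at `x₀` is the derivative of the chart there. Any chart
around `f n₀` may be used. Working along a map covers fields on the total space (`f = id`), fields
along a section and fields along a family at once. -/
theorem smoothAlongAt_iff {x₀ : M} (hx₀ : f n₀ ∈ (chartAt E x₀).source) :
    SmoothAlongAt I' f X n₀ ↔ ContMDiffAt I' 𝓘(ℝ, E) ∞ f n₀ ∧
      ContMDiffAt I' 𝓘(ℝ, E) ∞ (fun n => toChart x₀ (f n) (X n)) n₀ := by
  have h1 := (trivializationAt E (TangentSpace 𝓘(ℝ, E)) x₀).contMDiffAt_iff (IM := I')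
    (IB := 𝓘(ℝ, E)) (n := ∞) (f := fun n => (⟨f n, X n⟩ : TangentBundle 𝓘(ℝ, E) M)) (x₀ := n₀)
    (by rw [Bundle.Trivialization.mem_source]; exact hx₀)
  refine h1.trans (and_congr_right fun hf => ?_)
  have hf' : ∀ᶠ n in 𝓝 n₀, f n ∈ (chartAt E x₀).source :=
    hf.continuousAt.eventually ((chartAt E x₀).open_source.mem_nhds hx₀)
  refine Filter.EventuallyEq.contMDiffAt_iff ?_
  filter_upwards [hf'] with n hn
  have h2 := Bundle.Trivialization.continuousLinearMapAt_apply_of_mem (R := ℝ)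
    (trivializationAt E (TangentSpace 𝓘(ℝ, E)) x₀) (b := f n) hn (X n)
  rw [TangentBundle.continuousLinearMapAt_trivializationAt hn] at h2
  exact h2.symm

theorem SmoothAlongAt.contMDiffAt (hX : SmoothAlongAt I' f X n₀) : ContMDiffAt I' 𝓘(ℝ, E) ∞ f n₀ :=
  ((smoothAlongAt_iff (mem_chart_source E (f n₀))).1 hX).1

theorem SmoothAlongAt.toChart {x₀ : M} (hX : SmoothAlongAt I' f X n₀)
    (hx₀ : f n₀ ∈ (chartAt E x₀).source) :
    ContMDiffAt I' 𝓘(ℝ, E) ∞ (fun n => toChart x₀ (f n) (X n)) n₀ :=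
  ((smoothAlongAt_iff hx₀).1 hX).2

theorem SmoothAlongAt.add (hX : SmoothAlongAt I' f X n₀) (hY : SmoothAlongAt I' f Y n₀) :
    SmoothAlongAt I' f (fun n => X n + Y n) n₀ := by
  have hm := mem_chart_source E (f n₀)
  refine (smoothAlongAt_iff hm).2 ⟨hX.contMDiffAt, ?_⟩
  simp only [map_add]
  exact (hX.toChart hm).add (hY.toChart hm)

theorem SmoothAlongAt.smul {c : N → ℝ} (hc : ContMDiffAt I' 𝓘(ℝ, ℝ) ∞ c n₀)
    (hX : SmoothAlongAt I' f X n₀) : SmoothAlongAt I' f (fun n => c n • X n) n₀ := by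
  have hm := mem_chart_source E (f n₀)
  refine (smoothAlongAt_iff hm).2 ⟨hX.contMDiffAt, ?_⟩
  simp only [map_smul]
  exact hc.smul (hX.toChart hm)

theorem smoothAlongAt_zero (hf : ContMDiffAt I' 𝓘(ℝ, E) ∞ f n₀) :
    SmoothAlongAt I' f (fun n => (0 : TangentSpace 𝓘(ℝ, E) (f n))) n₀ := by
  refine (smoothAlongAt_iff (mem_chart_source E (f n₀))).2 ⟨hf, ?_⟩
  simp only [map_zero]
  exact contMDiffAt_const

theorem SmoothAlongAt.sum {ι : Type*} (s : Finset ι) {X : ι → ∀ n, TangentSpace 𝓘(ℝ, E) (f n)}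
    (hf : ContMDiffAt I' 𝓘(ℝ, E) ∞ f n₀) (hX : ∀ i ∈ s, SmoothAlongAt I' f (X i) n₀) :
    SmoothAlongAt I' f (fun n => ∑ i ∈ s, X i n) n₀ := by
  classical
  induction s using Finset.induction_on with
  | empty => simpa using smoothAlongAt_zero hf
  | insert i s hi ih =>
    simp only [Finset.sum_insert hi]
    exact (hX i (by simp)).add (ih fun j hj => hX j (by simp [hj]))

theorem SmoothAlongAt.congr (hX : SmoothAlongAt I' f X n₀) (hXY : ∀ᶠ n in 𝓝 n₀, Y n = X n) :
    SmoothAlongAt I' f Y n₀ :=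
  ContMDiffAt.congr_of_eventuallyEq hX (hXY.mono fun n hn => by simp only [hn])

/-- Vector fields with constant coordinate expression are smooth along any smooth map. -/
theorem smoothAlongAt_ofChart {x₀ : M} (hf : ContMDiffAt I' 𝓘(ℝ, E) ∞ f n₀)
    (hx₀ : f n₀ ∈ (chartAt E x₀).source) (e : E) :
    SmoothAlongAt I' f (fun n => ofChart x₀ (f n) e) n₀ := by
  refine (smoothAlongAt_iff hx₀).2 ⟨hf, ?_⟩
  refine ContMDiffAt.congr_of_eventuallyEq (contMDiffAt_const (c := e)) ?_
  filter_upwards [hf.continuousAt.eventually ((chartAt E x₀).open_source.mem_nhds hx₀)] with n hn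
  exact toChart_ofChart hn e

theorem SmoothAlongAt.comp {E'' : Type*} [NormedAddCommGroup E''] [NormedSpace ℝ E'']
    {H'' : Type*} [TopologicalSpace H''] {I'' : ModelWithCorners ℝ E'' H''} {K : Type*}
    [TopologicalSpace K] [ChartedSpace H'' K] {u : K → N} {k₀ : K}
    (hX : SmoothAlongAt I' f X (u k₀)) (hu : ContMDiffAt I'' I' ∞ u k₀) :
    SmoothAlongAt I'' (f ∘ u) (fun k => X (u k)) k₀ :=
  ContMDiffAt.comp k₀ hX hu

/-- A smooth form evaluated on smooth vector fields along a smooth map is a smooth function. -/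
theorem IsSmoothForm.contMDiffAt_apply {k : ℕ} {η : DForm E M k} (hη : IsSmoothForm η)
    {X : Fin k → ∀ n, TangentSpace 𝓘(ℝ, E) (f n)} (hf : ContMDiffAt I' 𝓘(ℝ, E) ∞ f n₀)
    (hX : ∀ i, SmoothAlongAt I' f (X i) n₀) :
    ContMDiffAt I' 𝓘(ℝ, ℝ) ∞ (fun n => η (f n) (fun i => X i n)) n₀ := by
  have hm := mem_chart_source E (f n₀)
  have hsrc : ∀ᶠ n in 𝓝 n₀, f n ∈ (chartAt E (f n₀)).source :=
    hf.continuousAt.eventually ((chartAt E (f n₀)).open_source.mem_nhds hm)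
  set φ := extChartAt 𝓘(ℝ, E) (f n₀) with hφ
  have h1 : ContMDiffAt I' 𝓘(ℝ, E [⋀^Fin k]→L[ℝ] ℝ) ∞ (fun n => inChart η (f n₀) (φ (f n))) n₀ := by
    have h2 : ContDiffAt ℝ ∞ (inChart η (f n₀)) (φ (f n₀)) :=
      (hη (f n₀)).contDiffAt ((isOpen_extChartAt_target _).mem_nhds (mem_extChartAt_target _))
    exact h2.contMDiffAt.comp n₀ ((contMDiffAt_extChartAt' hm).comp n₀ hf)
  have h3 : ContMDiffAt I' 𝓘(ℝ, Fin k → E) ∞ (fun n i => CRMS.toChart (f n₀) (f n) (X i n)) n₀ :=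
    contMDiffAt_pi_space.2 fun i => (hX i).toChart hm
  let L : (E [⋀^Fin k]→L[ℝ] ℝ) →L[ℝ] ContinuousMultilinearMap ℝ (fun _ : Fin k => E) ℝ :=
    ContinuousAlternatingMap.toContinuousMultilinearMapCLM ℝ
  -- Evaluation is jointly smooth in the form and in its arguments, being linear in the one and
  -- multilinear in the others.
  have h4 : ContDiff ℝ ∞ (fun p : (E [⋀^Fin k]→L[ℝ] ℝ) × (Fin k → E) => L p.1 p.2) :=
    contDiff_iff_contDiffAt.2 fun p => (L.analyticAt_uncurry_of_multilinear).contDiffAt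
  have h5 := (h4.contDiffAt.contMDiffAt (x := (inChart η (f n₀) (φ (f n₀)),
    fun i => CRMS.toChart (f n₀) (f n₀) (X i n₀)))).comp n₀ (h1.prodMk_space h3)
  refine h5.congr_of_eventuallyEq ?_
  filter_upwards [hsrc] with n hn
  have h6 : φ.symm (φ (f n)) = f n := φ.left_inv (by rwa [hφ, extChartAt_source])
  have h7 : ∀ v : Fin k → E, inChart η (f n₀) (φ (f n)) v =
      η (f n) (fun i => ofChart (f n₀) (f n) (v i)) := by
    intro v
    -- The type of the value of `η` depends on the base point, so the equality of base points is
    -- generalised before it is substituted.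
    have h8 : ∀ x' : M, x' = f n → ∀ v : Fin k → E,
      (η x' : E [⋀^Fin k]→L[ℝ] ℝ) v = (η (f n) : E [⋀^Fin k]→L[ℝ] ℝ) v := by
      rintro x' rfl v; rfl
    exact h8 _ h6 (fun i => mfderiv 𝓘(ℝ, E) 𝓘(ℝ, E) φ.symm (φ (f n)) (v i))
  change _ = inChart η (f n₀) (φ (f n)) (fun i => CRMS.toChart (f n₀) (f n) (X i n))
  rw [h7]
  congr 1
  funext i
  exact (ofChart_toChart hn _).symm

end Along

/-! ### Smoothness of the geometric operations along maps -/

section Solve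

variable {E' : Type*} [NormedAddCommGroup E'] [NormedSpace ℝ E'] {H' : Type*} [TopologicalSpace H']
  {I' : ModelWithCorners ℝ E' H'} {N : Type*} [TopologicalSpace N] [ChartedSpace H' N] {n₀ : N}
  {m : ℕ}

theorem contMDiffAt_det {A : N → Matrix (Fin m) (Fin m) ℝ}
    (hA : ∀ k l, ContMDiffAt I' 𝓘(ℝ, ℝ) ∞ (fun n => A n k l) n₀) :
    ContMDiffAt I' 𝓘(ℝ, ℝ) ∞ (fun n => (A n).det) n₀ := by
  have h1 : ContDiff ℝ ∞ (fun B : Fin m → Fin m → ℝ => Matrix.det (Matrix.of B)) := by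
    simp only [Matrix.det_apply]
    refine ContDiff.sum fun τ _ => ContDiff.const_smul _ (contDiff_prod fun i _ => ?_)
    exact (contDiff_apply ℝ ℝ i).comp (contDiff_apply ℝ (Fin m → ℝ) (τ i))
  have h2 : ContMDiffAt I' 𝓘(ℝ, Fin m → Fin m → ℝ) ∞
      (fun n => (fun k l => A n k l : Fin m → Fin m → ℝ)) n₀ :=
    contMDiffAt_pi_space.2 fun k => contMDiffAt_pi_space.2 fun l => hA k l
  have h3 : ContMDiff 𝓘(ℝ, Fin m → Fin m → ℝ) 𝓘(ℝ, ℝ) ∞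
    (fun B : Fin m → Fin m → ℝ => Matrix.det (Matrix.of B)) := h1.contMDiff
  exact ContMDiffAt.comp (I' := 𝓘(ℝ, Fin m → Fin m → ℝ)) (M' := Fin m → Fin m → ℝ) n₀
    (h3 (fun k l => A n₀ k l)) h2

/-- Solutions of nondegenerate smooth linear systems are smooth. -/
theorem contMDiffAt_of_linear_system {A : N → Matrix (Fin m) (Fin m) ℝ} {b c : N → Fin m → ℝ}
    (hA : ∀ k l, ContMDiffAt I' 𝓘(ℝ, ℝ) ∞ (fun n => A n k l) n₀)
    (hb : ∀ k, ContMDiffAt I' 𝓘(ℝ, ℝ) ∞ (fun n => b n k) n₀)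
    (hc : ∀ᶠ n in 𝓝 n₀, (A n).mulVec (c n) = b n) (hdet : (A n₀).det ≠ 0) (k : Fin m) :
    ContMDiffAt I' 𝓘(ℝ, ℝ) ∞ (fun n => c n k) n₀ := by
  have h1 := contMDiffAt_det hA
  have h2 : ContMDiffAt I' 𝓘(ℝ, ℝ) ∞ (fun n => ((A n).updateCol k (b n)).det) n₀ := by
    refine contMDiffAt_det fun i j => ?_
    by_cases hj : j = k
    · subst hj; simpa using hb i
    · simpa [Matrix.updateCol_apply, hj] using hA i j
  have h3 := h1.inv₀ hdet
  refine (h2.smul h3).congr_of_eventuallyEq ?_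
  filter_upwards [hc, h1.continuousAt.eventually_ne hdet] with n hn hn'
  -- Cramer's rule exhibits the unknown as a quotient of determinants whose denominator stays
  -- nonzero near `n₀`.
  have h4 : (A n).cramer (b n) = (A n).det • c n := by
    rw [← hn, Matrix.cramer_eq_adjugate_mulVec, Matrix.mulVec_mulVec, Matrix.adjugate_mul,
      Matrix.smul_mulVec, Matrix.one_mulVec]
  have h5 := congrFun h4 k
  rw [Matrix.cramer_apply] at h5
  change c n k = ((A n).updateCol k (b n)).det • ((A n).det)⁻¹
  rw [h5]
  simp only [Pi.smul_apply, smul_eq_mul]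
  field_simp

end Solve

/-! ### Complex structure, connection and metrics applied to smooth fields along maps -/

section Geometry

variable {E : Type*} [NormedAddCommGroup E] [NormedSpace ℂ E]
  {W : Type*} [TopologicalSpace W] [ChartedSpace E W]
  {S : Type*} [TopologicalSpace S] [ChartedSpace ℂ S] {σ : W → S}

theorem mfderiv_cplx_at {F : Type*} [NormedAddCommGroup F] [NormedSpace ℂ F]
    {M : Type*} [TopologicalSpace M] [ChartedSpace F M] {f : W → M} {w : W}
    (hf : MDifferentiableAt 𝓘(ℂ, E) 𝓘(ℂ, F) f w) (ξ : TangentSpace 𝓘(ℝ, E) w) :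
    mfderiv 𝓘(ℝ, E) 𝓘(ℝ, F) f w (cplx E w ξ) =
      cplx F (f w) (mfderiv 𝓘(ℝ, E) 𝓘(ℝ, F) f w ξ) := by
  obtain ⟨hc, hd⟩ := hf.hasMFDerivAt
  set L : E →L[ℂ] F := mfderiv 𝓘(ℂ, E) 𝓘(ℂ, F) f w with hL
  have hr : HasMFDerivAt 𝓘(ℝ, E) 𝓘(ℝ, F) f w (L.restrictScalars ℝ) :=
    ⟨hc, HasFDerivWithinAt.restrictScalars ℝ hd⟩
  rw [hr.mfderiv]
  exact L.map_smul Complex.I ξ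

variable [IsManifold 𝓘(ℂ, E) ω W]

/-- Charts are holomorphic, so `I` has constant coefficients in every chart, not only in the
preferred one at `x`. -/
theorem toChart_cplx {x₀ x : W} (hx : x ∈ (chartAt E x₀).source) (v : TangentSpace 𝓘(ℝ, E) x) :
    toChart x₀ x (cplx E x v) = Complex.I • toChart x₀ x v :=
  mfderiv_cplx_at (f := extChartAt 𝓘(ℂ, E) x₀) (mdifferentiableAt_extChartAt hx) v

variable {E' : Type*} [NormedAddCommGroup E'] [NormedSpace ℝ E'] {H' : Type*} [TopologicalSpace H']
  {I' : ModelWithCorners ℝ E' H'} {N : Type*} [TopologicalSpace N] [ChartedSpace H' N]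
  {f : N → W} {n₀ : N}

theorem SmoothAlongAt.cplx {X : ∀ n, TangentSpace 𝓘(ℝ, E) (f n)} (hX : SmoothAlongAt I' f X n₀) :
    SmoothAlongAt I' f (fun n => cplx E (f n) (X n)) n₀ := by
  have hm := mem_chart_source E (f n₀)
  refine (smoothAlongAt_iff hm).2 ⟨hX.contMDiffAt, ?_⟩
  let L : E →L[ℝ] E := ((Complex.I • ContinuousLinearMap.id ℂ E).restrictScalars ℝ : E →L[ℝ] E)
  have h1 : ContMDiffAt I' 𝓘(ℝ, E) ∞ (fun n => L (CRMS.toChart (f n₀) (f n) (X n))) n₀ :=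
    (L.contDiff.contDiffAt.contMDiffAt).comp n₀ (hX.toChart hm)
  refine h1.congr_of_eventuallyEq ?_
  filter_upwards [hX.contMDiffAt.continuousAt.eventually
    ((chartAt E (f n₀)).open_source.mem_nhds hm)] with n hn
  exact toChart_cplx hn (X n)

theorem SmoothFieldOn.smoothAlongAt {X : ∀ w : W, TangentSpace 𝓘(ℝ, E) w} {U : Set W}
    (hX : SmoothFieldOn X U) (hU : IsOpen U) (hf : ContMDiffAt I' 𝓘(ℝ, E) ∞ f n₀) (h0 : f n₀ ∈ U) :
    SmoothAlongAt I' f (fun n => X (f n)) n₀ :=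
  ((hX _ h0).contMDiffAt (hU.mem_nhds h0)).comp n₀ hf

theorem smoothFieldOn_ofChart (x₀ : W) (e : E) :
    SmoothFieldOn (fun w => ofChart x₀ w e) (chartAt E x₀).source := fun w hw =>
  (smoothAlongAt_ofChart (I' := 𝓘(ℝ, E)) (f := id) (n₀ := w) contMDiffAt_id hw e).contMDiffWithinAt

variable [FiniteDimensional ℂ E]

theorem eq_sum_ofChart {x₀ x : W} (hx : x ∈ (chartAt E x₀).source) (v : TangentSpace 𝓘(ℝ, E) x) :
    v = ∑ k, (Module.finBasis ℝ E).repr (toChart x₀ x v) k • ofChart x₀ x (Module.finBasis ℝ E k) := by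
  conv_lhs => rw [← ofChart_toChart hx v, ← (Module.finBasis ℝ E).sum_repr (toChart x₀ x v)]
  rw [map_sum]
  simp only [map_smul]

theorem SmoothAlongAt.repr {x₀ : W} {X : ∀ n, TangentSpace 𝓘(ℝ, E) (f n)}
    (hX : SmoothAlongAt I' f X n₀) (hx : f n₀ ∈ (chartAt E x₀).source)
    (k : Fin (Module.finrank ℝ E)) :
    ContMDiffAt I' 𝓘(ℝ, ℝ) ∞ (fun n =>
      (Module.finBasis ℝ E).repr (CRMS.toChart x₀ (f n) (X n)) k) n₀ :=
  let L : E →L[ℝ] ℝ := ((Module.finBasis ℝ E).coord k).toContinuousLinearMap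
  (L.contDiff.contDiffAt.contMDiffAt).comp n₀ (hX.toChart hx)

theorem Connection.smoothAlongAt_basis (P : Connection E σ) (x₀ : W) (e : E)
    (hf : ContMDiffAt I' 𝓘(ℝ, E) ∞ f n₀) (h0 : f n₀ ∈ (chartAt E x₀).source) :
    SmoothAlongAt I' f (fun n => (P.proj (f n) (ofChart x₀ (f n) e) : TangentSpace 𝓘(ℝ, E) (f n))) n₀ :=
  (P.smooth _ _ (chartAt E x₀).open_source (smoothFieldOn_ofChart x₀ e)).smoothAlongAt
    (chartAt E x₀).open_source hf h0

theorem Connection.proj_eq_sum (P : Connection E σ) {x₀ x : W} (hx : x ∈ (chartAt E x₀).source)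
    (v : TangentSpace 𝓘(ℝ, E) x) :
    P.proj x v = ∑ k, (Module.finBasis ℝ E).repr (toChart x₀ x v) k •
      P.proj x (ofChart x₀ x (Module.finBasis ℝ E k)) := by
  conv_lhs => rw [eq_sum_ofChart hx v]
  rw [map_sum]
  simp only [map_smul]

/-- The connection is only known to preserve smooth fields on open subsets of `W`. A field along `f`
is a combination, with smooth coefficients, of the coordinate fields, and those do live on an open
set. -/
theorem Connection.smoothAlongAt (P : Connection E σ) {X : ∀ n, TangentSpace 𝓘(ℝ, E) (f n)}
    (hX : SmoothAlongAt I' f X n₀) :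
    SmoothAlongAt I' f (fun n => (P.proj (f n) (X n) : TangentSpace 𝓘(ℝ, E) (f n))) n₀ := by
  have hm := mem_chart_source E (f n₀)
  have h1 := SmoothAlongAt.sum (I' := I') Finset.univ hX.contMDiffAt fun k _ =>
    SmoothAlongAt.smul (hX.repr hm k)
      (P.smoothAlongAt_basis (f n₀) (Module.finBasis ℝ E k) hX.contMDiffAt hm)
  refine h1.congr ?_
  filter_upwards [hX.contMDiffAt.continuousAt.eventually
    ((chartAt E (f n₀)).open_source.mem_nhds hm)] with n hn
  rw [P.proj_eq_sum hn (X n)]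
  simp

variable [IsManifold 𝓘(ℂ, ℂ) ω S]
  {hσ : MDifferentiable 𝓘(ℂ, E) 𝓘(ℂ, ℂ) σ} {Ω : DForm E W 3} {h : ConformalMetric S}

theorem contMDiffAt_sum' {ι : Type*} (s : Finset ι) {u : ι → N → ℝ}
    (hu : ∀ i ∈ s, ContMDiffAt I' 𝓘(ℝ, ℝ) ∞ (u i) n₀) :
    ContMDiffAt I' 𝓘(ℝ, ℝ) ∞ (fun n => ∑ i ∈ s, u i n) n₀ := by
  classical
  induction s using Finset.induction_on with
  | empty => simpa using contMDiffAt_const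
  | insert i s hi ih =>
    simp only [Finset.sum_insert hi]
    exact (hu i (by simp)).add (ih fun j hj => hu j (by simp [hj]))

/-- A vertical field is its own projection, so it expands in the projected coordinate fields; on
these, smoothness of `g` is part of the structure. The connection serves only to produce this
spanning family of `V`. -/
theorem CompatibleMetric.contMDiffAt_g (G : CompatibleMetric hσ Ω h) (P : Connection E σ)
    {X Y : ∀ n, Vert E σ (f n)}
    (hX : SmoothAlongAt I' f (fun n => (X n : TangentSpace 𝓘(ℝ, E) (f n))) n₀)
    (hY : SmoothAlongAt I' f (fun n => (Y n : TangentSpace 𝓘(ℝ, E) (f n))) n₀) :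
    ContMDiffAt I' 𝓘(ℝ, ℝ) ∞ (fun n => G.g (f n) (X n) (Y n)) n₀ := by
  have hm := mem_chart_source E (f n₀)
  have hsm : ∀ e : E, SmoothFieldOn (fun w => (P.proj w (ofChart (f n₀) w e) : TangentSpace 𝓘(ℝ, E) w))
      (chartAt E (f n₀)).source := fun e =>
    P.smooth _ _ (chartAt E (f n₀)).open_source (smoothFieldOn_ofChart (f n₀) e)
  have hg : ∀ e e' : E, ContMDiffAt I' 𝓘(ℝ, ℝ) ∞ (fun n => G.g (f n)
      (P.proj (f n) (ofChart (f n₀) (f n) e)) (P.proj (f n) (ofChart (f n₀) (f n) e'))) n₀ :=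
    fun e e' => ((G.smooth _ _ _ (chartAt E (f n₀)).open_source (hsm e) (hsm e') _ hm).contMDiffAt
      ((chartAt E (f n₀)).open_source.mem_nhds hm)).comp n₀ hX.contMDiffAt
  refine ContMDiffAt.congr_of_eventuallyEq (contMDiffAt_sum' Finset.univ fun k _ =>
    contMDiffAt_sum' Finset.univ fun l _ => (hX.repr hm k).smul ((hY.repr hm l).smul
      (hg (Module.finBasis ℝ E k) (Module.finBasis ℝ E l)))) ?_
  filter_upwards [hX.contMDiffAt.continuousAt.eventually
    ((chartAt E (f n₀)).open_source.mem_nhds hm)] with n hn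
  have e1 : X n = P.proj (f n) (X n) := (P.proj_vert _ _).symm
  have e2 : Y n = P.proj (f n) (Y n) := (P.proj_vert _ _).symm
  conv_lhs => rw [e1, e2, P.proj_eq_sum hn (X n), P.proj_eq_sum hn (Y n)]
  simp only [map_sum, map_smul, LinearMap.sum_apply, LinearMap.smul_apply, smul_eq_mul,
    Finset.mul_sum]
  rw [Finset.sum_comm]
  refine Finset.sum_congr rfl fun k _ => Finset.sum_congr rfl fun l _ => ?_
  simp only [Pi.mul_apply]
  ring

/-- A vertical vector field along `f` whose inner products with smooth vertical fields are smooth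
is smooth. -/
theorem CompatibleMetric.smoothAlongAt_of_g (G : CompatibleMetric hσ Ω h) (P : Connection E σ)
    (hf : ContMDiffAt I' 𝓘(ℝ, E) ∞ f n₀) {α : ∀ n, Vert E σ (f n)}
    (hα : ∀ X : ∀ n, Vert E σ (f n),
      SmoothAlongAt I' f (fun n => (X n : TangentSpace 𝓘(ℝ, E) (f n))) n₀ →
      ContMDiffAt I' 𝓘(ℝ, ℝ) ∞ (fun n => G.g (f n) (X n) (α n)) n₀) :
    SmoothAlongAt I' f (fun n => (α n : TangentSpace 𝓘(ℝ, E) (f n))) n₀ := by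
  have hm := mem_chart_source E (f n₀)
  have hnear := hf.continuousAt.eventually ((chartAt E (f n₀)).open_source.mem_nhds hm)
  let b := Module.finBasis ℝ E
  let X : Fin (Module.finrank ℝ E) → ∀ n, Vert E σ (f n) := fun k n =>
    P.proj (f n) (ofChart (f n₀) (f n) (b k))
  have hX : ∀ k, SmoothAlongAt I' f (fun n => (X k n : TangentSpace 𝓘(ℝ, E) (f n))) n₀ := fun k =>
    P.smoothAlongAt_basis (f n₀) (b k) hf hm
  -- The projected coordinate fields `X k` span `V` but are linearly dependent in general, so their
  -- Gram matrix is singular. Adding the Gram matrix of `Q = 1 - P` gives a positive definite `A`.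
  -- The coordinate vector `c` of `α` satisfies `Qc = 0`, so the extra term does not change the
  -- right-hand side of the system.
  let Q : Fin (Module.finrank ℝ E) → Fin (Module.finrank ℝ E) → N → ℝ := fun m k n =>
    (if k = m then 1 else 0) - b.repr (CRMS.toChart (f n₀) (f n) (X k n)) m
  have hQ : ∀ m k, ContMDiffAt I' 𝓘(ℝ, ℝ) ∞ (Q m k) n₀ := fun m k =>
    contMDiffAt_const.sub ((hX k).repr hm m)
  let A : N → Matrix (Fin (Module.finrank ℝ E)) (Fin (Module.finrank ℝ E)) ℝ := fun n k l =>
    G.g (f n) (X k n) (X l n) + ∑ m, Q m k n * Q m l n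
  let c : N → Fin (Module.finrank ℝ E) → ℝ := fun n k => b.repr (CRMS.toChart (f n₀) (f n) (α n)) k
  -- the two facts about a coordinate vector `c`
  have hPc : ∀ n (c : Fin (Module.finrank ℝ E) → ℝ), ∑ l, c l • X l n =
      P.proj (f n) (ofChart (f n₀) (f n) (∑ l, c l • b l)) := fun n c => by
    simp only [X, map_sum, map_smul]
  have hQc : ∀ n (c : Fin (Module.finrank ℝ E) → ℝ) m, ∑ l, Q m l n * c l =
      c m - b.repr (CRMS.toChart (f n₀) (f n) (∑ l, c l • X l n : Vert E σ (f n))) m := fun n c m => by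
    have : ((∑ l, c l • X l n : Vert E σ (f n)) : TangentSpace 𝓘(ℝ, E) (f n)) =
      ∑ l, c l • (X l n : TangentSpace 𝓘(ℝ, E) (f n)) := by simp
    rw [this, map_sum]
    simp only [Q, map_smul, map_sum, sub_mul, Finset.sum_sub_distrib, ite_mul, one_mul, zero_mul,
      Finset.sum_ite_eq', Finset.mem_univ, if_true, Finsupp.coe_finsetSum, Finset.sum_apply,
      Finsupp.smul_apply, smul_eq_mul]
    congr 1
    exact Finset.sum_congr rfl fun l _ => mul_comm _ _
  have hmul : ∀ n (c : Fin (Module.finrank ℝ E) → ℝ) k, (A n).mulVec c k =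
      G.g (f n) (X k n) (∑ l, c l • X l n) + ∑ m, Q m k n * ∑ l, Q m l n * c l := by
    intro n c k
    simp only [Matrix.mulVec, dotProduct, A, add_mul, Finset.sum_add_distrib, map_sum, map_smul,
      smul_eq_mul, Finset.mul_sum, Finset.sum_mul]
    congr 1
    · exact Finset.sum_congr rfl fun l _ => mul_comm _ _
    · rw [Finset.sum_comm]
      exact Finset.sum_congr rfl fun l _ => Finset.sum_congr rfl fun m _ => by ring
  have hdet : (A n₀).det ≠ 0 := by
    intro h0
    obtain ⟨c, hc0, hc⟩ := Matrix.exists_mulVec_eq_zero_iff.2 h0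
    apply hc0
    set u : Vert E σ (f n₀) := ∑ l, c l • X l n₀ with hu
    -- The quadratic form of `A` at a kernel vector `c` is a sum of nonnegative terms, so `Pc = 0`
    -- and `Qc = 0`, whence `c = Pc + Qc = 0`.
    have h1 : G.g (f n₀) u u + ∑ m, (∑ l, Q m l n₀ * c l) ^ 2 = 0 := by
      have h2 : ∑ k, c k * (A n₀).mulVec c k = 0 := by simp [hc]
      rw [← h2]
      simp only [hmul, mul_add, Finset.sum_add_distrib]
      congr 1
      · conv_lhs => rw [hu, LinearMap.map_sum₂]
        simp only [map_smul, LinearMap.smul_apply, smul_eq_mul]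
      · simp only [pow_two, Finset.sum_mul_sum]
        simp only [Finset.mul_sum]
        symm
        rw [Finset.sum_comm]
        refine Finset.sum_congr rfl fun m _ => Finset.sum_congr rfl fun l _ =>
          Finset.sum_congr rfl fun l' _ => ?_
        ring
    have hnn : 0 ≤ ∑ m, (∑ l, Q m l n₀ * c l) ^ 2 := Finset.sum_nonneg fun m _ => sq_nonneg _
    have hu0 : u = 0 := by
      by_contra hne
      have := G.pos _ u hne
      linarith
    have hs : ∑ m, (∑ l, Q m l n₀ * c l) ^ 2 = 0 := by
      rw [hu0] at h1; simpa using h1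
    funext m
    have h3 := (Finset.sum_eq_zero_iff_of_nonneg (fun m _ => sq_nonneg _)).1 hs m (Finset.mem_univ m)
    rw [sq_eq_zero_iff, hQc, ← hu, hu0] at h3
    simpa using h3
  have hsys : ∀ᶠ n in 𝓝 n₀, (A n).mulVec (c n) = fun k => G.g (f n) (X k n) (α n) := by
    filter_upwards [hnear] with n hn
    have h1 : ∑ l, c n l • X l n = α n := by
      rw [hPc, b.sum_repr, ofChart_toChart hn, P.proj_vert]
    funext k
    rw [hmul, h1]
    simp only [hQc, h1, c, sub_self, mul_zero, Finset.sum_const_zero, add_zero]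
  have hA : ∀ k l, ContMDiffAt I' 𝓘(ℝ, ℝ) ∞ (fun n => A n k l) n₀ := fun k l =>
    (G.contMDiffAt_g P (hX k) (hX l)).add
      (contMDiffAt_sum' Finset.univ fun m _ => (hQ m k).mul (hQ m l))
  have hc := contMDiffAt_of_linear_system hA (fun k => hα (X k) (hX k)) hsys hdet
  have h1 := SmoothAlongAt.sum (I' := I') Finset.univ hf fun k _ =>
    SmoothAlongAt.smul (hc k) (smoothAlongAt_ofChart (f := f) (x₀ := f n₀) hf hm (b k))
  refine h1.congr ?_
  filter_upwards [hnear] with n hn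
  exact eq_sum_ofChart hn _

theorem ConformalMetric.contMDiffAt_inner (h : ConformalMetric S) {u : N → S}
    {X Y : ∀ n, TangentSpace 𝓘(ℝ, ℂ) (u n)}
    (hX : SmoothAlongAt I' u X n₀) (hY : SmoothAlongAt I' u Y n₀) :
    ContMDiffAt I' 𝓘(ℝ, ℝ) ∞ (fun n => h.inner (u n) (X n) (Y n)) n₀ := by
  have h1 : ContMDiffAt I' (𝓘(ℝ, ℂ).prod 𝓘(ℝ, ℝ)) ∞
      (fun m ↦ Bundle.TotalSpace.mk' ℝ (E := Bundle.Trivial S ℝ) (u m) (h.inner (u m) (X m) (Y m))) n₀ := by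
    apply ContMDiffAt.clm_bundle_apply₂ (F₁ := ℂ) (F₂ := ℂ)
    · exact h.contMDiff.contMDiffAt.comp n₀ hX.contMDiffAt
    · exact hX
    · exact hY
  exact (Bundle.contMDiffAt_totalSpace.1 h1).2

end Geometry

/-! ### The zero-order term and the first-order operator -/

section Operators

/-- The pair is transformed by a matrix of determinant `a² + b²`. -/
theorem form_rotate {M : Type*} [AddCommGroup M] [Module ℝ M] [TopologicalSpace M]
    (η : M [⋀^Fin 3]→L[ℝ] ℝ) (v x y : M) (a b : ℝ) :
    η ![v, a • x + b • y, a • y - b • x] = (a ^ 2 + b ^ 2) * η ![v, x, y] := by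
  have h0 : ∀ z, η ![v, z, z] = 0 := fun z => by
    have := form_swap12 η v z z; linarith
  have e : a • y - b • x = a • y + (-b) • x := by module
  rw [e]
  simp only [form_add1, form_add2, form_smul1, form_smul2, h0]
  rw [form_swap12 η v x y]
  ring

variable {E : Type*} [NormedAddCommGroup E] [NormedSpace ℂ E]
  {W : Type*} [TopologicalSpace W] [ChartedSpace E W]
  {S : Type*} [TopologicalSpace S] [ChartedSpace ℂ S] {σ : W → S}

theorem contMDiff_proj {B : Type*} [NormedAddCommGroup B] [NormedSpace ℝ B]
    {F : Type*} [TopologicalSpace F] [ChartedSpace B F]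
    (hb : IsSmoothFiberBundle E B F σ) : ContMDiff 𝓘(ℝ, E) 𝓘(ℝ, ℂ) ∞ σ := by
  intro w
  obtain ⟨e, he, hs, -⟩ := hb (σ w)
  have hw : w ∈ e.source := e.mem_source.2 he
  have h1 : ContMDiffAt 𝓘(ℝ, E) 𝓘(ℝ, ℂ) ∞ (fun w => (e w).1) w :=
    contMDiffAt_fst.comp w ((hs w hw).contMDiffAt (e.open_source.mem_nhds hw))
  refine h1.congr_of_eventuallyEq ?_
  filter_upwards [e.open_source.mem_nhds hw] with x hx
  exact (e.coe_fst hx).symm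

theorem transport_eq {t t' : S} (ht : t = t') (ρ : TangentSpace 𝓘(ℝ, ℂ) t) :
    (transport ht ρ : ℂ) = (ρ : ℂ) := by
  subst ht; rfl

theorem transport_cplx {t t' : S} (ht : t = t') (ρ : TangentSpace 𝓘(ℝ, ℂ) t) :
    transport ht (cplx ℂ t ρ) = cplx ℂ t' (transport ht ρ) := by
  subst ht; rfl

theorem SmoothSection.mfderiv_proj (hσ : MDifferentiable 𝓘(ℂ, E) 𝓘(ℂ, ℂ) σ) (Z : SmoothSection E σ)
    (t : S) (ρ : TangentSpace 𝓘(ℝ, ℂ) t) :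
    mfderiv 𝓘(ℝ, E) 𝓘(ℝ, ℂ) σ (Z.toFun t) (mfderiv 𝓘(ℝ, ℂ) 𝓘(ℝ, E) Z.toFun t ρ) =
      transport (Z.isSection t).symm ρ := by
  have h1 := mfderiv_comp t (mdifferentiable_real hσ (Z.toFun t))
    (Z.smooth.mdifferentiableAt (by simp) : MDifferentiableAt 𝓘(ℝ, ℂ) 𝓘(ℝ, E) Z.toFun t)
  have h2 : σ ∘ Z.toFun = id := funext Z.isSection
  rw [h2, mfderiv_id] at h1
  have h3 := congrArg (fun f => f ρ) h1.symm
  exact Eq.trans (α := ℂ) h3 (transport_eq (Z.isSection t).symm ρ).symm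

variable [IsManifold 𝓘(ℂ, E) ω W]

theorem Connection.eq_zero_of_horizontal (P : Connection E σ) {w : W} {ξ : TangentSpace 𝓘(ℝ, E) w}
    (hξ : P.proj w ξ = 0) (h0 : mfderiv 𝓘(ℝ, E) 𝓘(ℝ, ℂ) σ w ξ = 0) : ξ = 0 := by
  have h1 := P.proj_vert w ⟨ξ, h0⟩
  rw [hξ] at h1
  exact (congrArg Subtype.val h1).symm

theorem Connection.eq_of_horizontal (P : Connection E σ) {w : W} {ξ ξ' : TangentSpace 𝓘(ℝ, E) w}
    (hξ : P.proj w ξ = 0) (hξ' : P.proj w ξ' = 0)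
    (h0 : mfderiv 𝓘(ℝ, E) 𝓘(ℝ, ℂ) σ w ξ = mfderiv 𝓘(ℝ, E) 𝓘(ℝ, ℂ) σ w ξ') : ξ = ξ' := by
  refine sub_eq_zero.1 (P.eq_zero_of_horizontal ?_ ?_)
  · rw [map_sub, hξ, hξ', sub_zero]
  · rw [map_sub, h0, sub_self]

theorem Connection.horizontal_part (P : Connection E σ) (w : W) (ξ : TangentSpace 𝓘(ℝ, E) w) :
    P.proj w (ξ - P.proj w ξ) = 0 ∧ mfderiv 𝓘(ℝ, E) 𝓘(ℝ, ℂ) σ w (ξ - P.proj w ξ) =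
      mfderiv 𝓘(ℝ, E) 𝓘(ℝ, ℂ) σ w ξ := by
  have h1 : mfderiv 𝓘(ℝ, E) 𝓘(ℝ, ℂ) σ w (P.proj w ξ) = 0 := (P.proj w ξ).2
  refine ⟨by rw [map_sub, P.proj_vert, sub_self], ?_⟩
  rw [map_sub, h1, sub_zero]

variable [IsManifold 𝓘(ℂ, ℂ) ω S]
  {hσ : MDifferentiable 𝓘(ℂ, E) 𝓘(ℂ, ℂ) σ} {Ω : DForm E W 3} {h : ConformalMetric S}
  (G : CompatibleMetric hσ Ω h) (P : Connection E σ)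

theorem transport_inner (h : ConformalMetric S) {t t' : S} (ht : t = t') (ρ : TangentSpace 𝓘(ℝ, ℂ) t) :
    h.inner t' (transport ht ρ) (transport ht ρ) = h.inner t ρ ρ := by
  subst ht; rfl

theorem exists_riesz [FiniteDimensional ℂ E] (w : W) (ℓ : Vert E σ w →ₗ[ℝ] ℝ) :
    ∃ a : Vert E σ w, ∀ v, G.g w v a = ℓ v := by
  have : FiniteDimensional ℝ (TangentSpace 𝓘(ℝ, E) w) :=
    inferInstanceAs (FiniteDimensional ℝ E)
  have hinj : Function.Injective (G.g w).flip := by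
    intro a a' haa
    exact G.ext_of_g fun v => congrArg (fun f => f v) haa
  have hsurj := (LinearMap.injective_iff_surjective_of_finrank_eq_finrank
    (Subspace.dual_finrank_eq (K := ℝ) (V := Vert E σ w)).symm).1 hinj
  obtain ⟨a, ha⟩ := hsurj ℓ
  exact ⟨a, fun v => congrArg (fun f => f v) ha⟩

/-- The linear functional `v ↦ Ω(v, ξ, ξ')` on the vertical space. -/
noncomputable def contractVert (Ω : DForm E W 3) (w : W) (ξ ξ' : TangentSpace 𝓘(ℝ, E) w) :
    Vert E σ w →ₗ[ℝ] ℝ where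
  toFun v := Ω w ![v, ξ, ξ']
  map_add' _ _ := form_add0 _ _ _ _ _
  map_smul' _ _ := form_smul0 _ _ _ _ _

/-- At each point `α` is the Riesz vector of `-Ω(·, ξ, ξ')` for one chosen frame. Horizontal lifts
are determined by their projections, so another positive orthonormal frame lifts to a rotation of
`ξ, ξ'`, which leaves the functional unchanged. -/
theorem exists_curvatureTerm [FiniteDimensional ℂ E]
    (hs : ∀ w, Function.Surjective (mfderiv 𝓘(ℝ, E) 𝓘(ℝ, ℂ) σ w)) :
    ∃ α : ∀ w : W, Vert E σ w, IsCurvatureTerm G P α := by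
  have key : ∀ w, ∃ a : Vert E σ w, ∀ (ξ₁ ξ₂ : TangentSpace 𝓘(ℝ, E) w),
      P.proj w ξ₁ = 0 → P.proj w ξ₂ = 0 →
      h.inner (σ w) (mfderiv 𝓘(ℝ, E) 𝓘(ℝ, ℂ) σ w ξ₁) (mfderiv 𝓘(ℝ, E) 𝓘(ℝ, ℂ) σ w ξ₁) = 1 →
      mfderiv 𝓘(ℝ, E) 𝓘(ℝ, ℂ) σ w ξ₂ = cplx ℂ (σ w) (mfderiv 𝓘(ℝ, E) 𝓘(ℝ, ℂ) σ w ξ₁) →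
      ∀ v : Vert E σ w, G.g w v a = -Ω w ![v, ξ₁, ξ₂] := by
    intro w
    obtain ⟨ρ, hρ⟩ := exists_unit h (σ w)
    obtain ⟨x, hx⟩ := hs w ρ
    obtain ⟨y, hy⟩ := hs w (cplx ℂ (σ w) ρ)
    obtain ⟨hxP, hxσ⟩ := P.horizontal_part w x
    obtain ⟨hyP, hyσ⟩ := P.horizontal_part w y
    rw [hx] at hxσ
    rw [hy] at hyσ
    set ξ := x - P.proj w x
    set ξ' := y - P.proj w y
    obtain ⟨a, ha⟩ := exists_riesz G w (-contractVert Ω w ξ ξ')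
    refine ⟨a, fun ξ₁ ξ₂ h1 h2 hn hj v => ?_⟩
    have hρ0 : ρ ≠ 0 := by
      rintro rfl
      simp at hρ
    obtain ⟨c, d, hcd, hnn⟩ := exists_rotation (h := h) hρ0 (mfderiv 𝓘(ℝ, E) 𝓘(ℝ, ℂ) σ w ξ₁)
    rw [hn, hρ, mul_one] at hnn
    have e1 : ξ₁ = c • ξ + d • ξ' := by
      refine P.eq_of_horizontal h1 ?_ ?_
      · rw [map_add, map_smul, map_smul, hxP, hyP]; simp
      · rw [map_add, map_smul, map_smul, hxσ, hyσ, hcd]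
    have e2 : ξ₂ = c • ξ' - d • ξ := by
      refine P.eq_of_horizontal h2 ?_ ?_
      · rw [map_sub, map_smul, map_smul, hxP, hyP]; simp
      · rw [map_sub, map_smul, map_smul, hxσ, hyσ, hj, hcd, map_add, map_smul, map_smul, cplx_cplx]
        module
    rw [e1, e2, form_rotate, ← hnn, one_mul]
    exact ha v
  choose α hα using key
  exact ⟨α, hα⟩

variable {G P}

/-- Both sides are quadratic under simultaneous scaling of the frame. This form is needed because
the frames that vary smoothly in charts are not normalised. -/
theorem IsCurvatureTerm.scaled {α : ∀ w : W, Vert E σ w} (hα : IsCurvatureTerm G P α) (w : W)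
    {ξ₁ ξ₂ : TangentSpace 𝓘(ℝ, E) w} (h1 : P.proj w ξ₁ = 0) (h2 : P.proj w ξ₂ = 0)
    (hj : mfderiv 𝓘(ℝ, E) 𝓘(ℝ, ℂ) σ w ξ₂ = cplx ℂ (σ w) (mfderiv 𝓘(ℝ, E) 𝓘(ℝ, ℂ) σ w ξ₁))
    (v : Vert E σ w) :
    h.inner (σ w) (mfderiv 𝓘(ℝ, E) 𝓘(ℝ, ℂ) σ w ξ₁) (mfderiv 𝓘(ℝ, E) 𝓘(ℝ, ℂ) σ w ξ₁) *
      G.g w v (α w) = -Ω w ![v, ξ₁, ξ₂] := by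
  by_cases h0 : mfderiv 𝓘(ℝ, E) 𝓘(ℝ, ℂ) σ w ξ₁ = 0
  · have e1 := P.eq_zero_of_horizontal h1 h0
    subst e1
    have h3 := form_smul1 (Ω w) 0 (v : TangentSpace 𝓘(ℝ, E) w) 0 ξ₂
    rw [zero_smul, zero_mul] at h3
    rw [h3]; simp
  · have hp := h.pos' h0
    set q := h.inner (σ w) (mfderiv 𝓘(ℝ, E) 𝓘(ℝ, ℂ) σ w ξ₁) (mfderiv 𝓘(ℝ, E) 𝓘(ℝ, ℂ) σ w ξ₁)
      with hq
    set r := (Real.sqrt q)⁻¹ with hr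
    have hrr : r * r = q⁻¹ := by
      rw [hr, ← mul_inv, Real.mul_self_sqrt hp.le]
    have h3 := hα w (r • ξ₁) (r • ξ₂) (by rw [map_smul, h1, smul_zero])
      (by rw [map_smul, h2, smul_zero])
      (by
        simp only [map_smul, smul_apply, smul_eq_mul]
        rw [← hq, ← mul_assoc, hrr, inv_mul_cancel₀ hp.ne'])
      (by rw [map_smul, map_smul, map_smul, hj]) v
    rw [h3, form_smul1, form_smul2, ← mul_assoc r, hrr]
    field_simp

theorem SmoothAlongAt.mfderiv {F : Type*} [NormedAddCommGroup F] [NormedSpace ℝ F]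
    {M : Type*} [TopologicalSpace M] [ChartedSpace F M] [IsManifold 𝓘(ℝ, F) ω M]
    {F₂ : Type*} [NormedAddCommGroup F₂] [NormedSpace ℝ F₂]
    {M₂ : Type*} [TopologicalSpace M₂] [ChartedSpace F₂ M₂] [IsManifold 𝓘(ℝ, F₂) ω M₂]
    {E' : Type*} [NormedAddCommGroup E'] [NormedSpace ℝ E'] {H' : Type*} [TopologicalSpace H']
    {I' : ModelWithCorners ℝ E' H'} {N : Type*} [TopologicalSpace N] [ChartedSpace H' N]
    {f : N → M} {n₀ : N} {X : ∀ n, TangentSpace 𝓘(ℝ, F) (f n)} (hX : SmoothAlongAt I' f X n₀)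
    {φ : M → M₂} (hφ : ContMDiff 𝓘(ℝ, F) 𝓘(ℝ, F₂) ∞ φ) :
    SmoothAlongAt I' (fun n => φ (f n)) (fun n => mfderiv 𝓘(ℝ, F) 𝓘(ℝ, F₂) φ (f n) (X n)) n₀ := by
  have h1 : ContMDiff 𝓘(ℝ, F).tangent 𝓘(ℝ, F₂).tangent ∞ (tangentMap 𝓘(ℝ, F) 𝓘(ℝ, F₂) φ) :=
    hφ.contMDiff_tangentMap (by simp)
  exact ContMDiffAt.comp n₀ (h1 _) hX

theorem IsSmoothForm.contMDiffAt_three {F : Type*} [NormedAddCommGroup F] [NormedSpace ℝ F]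
    {M : Type*} [TopologicalSpace M] [ChartedSpace F M] [IsManifold 𝓘(ℝ, F) ω M]
    {E' : Type*} [NormedAddCommGroup E'] [NormedSpace ℝ E'] {H' : Type*} [TopologicalSpace H']
    {I' : ModelWithCorners ℝ E' H'} {N : Type*} [TopologicalSpace N] [ChartedSpace H' N]
    {f : N → M} {n₀ : N} {η : DForm F M 3} (hη : IsSmoothForm η)
    {X Y Z : ∀ n, TangentSpace 𝓘(ℝ, F) (f n)} (hX : SmoothAlongAt I' f X n₀)
    (hY : SmoothAlongAt I' f Y n₀) (hZ : SmoothAlongAt I' f Z n₀) :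
    ContMDiffAt I' 𝓘(ℝ, ℝ) ∞ (fun n => η (f n) ![X n, Y n, Z n]) n₀ := by
  have h1 := hη.contMDiffAt_apply (I' := I') (f := f) (n₀ := n₀) (X := fun i n => ![X n, Y n, Z n] i)
    hX.contMDiffAt (by
      intro i
      fin_cases i
      · exact hX
      · exact hY
      · exact hZ)
  exact h1

theorem SmoothAlongAt.sub {F : Type*} [NormedAddCommGroup F] [NormedSpace ℝ F]
    {M : Type*} [TopologicalSpace M] [ChartedSpace F M] [IsManifold 𝓘(ℝ, F) ω M]
    {E' : Type*} [NormedAddCommGroup E'] [NormedSpace ℝ E'] {H' : Type*} [TopologicalSpace H']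
    {I' : ModelWithCorners ℝ E' H'} {N : Type*} [TopologicalSpace N] [ChartedSpace H' N]
    {f : N → M} {n₀ : N} {X Y : ∀ n, TangentSpace 𝓘(ℝ, F) (f n)} (hX : SmoothAlongAt I' f X n₀)
    (hY : SmoothAlongAt I' f Y n₀) : SmoothAlongAt I' f (fun n => X n - Y n) n₀ := by
  have h1 := hX.add (SmoothAlongAt.smul (c := fun _ => (-1 : ℝ)) contMDiffAt_const hY)
  refine h1.congr (Eventually.of_forall fun n => ?_)
  module

/-- Take a coordinate field `e` with `dσ(e) ≠ 0` near `w₀`. As `σ` is holomorphic, the horizontal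
parts of `e` and `Ie` lift a conformal frame, and `g(X, α)` is `-Ω(X, ·, ·)` on them divided by
`|dσ(e)|²`, a smooth function for every smooth vertical `X`. -/
theorem IsCurvatureTerm.smooth [FiniteDimensional ℂ E] {B : Type*} [NormedAddCommGroup B]
    [NormedSpace ℝ B] {F : Type*} [TopologicalSpace F] [ChartedSpace B F]
    (hb : IsSmoothFiberBundle E B F σ) (hΩ : IsCRMS σ Ω)
    {α : ∀ w : W, Vert E σ w} (hα : IsCurvatureTerm G P α) :
    SmoothFieldOn (fun w => (α w : TangentSpace 𝓘(ℝ, E) w)) Set.univ := by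
  have hs := mfderiv_surjective hσ hb
  intro w₀ _
  have hm := mem_chart_source E w₀
  refine (G.smoothAlongAt_of_g (I' := 𝓘(ℝ, E)) (f := id) (n₀ := w₀) P contMDiffAt_id (α := α)
    fun X hX => ?_ : SmoothAlongAt 𝓘(ℝ, E) (id : W → W) _ w₀).contMDiffWithinAt
  obtain ⟨x, hx⟩ := hs w₀ (1 : ℂ)
  let e : ∀ w : W, TangentSpace 𝓘(ℝ, E) w := fun w => ofChart w₀ w (toChart w₀ w₀ x)
  have he0 : mfderiv 𝓘(ℝ, E) 𝓘(ℝ, ℂ) σ w₀ (e w₀) ≠ 0 := by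
    simp only [e, ofChart_toChart hm, hx]
    exact one_ne_zero (α := ℂ)
  have he : SmoothAlongAt 𝓘(ℝ, E) (id : W → W) e w₀ :=
    smoothAlongAt_ofChart (f := id) contMDiffAt_id hm _
  have hσe : SmoothAlongAt 𝓘(ℝ, E) σ (fun w => mfderiv 𝓘(ℝ, E) 𝓘(ℝ, ℂ) σ w (e w)) w₀ :=
    he.mfderiv (contMDiff_proj hb)
  have hh := h.contMDiffAt_inner hσe hσe
  have hΩs := hΩ.smooth.contMDiffAt_three hX (he.sub (P.smoothAlongAt he))
    (he.cplx.sub (P.smoothAlongAt he.cplx))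
  have hpos := h.pos' he0
  refine ((hΩs.smul (hh.inv₀ hpos.ne')).neg).congr_of_eventuallyEq ?_
  filter_upwards [hh.continuousAt.eventually_ne hpos.ne'] with w hw
  obtain ⟨a1, a2⟩ := P.horizontal_part w (e w)
  obtain ⟨b1, b2⟩ := P.horizontal_part w (cplx E w (e w))
  let X' : ∀ w, Vert E σ w := X
  have h3 := hα.scaled w a1 b1 (by rw [b2, a2, mfderiv_cplx hσ]) (X' w)
  rw [a2] at h3
  change G.g w (X' w) (α w) = -(Ω w ![((X' w : Vert E σ w) : TangentSpace 𝓘(ℝ, E) w), e w - P.proj w (e w),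
    cplx E w (e w) - P.proj w (cplx E w (e w))] *
      (h.inner (σ w) (mfderiv 𝓘(ℝ, E) 𝓘(ℝ, ℂ) σ w (e w)) (mfderiv 𝓘(ℝ, E) 𝓘(ℝ, ℂ) σ w (e w)))⁻¹)
  have hw' : h.inner (σ w) (mfderiv 𝓘(ℝ, E) 𝓘(ℝ, ℂ) σ w (e w))
    (mfderiv 𝓘(ℝ, E) 𝓘(ℝ, ℂ) σ w (e w)) ≠ 0 := hw
  rw [← neg_mul, ← h3, mul_comm, inv_mul_cancel_left₀ hw']

/-- Decompose `dZ ρ` and `dZ jρ` into horizontal and vertical parts and expand `Ω(v, ·, ·)`. The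
horizontal pair gives `-|ρ|² g(v, α)`; the two mixed terms give `g(v, 𝔍(jρ)∇_ρ Z - 𝔍(ρ)∇_{jρ} Z)`;
three vertical arguments give zero. -/
theorem g_jNablaAt (hΩ : IsCRMS σ Ω)
    (hs : ∀ w, Function.Surjective (mfderiv 𝓘(ℝ, E) 𝓘(ℝ, ℂ) σ w))
    {α : ∀ w : W, Vert E σ w} (hα : IsCurvatureTerm G P α) (Z : SmoothSection E σ) (t : S)
    (ρ : TangentSpace 𝓘(ℝ, ℂ) t) (v : Vert E σ (Z.toFun t)) :
    G.g (Z.toFun t) v (jNablaAt G P Z t ρ) - h.inner t ρ ρ * G.g (Z.toFun t) v (α (Z.toFun t)) =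
      Ω (Z.toFun t) ![v, mfderiv 𝓘(ℝ, ℂ) 𝓘(ℝ, E) Z.toFun t ρ,
        mfderiv 𝓘(ℝ, ℂ) 𝓘(ℝ, E) Z.toFun t (cplx ℂ t ρ)] := by
  revert v
  set w := Z.toFun t
  intro v
  have ht : t = σ w := (Z.isSection t).symm
  set x : TangentSpace 𝓘(ℝ, E) w := mfderiv 𝓘(ℝ, ℂ) 𝓘(ℝ, E) Z.toFun t ρ with hxd
  set y : TangentSpace 𝓘(ℝ, E) w := mfderiv 𝓘(ℝ, ℂ) 𝓘(ℝ, E) Z.toFun t (cplx ℂ t ρ) with hyd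
  have hx : mfderiv 𝓘(ℝ, E) 𝓘(ℝ, ℂ) σ w x = transport ht ρ := Z.mfderiv_proj hσ t ρ
  have hy : mfderiv 𝓘(ℝ, E) 𝓘(ℝ, ℂ) σ w y = transport ht (cplx ℂ t ρ) := Z.mfderiv_proj hσ t _
  obtain ⟨hxP, hxσ⟩ := P.horizontal_part w x
  obtain ⟨hyP, hyσ⟩ := P.horizontal_part w y
  rw [hx] at hxσ
  rw [hy] at hyσ
  have hn1 : P.proj w x = Z.nabla P t ρ := rfl
  have hn2 : P.proj w y = Z.nabla P t (cplx ℂ t ρ) := rfl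
  have hsc := hα.scaled w hxP hyP (by rw [hyσ, hxσ, transport_cplx]) v
  rw [hxσ] at hsc
  rw [transport_inner] at hsc
  set p := P.proj w x with hp
  set q := P.proj w y with hqd
  have hx' : x = (x - p) + p := (sub_add_cancel x _).symm
  have hy' : y = (y - q) + q := (sub_add_cancel y _).symm
  have e1 : Ω w ![v, x, y] = Ω w ![v, x - p, y - q] + Ω w ![v, p, y - q] +
      (Ω w ![v, x - p, q] + Ω w ![v, p, q]) := by
    conv_lhs => rw [hx', hy']
    rw [form_add2, form_add1, form_add1]
  have e2 : Ω w ![v, p, y - q] = G.g w v (G.JL hΩ hs w ht (cplx ℂ t ρ) p) := by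
    rw [form_swap12, form_swap01, neg_neg, G.form_eq_all hΩ, hyσ]
    rfl
  have e3 : Ω w ![v, x - p, q] = -G.g w v (G.JL hΩ hs w ht ρ q) := by
    rw [form_swap01, G.form_eq_all hΩ, hxσ]
    rfl
  -- `𝔍(jρ) = I𝔍(ρ) = -𝔍(ρ)I` turns the definition of `𝔍_∇Z(ρ)` into the sum of the mixed terms.
  have e4 : jNablaAt G P Z t ρ = G.JL hΩ hs w ht (cplx ℂ t ρ) p - G.JL hΩ hs w ht ρ q := by
    have ha := congrArg (fun f => f p) (G.JL_anti hΩ hs w ht ρ)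
    simp only [Module.End.mul_apply, LinearMap.neg_apply] at ha
    have e5 : jNablaAt G P Z t ρ = G.JL hΩ hs w ht ρ (-(vertI hσ w p) - q) := rfl
    rw [e5, map_sub, map_neg, G.JL_cplx hΩ hs, Module.End.mul_apply, ha]
  rw [e1, e2, e3, hΩ.horizontal, e4, map_sub]
  linarith

/-- The operator `𝔍_∇`. -/
noncomputable def jNabla (G : CompatibleMetric hσ Ω h) (P : Connection E σ) (Z : SmoothSection E σ)
    (t : S) : Vert E σ (Z.toFun t) :=
  jNablaAt G P Z t (exists_unit h t).choose

/-- The key link between the gradient and `Ω`. The case of the chosen unit vector is `g_jNablaAt`;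
for general `ρ`, rotating and scaling multiplies the right-hand side by `|ρ|²`. Arbitrary length is
allowed so that `ρ` can be a coordinate vector in the integrals. -/
theorem g_jNabla (hΩ : IsCRMS σ Ω)
    (hs : ∀ w, Function.Surjective (mfderiv 𝓘(ℝ, E) 𝓘(ℝ, ℂ) σ w))
    {α : ∀ w : W, Vert E σ w} (hα : IsCurvatureTerm G P α) (Z : SmoothSection E σ) (t : S)
    (ρ : TangentSpace 𝓘(ℝ, ℂ) t) (v : Vert E σ (Z.toFun t)) :
    h.inner t ρ ρ * G.g (Z.toFun t) v (jNabla G P Z t - α (Z.toFun t)) =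
      Ω (Z.toFun t) ![v, mfderiv 𝓘(ℝ, ℂ) 𝓘(ℝ, E) Z.toFun t ρ,
        mfderiv 𝓘(ℝ, ℂ) 𝓘(ℝ, E) Z.toFun t (cplx ℂ t ρ)] := by
  have hu := (exists_unit h t).choose_spec
  set ρ₀ := (exists_unit h t).choose
  have h1 := g_jNablaAt hΩ hs hα Z t ρ₀ v
  rw [hu, one_mul] at h1
  have hρ0 : ρ₀ ≠ 0 := by
    intro h0
    rw [h0] at hu
    simp at hu
  obtain ⟨a, b, hab, hn⟩ := exists_rotation (h := h) hρ0 ρ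
  rw [hu, mul_one] at hn
  have hj : cplx ℂ t ρ = a • cplx ℂ t ρ₀ - b • ρ₀ := by
    rw [hab, map_add, map_smul, map_smul, cplx_cplx]; module
  let L : TangentSpace 𝓘(ℝ, ℂ) t →L[ℝ] TangentSpace 𝓘(ℝ, E) (Z.toFun t) :=
    mfderiv 𝓘(ℝ, ℂ) 𝓘(ℝ, E) Z.toFun t
  have e1 : L ρ = a • L ρ₀ + b • L (cplx ℂ t ρ₀) := by rw [hab, map_add, map_smul, map_smul]
  have e2 : L (cplx ℂ t ρ) = a • L (cplx ℂ t ρ₀) - b • L ρ₀ := by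
    rw [hj, map_sub, map_smul, map_smul]
  change _ = Ω (Z.toFun t) ![v, L ρ, L (cplx ℂ t ρ)]
  rw [e1, e2, form_rotate, hn, map_sub]
  exact congrArg _ h1

/-- The chosen unit vectors need not vary smoothly with `t`, so smoothness comes from `g_jNabla`
with a coordinate field in place of `ρ`: the inner products with smooth fields are visibly smooth.
-/
theorem jNabla_sub_smooth [FiniteDimensional ℂ E] (hΩ : IsCRMS σ Ω)
    (hs : ∀ w, Function.Surjective (mfderiv 𝓘(ℝ, E) 𝓘(ℝ, ℂ) σ w))
    {α : ∀ w : W, Vert E σ w} (hα : IsCurvatureTerm G P α) (Z : SmoothSection E σ) :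
    Z.SmoothAlong (fun t => jNabla G P Z t - α (Z.toFun t)) := by
  intro t₀
  have hm := mem_chart_source ℂ t₀
  refine (G.smoothAlongAt_of_g (I' := 𝓘(ℝ, ℂ)) (f := Z.toFun) (n₀ := t₀) P Z.smooth.contMDiffAt
    fun X hX => ?_ : SmoothAlongAt 𝓘(ℝ, ℂ) Z.toFun _ t₀)
  let e : ∀ t : S, TangentSpace 𝓘(ℝ, ℂ) t := fun t => ofChart t₀ t (1 : ℂ)
  have he0 : e t₀ ≠ 0 := by
    intro h0
    have h1 := toChart_ofChart (M := S) hm (1 : ℂ)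
    have h2 : ofChart t₀ t₀ (1 : ℂ) = 0 := h0
    rw [h2, map_zero] at h1
    exact zero_ne_one h1
  have he : SmoothAlongAt 𝓘(ℝ, ℂ) (id : S → S) e t₀ :=
    smoothAlongAt_ofChart (f := id) contMDiffAt_id hm _
  have hh := h.contMDiffAt_inner he he
  have hΩs := hΩ.smooth.contMDiffAt_three hX (he.mfderiv Z.smooth) (he.cplx.mfderiv Z.smooth)
  have hpos := h.pos' he0
  refine (hΩs.smul (hh.inv₀ hpos.ne')).congr_of_eventuallyEq ?_
  filter_upwards [hh.continuousAt.eventually_ne hpos.ne'] with t ht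
  have h3 := g_jNabla hΩ hs hα Z t (e t) (X t)
  change _ = Ω (Z.toFun t) ![(X t : TangentSpace 𝓘(ℝ, E) (Z.toFun t)),
    mfderiv 𝓘(ℝ, ℂ) 𝓘(ℝ, E) Z.toFun t (e t),
    mfderiv 𝓘(ℝ, ℂ) 𝓘(ℝ, E) Z.toFun t (cplx ℂ t (e t))] * (h.inner t (e t) (e t))⁻¹
  have ht' : h.inner t (e t) (e t) ≠ 0 := ht
  rw [← h3, mul_comm, inv_mul_cancel_left₀ ht']

theorem jNabla_smooth [FiniteDimensional ℂ E] (hΩ : IsCRMS σ Ω)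
    (hs : ∀ w, Function.Surjective (mfderiv 𝓘(ℝ, E) 𝓘(ℝ, ℂ) σ w))
    {α : ∀ w : W, Vert E σ w} (hα : IsCurvatureTerm G P α)
    (hα' : SmoothFieldOn (fun w => (α w : TangentSpace 𝓘(ℝ, E) w)) Set.univ) (Z : SmoothSection E σ) :
    Z.SmoothAlong (jNabla G P Z) := by
  intro t₀
  have h1 : SmoothAlongAt 𝓘(ℝ, ℂ) Z.toFun
      (fun t => ((jNabla G P Z t - α (Z.toFun t) : Vert E σ (Z.toFun t)) :
        TangentSpace 𝓘(ℝ, E) (Z.toFun t))) t₀ := jNabla_sub_smooth hΩ hs hα Z t₀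
  have h2 := hα'.smoothAlongAt (I' := 𝓘(ℝ, ℂ)) (f := Z.toFun) (n₀ := t₀) isOpen_univ
    Z.smooth.contMDiffAt (mem_univ _)
  refine ((h1.add h2).congr (Eventually.of_forall fun t => ?_) :
    SmoothAlongAt 𝓘(ℝ, ℂ) Z.toFun (fun t => (jNabla G P Z t : TangentSpace 𝓘(ℝ, E) (Z.toFun t))) t₀)
  rw [Submodule.coe_sub, sub_add_cancel]

end Operators

/-! ### Stokes' theorem on a closed Riemann surface -/

section Calculus

variable {T K : Set ℂ}

theorem integrableOn_of_eq_zero_off_compact {f : ℂ → ℝ} (hK : IsCompact K)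
    (hKT : K ⊆ T) (hT : MeasurableSet T) (hf : ContinuousOn f T) (h0 : ∀ y ∈ T \ K, f y = 0) :
    IntegrableOn f T := by
  have h1 : IntegrableOn f K := (hf.mono hKT).integrableOn_compact hK
  exact h1.of_forall_sdiff_eq_zero hT h0

theorem contDiff_indicator {c : ℂ → ℝ} {n : ℕ∞} (hT : IsOpen T) (hK : IsCompact K)
    (hKT : K ⊆ T) (hc : ContDiffOn ℝ n c T) (h0 : ∀ y ∈ T \ K, c y = 0) :
    ContDiff ℝ n (T.indicator c) := by
  rw [contDiff_iff_contDiffAt]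
  intro y
  by_cases hy : y ∈ T
  · refine (hc.contDiffAt (hT.mem_nhds hy)).congr_of_eventuallyEq ?_
    filter_upwards [hT.mem_nhds hy] with z hz
    exact indicator_of_mem hz c
  · have hy' : y ∈ Kᶜ := fun h => hy (hKT h)
    refine (contDiffAt_const (c := (0 : ℝ))).congr_of_eventuallyEq ?_
    filter_upwards [hK.isClosed.isOpen_compl.mem_nhds hy'] with z hz
    by_cases hzT : z ∈ T
    · rw [indicator_of_mem hzT, h0 z ⟨hzT, hz⟩]
    · exact indicator_of_notMem hzT c

/-- Integration by parts without boundary term. Extending `c` by zero gives a smooth compactly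
supported function on the plane; values of `u` outside `T` are irrelevant, since they are multiplied
by zero. -/
theorem setIntegral_mul_fderiv {c u : ℂ → ℝ} (hT : IsOpen T) (hK : IsCompact K) (hKT : K ⊆ T)
    (hc : ContDiffOn ℝ ∞ c T) (h0 : ∀ y ∈ T \ K, c y = 0) (hu : ContDiffOn ℝ ∞ u T) (v : ℂ) :
    ∫ y in T, c y * fderiv ℝ u y v = -∫ y in T, fderiv ℝ c y v * u y := by
  set f := T.indicator c with hf
  have hfs : ContDiff ℝ ∞ f := contDiff_indicator hT hK hKT hc h0
  have hfT : ∀ y ∈ T, f y = c y := fun y hy => indicator_of_mem hy c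
  have hf0 : ∀ y ∉ K, f y = 0 := fun y hy => by
    by_cases hyT : y ∈ T
    · rw [hfT y hyT, h0 y ⟨hyT, hy⟩]
    · exact indicator_of_notMem hyT c
  have hsupp : tsupport f ⊆ K := closure_minimal (fun y hy => by_contra fun h => hy (hf0 y h))
    hK.isClosed
  have hfd : ∀ y ∈ T, fderiv ℝ f y = fderiv ℝ c y := fun y hy => by
    apply Filter.EventuallyEq.fderiv_eq
    filter_upwards [hT.mem_nhds hy] with z hz using hfT z hz
  have hfd0 : ∀ y ∉ K, fderiv ℝ f y = 0 := fun y hy => by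
    have : f =ᶠ[𝓝 y] fun _ => 0 := by
      filter_upwards [hK.isClosed.isOpen_compl.mem_nhds hy] with z hz using hf0 z hz
    rw [this.fderiv_eq]; simp
  have hucont : ContinuousOn u T := hu.continuousOn
  have hudcont : ContinuousOn (fun y => fderiv ℝ u y v) T :=
    (hu.continuousOn_fderiv_of_isOpen hT (by simp)).clm_apply continuousOn_const
  have hfdc : Continuous (fun y => fderiv ℝ f y v) :=
    (hfs.continuous_fderiv (by simp)).clm_apply continuous_const
  have hint : ∀ p : ℂ → ℝ, ContinuousOn p T → (∀ y ∉ K, p y = 0) → Integrable p := by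
    intro p hp hp0
    have h1 : IntegrableOn p K := (hp.mono hKT).integrableOn_compact hK
    rw [← integrableOn_univ]
    exact h1.of_forall_sdiff_eq_zero MeasurableSet.univ fun y hy => hp0 y hy.2
  have h1 := integral_mul_fderiv_eq_neg_fderiv_mul_of_integrable (μ := volume) (f := f) (g := u)
    (v := v)
    (hint _ (hfdc.continuousOn.mul hucont) fun y hy => by rw [hfd0 y hy]; simp)
    (hint _ (hfs.continuous.continuousOn.mul hudcont) fun y hy => by rw [hf0 y hy]; simp)
    (hint _ (hfs.continuous.continuousOn.mul hucont) fun y hy => by rw [hf0 y hy]; simp)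
    (fun y _ => hfs.differentiable (by simp) y)
    (fun y hy => (hu.contDiffAt (hT.mem_nhds (hKT (hsupp hy)))).differentiableAt (by simp))
  have h2 : ∫ y in T, c y * fderiv ℝ u y v = ∫ y, f y * fderiv ℝ u y v := by
    refine Eq.trans ?_ (setIntegral_eq_integral_of_forall_compl_eq_zero (s := T)
      (f := fun y => f y * fderiv ℝ u y v) (fun y hy => by rw [hf0 y fun h => hy (hKT h)]; simp))
    exact setIntegral_congr_fun hT.measurableSet fun y hy => by simp only [hfT y hy]
  have h3 : ∫ y in T, fderiv ℝ c y v * u y = ∫ y, fderiv ℝ f y v * u y := by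
    refine Eq.trans ?_ (setIntegral_eq_integral_of_forall_compl_eq_zero (s := T)
      (f := fun y => fderiv ℝ f y v * u y) (fun y hy => by rw [hfd0 y fun h => hy (hKT h)]; simp))
    exact setIntegral_congr_fun hT.measurableSet fun y hy => by simp only [hfd y hy]
  rw [h2, h3, h1]

theorem det_of_complex_mul {L : ℂ →L[ℝ] ℂ} {c : ℂ} (hL : ∀ v, L v = c * v) :
    |L.det| = Complex.normSq c := by
  have h1 : (L : ℂ →ₗ[ℝ] ℂ) = Algebra.lmul ℝ ℂ c := LinearMap.ext hL
  have h2 : L.det = Algebra.norm ℝ c := by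
    rw [ContinuousLinearMap.det, h1, Algebra.norm_apply]
  rw [h2, Algebra.norm_complex_apply, abs_of_nonneg (Complex.normSq_nonneg c)]

end Calculus

/-! ### Holomorphic changes of chart and the chart independence of integrals -/

section Surface

variable {S : Type*} [TopologicalSpace S] [ChartedSpace ℂ S]

/-- The derivative of the inverse of the chart at `i`. -/
noncomputable def chartD (i : S) (y : ℂ) : ℂ →L[ℝ] ℂ :=
  mfderiv 𝓘(ℝ, ℂ) 𝓘(ℝ, ℂ) (extChartAt 𝓘(ℝ, ℂ) i).symm y

variable [IsManifold 𝓘(ℂ, ℂ) ω S]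

theorem chartD_mul {i : S} {y : ℂ} (hy : y ∈ (extChartAt 𝓘(ℝ, ℂ) i).target) (c v : ℂ) :
    chartD i y (c * v) = c * chartD i y v := by
  have hd : MDifferentiableAt 𝓘(ℂ, ℂ) 𝓘(ℂ, ℂ) (extChartAt 𝓘(ℂ, ℂ) i).symm y := by
    have h1 := mdifferentiableWithinAt_extChartAt_symm (I := 𝓘(ℂ, ℂ)) (x := i) (z := y) hy
    rwa [modelWithCornersSelf_coe, range_id, mdifferentiableWithinAt_univ] at h1
  have hI : ∀ u : ℂ, chartD i y (Complex.I * u) = Complex.I * chartD i y u := fun u =>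
    mfderiv_cplx_at hd u
  conv_lhs => rw [← Complex.re_add_im c]
  conv_rhs => rw [← Complex.re_add_im c]
  have e : ((c.re : ℂ) + c.im * Complex.I) * v = c.re • v + c.im • (Complex.I * v) := by
    simp only [Complex.real_smul]; ring
  rw [e, map_add, map_smul, map_smul, hI]
  simp only [Complex.real_smul]; ring

/-- The derivatives of the inverse charts commute with multiplication by complex numbers, so the
derivative of the transition map is multiplication by its value at `1`. -/
theorem chart_transition {i j : S} {y : ℂ} (hy : y ∈ (extChartAt 𝓘(ℝ, ℂ) i).target)
    (hj : (extChartAt 𝓘(ℝ, ℂ) i).symm y ∈ (extChartAt 𝓘(ℝ, ℂ) j).source) :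
    ∃ c : ℂ, ∃ L : ℂ →L[ℝ] ℂ, (∀ v, L v = c * v) ∧
      HasFDerivAt (fun z => extChartAt 𝓘(ℝ, ℂ) j ((extChartAt 𝓘(ℝ, ℂ) i).symm z)) L y ∧
      ∀ v, chartD i y v = chartD j (extChartAt 𝓘(ℝ, ℂ) j ((extChartAt 𝓘(ℝ, ℂ) i).symm y)) (c * v) := by
  set p := (extChartAt 𝓘(ℝ, ℂ) i).symm y with hp
  have hd1 : MDifferentiableAt 𝓘(ℝ, ℂ) 𝓘(ℝ, ℂ) (extChartAt 𝓘(ℝ, ℂ) i).symm y := by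
    have h1 := mdifferentiableWithinAt_extChartAt_symm (I := 𝓘(ℝ, ℂ)) (x := i) (z := y) hy
    rwa [modelWithCornersSelf_coe, range_id, mdifferentiableWithinAt_univ] at h1
  have hj' : p ∈ (chartAt ℂ j).source := by rwa [extChartAt_source] at hj
  have hd2 : MDifferentiableAt 𝓘(ℝ, ℂ) 𝓘(ℝ, ℂ) (extChartAt 𝓘(ℝ, ℂ) j) p :=
    mdifferentiableAt_extChartAt hj'
  have h3 := (hd2.hasMFDerivAt.comp y hd1.hasMFDerivAt).hasFDerivAt
  set L : ℂ →L[ℝ] ℂ := (mfderiv 𝓘(ℝ, ℂ) 𝓘(ℝ, ℂ) (extChartAt 𝓘(ℝ, ℂ) j) p : ℂ →L[ℝ] ℂ).comp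
    (chartD i y) with hL
  have hLv : ∀ v, L v = toChart j p (chartD i y v : ℂ) := fun v => rfl
  have hof : ∀ v, chartD i y v = chartD j (extChartAt 𝓘(ℝ, ℂ) j p) (L v) := fun v =>
    (ofChart_toChart hj' (chartD i y v : ℂ)).symm
  have hinj : ∀ a b : ℂ, chartD j (extChartAt 𝓘(ℝ, ℂ) j p) a =
      chartD j (extChartAt 𝓘(ℝ, ℂ) j p) b → a = b := fun a b hab => by
    have h4 := toChart_ofChart (M := S) hj' a
    have h5 := toChart_ofChart (M := S) hj' b
    have h6 : ofChart j p a = ofChart j p b := hab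
    rw [← h4, h6, h5]
  have hT : extChartAt 𝓘(ℝ, ℂ) j p ∈ (extChartAt 𝓘(ℝ, ℂ) j).target :=
    (extChartAt 𝓘(ℝ, ℂ) j).map_source hj
  have hmul : ∀ v, L v = L 1 * v := fun v => by
    apply hinj
    rw [← hof, mul_comm, chartD_mul hT, ← hof, ← chartD_mul hy, mul_one]
  exact ⟨L 1, L, hmul, h3, fun v => by rw [hof v, hmul v]⟩

/-- The integral of a conformally weighted density supported in two chart domains can be computed
in either chart. -/
theorem setIntegral_density_eq {q : S → ℂ → ℝ}
    (hq : ∀ t (c u : ℂ), q t (c * u) = Complex.normSq c * q t u) {i j : S}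
    (h0 : ∀ t, q t 1 ≠ 0 → t ∈ (extChartAt 𝓘(ℝ, ℂ) i).source ∩ (extChartAt 𝓘(ℝ, ℂ) j).source) :
    ∫ y in (extChartAt 𝓘(ℝ, ℂ) i).target, q ((extChartAt 𝓘(ℝ, ℂ) i).symm y) (chartD i y 1) =
      ∫ y in (extChartAt 𝓘(ℝ, ℂ) j).target, q ((extChartAt 𝓘(ℝ, ℂ) j).symm y) (chartD j y 1) := by
  set φ := extChartAt 𝓘(ℝ, ℂ) i
  set ψ := extChartAt 𝓘(ℝ, ℂ) j
  -- By the weight condition `q t u` is a multiple of `q t 1`, so the support condition at `u = 1`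
  -- controls every `u`.
  have hq0 : ∀ t, t ∉ φ.source ∩ ψ.source → ∀ u, q t u = 0 := fun t ht u => by
    have h1 : q t 1 = 0 := by_contra fun h => ht (h0 t h)
    have h2 := hq t u 1
    rw [h1, mul_one, mul_zero] at h2
    exact h2
  have hopen : ∀ (i j : S), MeasurableSet ((extChartAt 𝓘(ℝ, ℂ) i).target ∩
      (extChartAt 𝓘(ℝ, ℂ) i).symm ⁻¹' (extChartAt 𝓘(ℝ, ℂ) j).source) := fun i j =>
    ((continuousOn_extChartAt_symm i).isOpen_inter_preimage (isOpen_extChartAt_target i)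
      (isOpen_extChartAt_source j)).measurableSet
  have hred : ∀ (i j : S), (∀ t, t ∉ (extChartAt 𝓘(ℝ, ℂ) i).source ∩ (extChartAt 𝓘(ℝ, ℂ) j).source →
      ∀ u, q t u = 0) →
      ∫ y in (extChartAt 𝓘(ℝ, ℂ) i).target, q ((extChartAt 𝓘(ℝ, ℂ) i).symm y) (chartD i y 1) =
      ∫ y in (extChartAt 𝓘(ℝ, ℂ) i).target ∩
        (extChartAt 𝓘(ℝ, ℂ) i).symm ⁻¹' (extChartAt 𝓘(ℝ, ℂ) j).source,
        q ((extChartAt 𝓘(ℝ, ℂ) i).symm y) (chartD i y 1) := fun i j hq0 => by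
    refine setIntegral_eq_of_subset_of_forall_sdiff_eq_zero
      (isOpen_extChartAt_target i).measurableSet inter_subset_left fun y hy => ?_
    exact hq0 _ (fun h => hy.2 ⟨hy.1, h.2⟩) _
  rw [hred i j hq0, hred j i (fun t ht => hq0 t fun h => ht ⟨h.2, h.1⟩)]
  set A := φ.target ∩ φ.symm ⁻¹' ψ.source with hA
  set A' := ψ.target ∩ ψ.symm ⁻¹' φ.source with hA'
  let τ : ℂ → ℂ := fun z => ψ (φ.symm z)
  have himg : τ '' A = A' := by
    ext z
    constructor
    · rintro ⟨y, hy, rfl⟩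
      refine ⟨ψ.map_source hy.2, ?_⟩
      change ψ.symm (ψ (φ.symm y)) ∈ φ.source
      rw [ψ.left_inv hy.2]
      exact φ.map_target hy.1
    · rintro ⟨hz, hz'⟩
      have h1 : φ.symm (φ (ψ.symm z)) = ψ.symm z := φ.left_inv hz'
      refine ⟨φ (ψ.symm z), ⟨φ.map_source hz', ?_⟩, ?_⟩
      · change φ.symm (φ (ψ.symm z)) ∈ ψ.source
        rw [h1]; exact ψ.map_target hz
      · change ψ (φ.symm (φ (ψ.symm z))) = z
        rw [h1, ψ.right_inv hz]
  have hinj : InjOn τ A := fun y hy z hz hyz => by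
    have h1 := ψ.injOn hy.2 hz.2 hyz
    rw [← φ.right_inv hy.1, h1, φ.right_inv hz.1]
  have hex : ∀ y : A, ∃ c : ℂ, ∃ L : ℂ →L[ℝ] ℂ, (∀ v, L v = c * v) ∧
      HasFDerivAt τ L y ∧ ∀ v, chartD i y v = chartD j (τ y) (c * v) :=
    fun y => chart_transition y.2.1 y.2.2
  choose c L hL hder hcd using hex
  classical
  let L' : ℂ → ℂ →L[ℝ] ℂ := fun y => if hy : y ∈ A then L ⟨y, hy⟩ else 0
  have hL' : ∀ y (hy : y ∈ A), L' y = L ⟨y, hy⟩ := fun y hy => dif_pos hy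
  -- The Jacobian of multiplication by `c` is `|c|²`, exactly the factor by which `q` changes.
  rw [← himg, integral_image_eq_integral_abs_det_fderiv_smul volume (hopen i j) (f := τ) (f' := L')
    (fun y hy => by rw [hL' y hy]; exact (hder ⟨y, hy⟩).hasFDerivWithinAt) hinj]
  refine setIntegral_congr_fun (hopen i j) fun y hy => ?_
  have h5 : ψ.symm (τ y) = φ.symm y := ψ.left_inv hy.2
  change q (φ.symm y) (chartD i y 1) = |(L' y).det| • q (ψ.symm (τ y)) (chartD j (τ y) 1)
  rw [hL' y hy, det_of_complex_mul (hL ⟨y, hy⟩), hcd ⟨y, hy⟩,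
    chartD_mul (ψ.map_source hy.2), hq, h5, smul_eq_mul]

end Surface

/-! ### Partition of unity and the vanishing of integrals of exact 2-forms -/

section Stokes

variable {S : Type*} [TopologicalSpace S] [ChartedSpace ℂ S] [IsManifold 𝓘(ℂ, ℂ) ω S]
  [T2Space S] [CompactSpace S]

theorem chartPartition_subordinate (i : S) :
    tsupport (chartPartition S i) ⊆ (extChartAt 𝓘(ℝ, ℂ) i).source := by
  rw [extChartAt_source]
  exact (SmoothPartitionOfUnity.exists_isSubordinate_chartAt_source 𝓘(ℝ, ℂ) S).choose_spec i

variable (S) in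
theorem chartPartition_finite : {i : S | ∃ t, chartPartition S i t ≠ 0}.Finite := by
  have h1 := (chartPartition S).locallyFinite.finite_nonempty_of_compact
  refine h1.subset fun i hi => ?_
  obtain ⟨t, ht⟩ := hi
  exact ⟨t, ht⟩

variable (S) in
/-- The finitely many charts that contribute to integrals. -/
noncomputable def chartFinset : Finset S := (chartPartition_finite S).toFinset

theorem chartPartition_eq_zero {i : S} (hi : i ∉ chartFinset S) (t : S) :
    chartPartition S i t = 0 := by
  by_contra h
  exact hi ((chartPartition_finite S).mem_toFinset.2 ⟨t, h⟩)

theorem chartPartition_sum (t : S) : ∑ i ∈ chartFinset S, chartPartition S i t = 1 := by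
  rw [← (chartPartition S).sum_eq_one (mem_univ t)]
  refine (finsum_eq_sum_of_support_subset _ fun i hi => ?_).symm
  by_contra h
  exact hi (chartPartition_eq_zero h t)

theorem finsum_chart_eq_sum (F : S → ℂ → ℝ) :
    ∑ᶠ i : S, ∫ y in (extChartAt 𝓘(ℝ, ℂ) i).target,
      chartPartition S i ((extChartAt 𝓘(ℝ, ℂ) i).symm y) * F i y =
    ∑ i ∈ chartFinset S, ∫ y in (extChartAt 𝓘(ℝ, ℂ) i).target,
      chartPartition S i ((extChartAt 𝓘(ℝ, ℂ) i).symm y) * F i y := by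
  refine finsum_eq_sum_of_support_subset _ fun i hi => ?_
  by_contra h
  refine hi ?_
  simp [chartPartition_eq_zero h]

/-- The support of the partition function at `i`, in the chart at `i`. -/
def chartCompact (i : S) : Set ℂ := extChartAt 𝓘(ℝ, ℂ) i '' tsupport (chartPartition S i)

theorem isCompact_chartCompact (i : S) : IsCompact (chartCompact i) :=
  (isClosed_tsupport _).isCompact.image_of_continuousOn
    ((continuousOn_extChartAt i).mono (chartPartition_subordinate i))

theorem chartCompact_subset (i : S) : chartCompact i ⊆ (extChartAt 𝓘(ℝ, ℂ) i).target := by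
  rintro _ ⟨t, ht, rfl⟩
  exact (extChartAt 𝓘(ℝ, ℂ) i).map_source (chartPartition_subordinate i ht)

theorem notMem_tsupport_of_diff {i : S} {y : ℂ}
    (hy : y ∈ (extChartAt 𝓘(ℝ, ℂ) i).target \ chartCompact i) :
    (extChartAt 𝓘(ℝ, ℂ) i).symm y ∉ tsupport (chartPartition S i) := fun h =>
  hy.2 ⟨_, h, (extChartAt 𝓘(ℝ, ℂ) i).right_inv hy.1⟩

theorem contDiffOn_chartPartition (i k : S) :
    ContDiffOn ℝ ∞ (fun y => chartPartition S i ((extChartAt 𝓘(ℝ, ℂ) k).symm y))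
      (extChartAt 𝓘(ℝ, ℂ) k).target := by
  rw [← contMDiffOn_iff_contDiffOn]
  exact (chartPartition S i).contMDiff.comp_contMDiffOn (contMDiffOn_extChartAt_symm k)

/-- The differential of a function on the surface, as a functional on `ℂ`. -/
noncomputable def surfD (f : S → ℝ) (t : S) : ℂ →L[ℝ] ℝ := mfderiv 𝓘(ℝ, ℂ) 𝓘(ℝ, ℝ) f t

theorem fderiv_comp_chart {f : S → ℝ} (hf : ContMDiff 𝓘(ℝ, ℂ) 𝓘(ℝ, ℝ) ∞ f) {k : S} {y : ℂ}
    (hy : y ∈ (extChartAt 𝓘(ℝ, ℂ) k).target) (v : ℂ) :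
    fderiv ℝ (fun y => f ((extChartAt 𝓘(ℝ, ℂ) k).symm y)) y v =
      surfD f ((extChartAt 𝓘(ℝ, ℂ) k).symm y) (chartD k y v) := by
  have hd1 : MDifferentiableAt 𝓘(ℝ, ℂ) 𝓘(ℝ, ℂ) (extChartAt 𝓘(ℝ, ℂ) k).symm y := by
    have h1 := mdifferentiableWithinAt_extChartAt_symm (I := 𝓘(ℝ, ℂ)) (x := k) (z := y) hy
    rwa [modelWithCornersSelf_coe, range_id, mdifferentiableWithinAt_univ] at h1
  have hd2 : MDifferentiableAt 𝓘(ℝ, ℂ) 𝓘(ℝ, ℝ) f ((extChartAt 𝓘(ℝ, ℂ) k).symm y) :=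
    hf.mdifferentiableAt (by simp)
  have h3 := (hd2.hasMFDerivAt.comp y hd1.hasMFDerivAt).hasFDerivAt
  have h4 : fderiv ℝ (fun y => f ((extChartAt 𝓘(ℝ, ℂ) k).symm y)) y =
      (surfD f ((extChartAt 𝓘(ℝ, ℂ) k).symm y)).comp (chartD k y) := HasFDerivAt.fderiv h3
  rw [h4]
  rfl

theorem surfD_eq_zero {f : S → ℝ} {t : S} (ht : t ∉ tsupport f) : surfD f t = 0 := by
  have h1 : f =ᶠ[𝓝 t] fun _ => 0 := notMem_tsupport_iff_eventuallyEq.1 ht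
  rw [surfD, h1.mfderiv_eq]
  exact mfderiv_const

/-- Differentiate the constant function `∑ χ_i = 1`. -/
theorem surfD_sum_chartPartition (t : S) :
    ∑ i ∈ chartFinset S, surfD (chartPartition S i) t = 0 := by
  let D : (S → ℝ) → (ℂ →L[ℝ] ℝ) → Prop := fun f L => HasMFDerivAt 𝓘(ℝ, ℂ) 𝓘(ℝ, ℝ) f t L
  have h1 : ∀ s : Finset S, D (fun x => ∑ i ∈ s, chartPartition S i x)
      (∑ i ∈ s, surfD (chartPartition S i) t) := by
    classical
    intro s
    induction s using Finset.induction_on with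
    | empty =>
      simp only [Finset.sum_empty]
      exact hasMFDerivAt_const (0 : ℝ) t
    | insert i s hi ih =>
      simp only [Finset.sum_insert hi]
      exact (((chartPartition S i).contMDiff.mdifferentiableAt (by simp)).hasMFDerivAt).add ih
  have h2 := h1 (chartFinset S)
  simp only [chartPartition_sum] at h2
  exact hasMFDerivAt_unique h2 (hasMFDerivAt_const (1 : ℝ) t)

variable {β : S → ℂ →ₗ[ℝ] ℝ}

/-- The value of `dχ ∧ β` on `(u, iu)`. -/
noncomputable def wedgeDensity (χ : S → ℝ) (β : S → ℂ →ₗ[ℝ] ℝ) (t : S) (u : ℂ) : ℝ :=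
  surfD χ t u * β t (Complex.I * u) - surfD χ t (Complex.I * u) * β t u

/-- A real 2-form evaluated on `(u, iu)` scales by the determinant `|c|²` of multiplication by `c`;
this is the weight needed for `setIntegral_density_eq`. -/
theorem wedgeDensity_mul (χ : S → ℝ) (t : S) (c u : ℂ) :
    wedgeDensity χ β t (c * u) = Complex.normSq c * wedgeDensity χ β t u := by
  have e1 : c * u = c.re • u + c.im • (Complex.I * u) := by
    conv_lhs => rw [← Complex.re_add_im c]
    simp only [Complex.real_smul]; ring
  have e2 : Complex.I * (c * u) = c.re • (Complex.I * u) - c.im • u := by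
    conv_lhs => rw [← Complex.re_add_im c]
    simp only [Complex.real_smul]
    linear_combination (c.im : ℂ) * u * Complex.I_mul_I
  simp only [wedgeDensity]
  rw [e2, e1]
  simp only [map_add, map_sub, map_smul, smul_eq_mul, Complex.normSq_apply]
  ring

variable (hβ : ∀ (k : S) (v : ℂ), ContDiffOn ℝ ∞
  (fun y => β ((extChartAt 𝓘(ℝ, ℂ) k).symm y) (chartD k y v)) (extChartAt 𝓘(ℝ, ℂ) k).target)

include hβ

theorem continuousOn_wedgeDensity (i k : S) : ContinuousOn
    (fun y => wedgeDensity (chartPartition S i) β ((extChartAt 𝓘(ℝ, ℂ) k).symm y) (chartD k y 1))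
    (extChartAt 𝓘(ℝ, ℂ) k).target := by
  have hd : ∀ v, ContinuousOn (fun y => fderiv ℝ
      (fun y => chartPartition S i ((extChartAt 𝓘(ℝ, ℂ) k).symm y)) y v)
      (extChartAt 𝓘(ℝ, ℂ) k).target := fun v =>
    ((contDiffOn_chartPartition i k).continuousOn_fderiv_of_isOpen
      (isOpen_extChartAt_target k) (by simp)).clm_apply continuousOn_const
  refine (((hd 1).mul (hβ k Complex.I).continuousOn).sub
    ((hd Complex.I).mul (hβ k 1).continuousOn)).congr fun y hy => ?_
  have e : Complex.I * chartD k y 1 = chartD k y Complex.I := by rw [← chartD_mul hy, mul_one]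
  simp only [wedgeDensity, Pi.sub_apply, Pi.mul_apply,
    fderiv_comp_chart (chartPartition S i).contMDiff hy, e]

/-- In one chart this is `∫ χ dβ = -∫ dχ ∧ β`, from one integration by parts in each coordinate
direction. -/
theorem setIntegral_curl (i : S) :
    ∫ y in (extChartAt 𝓘(ℝ, ℂ) i).target,
      chartPartition S i ((extChartAt 𝓘(ℝ, ℂ) i).symm y) *
        (fderiv ℝ (fun y => β ((extChartAt 𝓘(ℝ, ℂ) i).symm y) (chartD i y Complex.I)) y 1 -
          fderiv ℝ (fun y => β ((extChartAt 𝓘(ℝ, ℂ) i).symm y) (chartD i y 1)) y Complex.I) =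
    -∫ y in (extChartAt 𝓘(ℝ, ℂ) i).target,
      wedgeDensity (chartPartition S i) β ((extChartAt 𝓘(ℝ, ℂ) i).symm y) (chartD i y 1) := by
  set T := (extChartAt 𝓘(ℝ, ℂ) i).target with hTd
  have hT : IsOpen T := isOpen_extChartAt_target i
  set c : ℂ → ℝ := fun y => chartPartition S i ((extChartAt 𝓘(ℝ, ℂ) i).symm y) with hc
  set b : ℂ → ℂ → ℝ := fun v y => β ((extChartAt 𝓘(ℝ, ℂ) i).symm y) (chartD i y v) with hb
  have hcs : ContDiffOn ℝ ∞ c T := contDiffOn_chartPartition i i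
  have hbs : ∀ v, ContDiffOn ℝ ∞ (b v) T := fun v => hβ i v
  have hK := isCompact_chartCompact i
  have hKT := chartCompact_subset i
  have h0 : ∀ y ∈ T \ chartCompact i, c y = 0 := fun y hy =>
    image_eq_zero_of_notMem_tsupport (f := chartPartition S i) (notMem_tsupport_of_diff hy)
  have hdb : ∀ v v', ContinuousOn (fun y => fderiv ℝ (b v) y v') T := fun v v' =>
    ((hbs v).continuousOn_fderiv_of_isOpen hT (by simp)).clm_apply continuousOn_const
  have hdc : ∀ v', ContinuousOn (fun y => fderiv ℝ c y v') T := fun v' =>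
    (hcs.continuousOn_fderiv_of_isOpen hT (by simp)).clm_apply continuousOn_const
  have hd0 : ∀ y ∈ T \ chartCompact i, ∀ v, fderiv ℝ c y v = 0 := fun y hy v => by
    rw [hc, fderiv_comp_chart (chartPartition S i).contMDiff hy.1,
      surfD_eq_zero (notMem_tsupport_of_diff hy)]
    rfl
  have hi1 : ∀ v v', IntegrableOn (fun y => c y * fderiv ℝ (b v) y v') T := fun v v' =>
    integrableOn_of_eq_zero_off_compact hK hKT hT.measurableSet (hcs.continuousOn.mul (hdb v v'))
      fun y hy => by rw [h0 y hy, zero_mul]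
  have hi2 : ∀ v v', IntegrableOn (fun y => fderiv ℝ c y v' * b v y) T := fun v v' =>
    integrableOn_of_eq_zero_off_compact hK hKT hT.measurableSet
      ((hdc v').mul (hbs v).continuousOn) fun y hy => by rw [hd0 y hy, zero_mul]
  have e1 : ∫ y in T, c y * (fderiv ℝ (b Complex.I) y 1 - fderiv ℝ (b 1) y Complex.I) =
      (∫ y in T, c y * fderiv ℝ (b Complex.I) y 1) - ∫ y in T, c y * fderiv ℝ (b 1) y Complex.I := by
    rw [← integral_sub (hi1 _ _) (hi1 _ _)]
    simp only [mul_sub]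
  have e2 : ∫ y in T, wedgeDensity (chartPartition S i) β ((extChartAt 𝓘(ℝ, ℂ) i).symm y)
      (chartD i y 1) = (∫ y in T, fderiv ℝ c y 1 * b Complex.I y) -
        ∫ y in T, fderiv ℝ c y Complex.I * b 1 y := by
    rw [← integral_sub (hi2 _ _) (hi2 _ _)]
    refine setIntegral_congr_fun hT.measurableSet fun y hy => ?_
    have e : Complex.I * chartD i y 1 = chartD i y Complex.I := by rw [← chartD_mul hy, mul_one]
    simp only [wedgeDensity, hc, hb, fderiv_comp_chart (chartPartition S i).contMDiff hy, e]
  rw [e1, e2, setIntegral_mul_fderiv hT hK hKT hcs h0 (hbs _),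
    setIntegral_mul_fderiv hT hK hKT hcs h0 (hbs _)]
  ring

/-- Stokes' theorem on a closed Riemann surface, for a smooth 1-form `β`. -/
theorem finsum_integral_curl_eq_zero :
    ∑ i ∈ chartFinset S, ∫ y in (extChartAt 𝓘(ℝ, ℂ) i).target,
      chartPartition S i ((extChartAt 𝓘(ℝ, ℂ) i).symm y) *
        (fderiv ℝ (fun y => β ((extChartAt 𝓘(ℝ, ℂ) i).symm y) (chartD i y Complex.I)) y 1 -
          fderiv ℝ (fun y => β ((extChartAt 𝓘(ℝ, ℂ) i).symm y) (chartD i y 1)) y Complex.I) = 0 := by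
  simp only [setIntegral_curl hβ, Finset.sum_neg_distrib, neg_eq_zero]
  -- Insert a second factor `∑_k χ_k = 1`, move the `(i, k)` term from the chart at `i` to the chart
  -- at `k`, and sum over `i` first: there `∑_i dχ_i = 0`. The product `χ_k dχ_i` is supported in
  -- both chart domains, which permits the move.
  let q : S → S → S → ℂ → ℝ := fun i k t u =>
    chartPartition S k t * wedgeDensity (chartPartition S i) β t u
  have hq0 : ∀ i k t u, t ∉ tsupport (chartPartition S i) → q i k t u = 0 := fun i k t u ht => by
    simp [q, wedgeDensity, surfD_eq_zero ht]
  have hq0' : ∀ i k t u, t ∉ tsupport (chartPartition S k) → q i k t u = 0 := fun i k t u ht => by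
    simp only [q]
    rw [image_eq_zero_of_notMem_tsupport ht, zero_mul]
  have hcont : ∀ i k m, ContinuousOn (fun y => q i k ((extChartAt 𝓘(ℝ, ℂ) m).symm y) (chartD m y 1))
      (extChartAt 𝓘(ℝ, ℂ) m).target := fun i k m =>
    (contDiffOn_chartPartition k m).continuousOn.mul (continuousOn_wedgeDensity hβ i m)
  have hint : ∀ i k m, (∀ t u, t ∉ tsupport (chartPartition S m) → q i k t u = 0) →
      IntegrableOn (fun y => q i k ((extChartAt 𝓘(ℝ, ℂ) m).symm y) (chartD m y 1))
        (extChartAt 𝓘(ℝ, ℂ) m).target := fun i k m h =>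
    integrableOn_of_eq_zero_off_compact (isCompact_chartCompact m) (chartCompact_subset m)
      (isOpen_extChartAt_target m).measurableSet (hcont i k m)
      fun y hy => h _ _ (notMem_tsupport_of_diff hy)
  calc ∑ i ∈ chartFinset S, ∫ y in (extChartAt 𝓘(ℝ, ℂ) i).target,
      wedgeDensity (chartPartition S i) β ((extChartAt 𝓘(ℝ, ℂ) i).symm y) (chartD i y 1)
      = ∑ i ∈ chartFinset S, ∑ k ∈ chartFinset S, ∫ y in (extChartAt 𝓘(ℝ, ℂ) i).target,
          q i k ((extChartAt 𝓘(ℝ, ℂ) i).symm y) (chartD i y 1) := by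
        refine Finset.sum_congr rfl fun i _ => ?_
        rw [← integral_finsetSum _ fun k _ => hint i k i (hq0 i k)]
        refine setIntegral_congr_fun (isOpen_extChartAt_target i).measurableSet fun y _ => ?_
        simp only [q]
        rw [← Finset.sum_mul, chartPartition_sum, one_mul]
    _ = ∑ i ∈ chartFinset S, ∑ k ∈ chartFinset S, ∫ y in (extChartAt 𝓘(ℝ, ℂ) k).target,
          q i k ((extChartAt 𝓘(ℝ, ℂ) k).symm y) (chartD k y 1) := by
        refine Finset.sum_congr rfl fun i _ => Finset.sum_congr rfl fun k _ => ?_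
        refine setIntegral_density_eq (q := q i k) (fun t c u => ?_) fun t ht => ⟨?_, ?_⟩
        · simp only [q, wedgeDensity_mul]; ring
        · exact chartPartition_subordinate i (by_contra fun h => ht (hq0 i k t 1 h))
        · exact chartPartition_subordinate k (by_contra fun h => ht (hq0' i k t 1 h))
    _ = ∑ k ∈ chartFinset S, ∫ y in (extChartAt 𝓘(ℝ, ℂ) k).target, (0 : ℝ) := by
        rw [Finset.sum_comm]
        refine Finset.sum_congr rfl fun k _ => ?_
        rw [← integral_finsetSum _ fun i _ => hint i k k (hq0' i k)]
        refine setIntegral_congr_fun (isOpen_extChartAt_target k).measurableSet fun y _ => ?_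
        have h1 : ∀ u, ∑ i ∈ chartFinset S,
            surfD (chartPartition S i) ((extChartAt 𝓘(ℝ, ℂ) k).symm y) u = 0 := fun u => by
          have := congrArg (fun L : ℂ →L[ℝ] ℝ => L u)
            (surfD_sum_chartPartition ((extChartAt 𝓘(ℝ, ℂ) k).symm y))
          simpa using this
        simp only [q, wedgeDensity]
        rw [← Finset.mul_sum, Finset.sum_sub_distrib, ← Finset.sum_mul, ← Finset.sum_mul, h1, h1]
        ring
    _ = 0 := by simp

end Stokes

/-! ### The derivative of the action along a family of sections -/

section PullFlat

variable {E : Type*} [NormedAddCommGroup E] [NormedSpace ℝ E]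
  {M : Type*} [TopologicalSpace M] [ChartedSpace E M]
  {V : Type*} [NormedAddCommGroup V] [NormedSpace ℝ V] {k : ℕ}

/-- The pull-back of a form to a normed space, as a form in the sense of calculus. -/
noncomputable def pullFlat (f : V → M) (η : DForm E M k) (y : V) : V [⋀^Fin k]→L[ℝ] ℝ :=
  pullback f η y

variable [IsManifold 𝓘(ℝ, E) ω M]

theorem inChart_apply {η : DForm E M k} {x₀ x : M} (hx : x ∈ (chartAt E x₀).source) (v : Fin k → E) :
    inChart η x₀ (extChartAt 𝓘(ℝ, E) x₀ x) v = η x (fun i => ofChart x₀ x (v i)) := by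
  have h6 : (extChartAt 𝓘(ℝ, E) x₀).symm (extChartAt 𝓘(ℝ, E) x₀ x) = x :=
    (extChartAt 𝓘(ℝ, E) x₀).left_inv (by rwa [extChartAt_source])
  have h8 : ∀ x' : M, x' = x → ∀ v : Fin k → E,
      (η x' : E [⋀^Fin k]→L[ℝ] ℝ) v = (η x : E [⋀^Fin k]→L[ℝ] ℝ) v := by
    rintro x' rfl v; rfl
  exact h8 _ h6 _

theorem fderiv_chart_comp {f : V → M} {y : V} {x₀ : M} (hx : f y ∈ (chartAt E x₀).source)
    (hf : MDifferentiableAt 𝓘(ℝ, V) 𝓘(ℝ, E) f y) (v : V) :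
    fderiv ℝ (fun z => extChartAt 𝓘(ℝ, E) x₀ (f z)) y v =
      toChart x₀ (f y) (mfderiv 𝓘(ℝ, V) 𝓘(ℝ, E) f y v) := by
  have hd2 : MDifferentiableAt 𝓘(ℝ, E) 𝓘(ℝ, E) (extChartAt 𝓘(ℝ, E) x₀) (f y) :=
    mdifferentiableAt_extChartAt hx
  have h1 := mfderiv_comp_apply y hd2 hf v
  rw [mfderiv_eq_fderiv] at h1
  exact h1

theorem pullFlat_eq_inChart {f : V → M} {y : V} {x₀ : M} (hx : f y ∈ (chartAt E x₀).source)
    (hf : MDifferentiableAt 𝓘(ℝ, V) 𝓘(ℝ, E) f y) (η : DForm E M k) :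
    pullFlat f η y = (inChart η x₀ (extChartAt 𝓘(ℝ, E) x₀ (f y))).compContinuousLinearMap
      (fderiv ℝ (fun z => extChartAt 𝓘(ℝ, E) x₀ (f z)) y) := by
  ext v
  change η (f y) (fun i => mfderiv 𝓘(ℝ, V) 𝓘(ℝ, E) f y (v i)) =
    inChart η x₀ (extChartAt 𝓘(ℝ, E) x₀ (f y))
      (fun i => fderiv ℝ (fun z => extChartAt 𝓘(ℝ, E) x₀ (f z)) y (v i))
  rw [inChart_apply hx]
  congr 1
  funext i
  rw [fderiv_chart_comp hx hf, ofChart_toChart hx]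

/-- Naturality of `d`: near `y` the pull-back factors through the chart at `f y`, and there it is
the pull-back of a form between normed spaces. -/
theorem extDeriv_pullFlat {f : V → M} {U : Set V} (hU : IsOpen U)
    (hf : ContMDiffOn 𝓘(ℝ, V) 𝓘(ℝ, E) ∞ f U) {y : V} (hy : y ∈ U)
    {Θ : DForm E M k} {Ω : DForm E M (k + 1)} (hΘ : IsSmoothForm Θ) (hd : IsExtDeriv Θ Ω) :
    DifferentiableAt ℝ (pullFlat f Θ) y ∧ extDeriv (pullFlat f Θ) y = pullFlat f Ω y := by
  set x₀ := f y
  have hm := mem_chart_source E x₀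
  have hfy : ContMDiffAt 𝓘(ℝ, V) 𝓘(ℝ, E) ∞ f y := (hf y hy).contMDiffAt (hU.mem_nhds hy)
  have hev : pullFlat f Θ =ᶠ[𝓝 y] fun z => (inChart Θ x₀ (extChartAt 𝓘(ℝ, E) x₀ (f z))).compContinuousLinearMap
      (fderiv ℝ (fun z => extChartAt 𝓘(ℝ, E) x₀ (f z)) z) := by
    filter_upwards [hU.mem_nhds hy,
      hfy.continuousAt.eventually ((chartAt E x₀).open_source.mem_nhds hm)] with z hz hz'
    exact pullFlat_eq_inChart hz' (((hf z hz).contMDiffAt (hU.mem_nhds hz)).mdifferentiableAt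
      (by simp)) Θ
  have hκ : ContDiffAt ℝ ∞ (fun z => extChartAt 𝓘(ℝ, E) x₀ (f z)) y :=
    ((contMDiffAt_extChartAt' hm).comp y hfy).contDiffAt
  have hT := mem_extChartAt_target (I := 𝓘(ℝ, E)) x₀
  have hin : DifferentiableAt ℝ (inChart Θ x₀) (extChartAt 𝓘(ℝ, E) x₀ (f y)) :=
    ((hΘ x₀).contDiffAt ((isOpen_extChartAt_target x₀).mem_nhds hT)).differentiableAt (by simp)
  have hfd : DifferentiableAt ℝ (fderiv ℝ (fun z => extChartAt 𝓘(ℝ, E) x₀ (f z))) y :=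
    (hκ.fderiv_right (m := 1) (by norm_cast)).differentiableAt (by simp)
  constructor
  · refine DifferentiableAt.congr_of_eventuallyEq ?_ hev
    have h1 := (hin.comp y (hκ.differentiableAt (by simp))).hasFDerivAt
    exact (h1.continuousAlternatingMapCompContinuousLinearMap hfd.hasFDerivAt).differentiableAt
  · rw [hev.extDeriv_eq, extDeriv_pullback (f := fun z => extChartAt 𝓘(ℝ, E) x₀ (f z)) hin
      (hκ.of_le (m := 2) (by norm_cast)) (by simp),
      pullFlat_eq_inChart hm (hfy.mdifferentiableAt (by simp)) Ω, hd x₀ _ hT]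

theorem extDeriv_two_apply {η : V → V [⋀^Fin 2]→L[ℝ] ℝ} {y : V} (hη : DifferentiableAt ℝ η y)
    (a b c : V) : extDeriv η y ![a, b, c] = fderiv ℝ (fun z => η z ![b, c]) y a -
      fderiv ℝ (fun z => η z ![a, c]) y b + fderiv ℝ (fun z => η z ![a, b]) y c := by
  rw [extDeriv_apply hη, Fin.sum_univ_three]
  have e0 : (0 : Fin 3).removeNth ![a, b, c] = ![b, c] := by ext i; fin_cases i <;> rfl
  have e1 : (1 : Fin 3).removeNth ![a, b, c] = ![a, c] := by ext i; fin_cases i <;> rfl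
  have e2 : (2 : Fin 3).removeNth ![a, b, c] = ![a, b] := by ext i; fin_cases i <;> rfl
  rw [e0, e1, e2]
  simp
  ring

theorem smoothAlongAt_mfderiv {f : V → M} {U : Set V} (hU : IsOpen U)
    (hf : ContMDiffOn 𝓘(ℝ, V) 𝓘(ℝ, E) ∞ f U) {y : V} (hy : y ∈ U) (v : V) :
    SmoothAlongAt 𝓘(ℝ, V) f (fun z => mfderiv 𝓘(ℝ, V) 𝓘(ℝ, E) f z v) y := by
  have hfy : ContMDiffAt 𝓘(ℝ, V) 𝓘(ℝ, E) ∞ f y := (hf y hy).contMDiffAt (hU.mem_nhds hy)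
  have hm := mem_chart_source E (f y)
  refine (smoothAlongAt_iff hm).2 ⟨hfy, ?_⟩
  have hκ : ContDiffAt ℝ ∞ (fun z => extChartAt 𝓘(ℝ, E) (f y) (f z)) y :=
    ((contMDiffAt_extChartAt' hm).comp y hfy).contDiffAt
  have h1 : ContDiffAt ℝ ∞ (fun z => fderiv ℝ (fun z => extChartAt 𝓘(ℝ, E) (f y) (f z)) z v) y :=
    (hκ.fderiv_right (m := ∞) (by simp)).clm_apply contDiffAt_const
  refine h1.contMDiffAt.congr_of_eventuallyEq ?_
  filter_upwards [hU.mem_nhds hy,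
    hfy.continuousAt.eventually ((chartAt E (f y)).open_source.mem_nhds hm)] with z hz hz'
  have hfz : MDifferentiableAt 𝓘(ℝ, V) 𝓘(ℝ, E) f z :=
    ((hf z hz).contMDiffAt (hU.mem_nhds hz)).mdifferentiableAt (by simp)
  exact (fderiv_chart_comp hz' hfz v).symm

theorem contDiffOn_pullFlat_apply {f : V → M} {U : Set V} (hU : IsOpen U)
    (hf : ContMDiffOn 𝓘(ℝ, V) 𝓘(ℝ, E) ∞ f U) {Θ : DForm E M k} (hΘ : IsSmoothForm Θ)
    (v : Fin k → V) : ContDiffOn ℝ ∞ (fun z => pullFlat f Θ z v) U := fun y hy =>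
  ((hΘ.contMDiffAt_apply (X := fun i z => mfderiv 𝓘(ℝ, V) 𝓘(ℝ, E) f z (v i))
    ((hf y hy).contMDiffAt (hU.mem_nhds hy)) fun i =>
      smoothAlongAt_mfderiv hU hf hy (v i)).contDiffAt).contDiffWithinAt

end PullFlat

/-! ### Differentiation under the integral sign -/

section Calculus

variable {T K : Set ℂ}

/-- The integrand lives on the compact set `K`, so its parameter derivative is bounded on the
product of the unit ball of parameters with `K`; this constant, cut off to `K`, dominates. -/
theorem hasDerivAt_setIntegral_mul {c : ℂ → ℝ} {a : ℝ × ℂ → ℝ} (hT : IsOpen T) (hK : IsCompact K)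
    (hKT : K ⊆ T) (hc : ContinuousOn c T) (h0 : ∀ y ∈ T \ K, c y = 0)
    (ha : ContDiffOn ℝ ∞ a (Prod.snd ⁻¹' T)) :
    HasDerivAt (fun r => ∫ y in T, c y * a (r, y)) (∫ y in T, c y * fderiv ℝ a (0, y) (1, 0)) 0 := by
  have hU : IsOpen (Prod.snd ⁻¹' T : Set (ℝ × ℂ)) := hT.preimage continuous_snd
  have had : ContinuousOn (fun p => fderiv ℝ a p (1, 0)) (Prod.snd ⁻¹' T) :=
    (ha.continuousOn_fderiv_of_isOpen hU (by simp)).clm_apply continuousOn_const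
  have hline : ∀ r : ℝ, ContinuousOn (fun y : ℂ => (r, y)) T := fun r =>
    (continuous_const.prodMk continuous_id).continuousOn
  have hF : ∀ r, ContinuousOn (fun y => c y * a (r, y)) T := fun r =>
    hc.mul (ha.continuousOn.comp (hline r) fun y hy => hy)
  have hF' : ContinuousOn (fun y => c y * fderiv ℝ a (0, y) (1, 0)) T :=
    hc.mul (had.comp (hline 0) fun y hy => hy)
  have hcpt : IsCompact (Metric.closedBall (0 : ℝ) 1 ×ˢ K) := (isCompact_closedBall _ _).prod hK
  have hcont : ContinuousOn (fun p : ℝ × ℂ => c p.2 * fderiv ℝ a p (1, 0))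
      (Metric.closedBall (0 : ℝ) 1 ×ˢ K) :=
    (hc.comp continuous_snd.continuousOn fun p hp => hKT hp.2).mul
      (had.mono fun p hp => hKT hp.2)
  obtain ⟨C, hC⟩ := hcpt.exists_bound_of_continuousOn hcont
  refine (hasDerivAt_integral_of_dominated_loc_of_deriv_le (μ := volume.restrict T)
    (F := fun r y => c y * a (r, y)) (F' := fun r y => c y * fderiv ℝ a (r, y) (1, 0))
    (bound := K.indicator fun _ => C) (Metric.ball_mem_nhds (0 : ℝ) one_pos)
    (Eventually.of_forall fun r => (hF r).aestronglyMeasurable hT.measurableSet)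
    (integrableOn_of_eq_zero_off_compact hK hKT hT.measurableSet (hF 0) fun y hy => by
      rw [h0 y hy, zero_mul])
    (hF'.aestronglyMeasurable hT.measurableSet) ?_ ?_ ?_).2
  · refine (ae_restrict_mem hT.measurableSet).mono fun y hy r hr => ?_
    by_cases hyK : y ∈ K
    · rw [indicator_of_mem hyK]
      exact hC (r, y) ⟨Metric.ball_subset_closedBall hr, hyK⟩
    · rw [indicator_of_notMem hyK, h0 y ⟨hy, hyK⟩, zero_mul, norm_zero]
  · refine Integrable.restrict ((integrable_indicator_iff hK.measurableSet).2 ?_)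
    exact continuousOn_const.integrableOn_compact hK
  · refine (ae_restrict_mem hT.measurableSet).mono fun y hy r _ => ?_
    have h1 : HasFDerivAt a (fderiv ℝ a (r, y)) (r, y) :=
      ((ha.contDiffAt (hU.mem_nhds hy)).differentiableAt (by simp)).hasFDerivAt
    have h2 : HasDerivAt (fun r : ℝ => (r, y)) ((1 : ℝ), (0 : ℂ)) r :=
      (hasDerivAt_id r).prodMk (hasDerivAt_const r y)
    exact (h1.comp_hasDerivAt r h2).const_mul (c y)

end Calculus

/-! ### The homotopy formula for a family of sections, in a chart of the base -/

section Family

variable {E : Type*} [NormedAddCommGroup E] [NormedSpace ℂ E]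
  {W : Type*} [TopologicalSpace W] [ChartedSpace E W]
  {S : Type*} [TopologicalSpace S] [ChartedSpace ℂ S] {σ : W → S}

theorem SmoothSection.eq_of_toFun_eq {Z Z' : SmoothSection E σ} (hZ : Z.toFun = Z'.toFun) :
    Z = Z' := by
  cases Z; cases Z'; subst hZ; rfl

/-- A family of sections in the chart at `i`. -/
noncomputable def SectionFamily.inChartAt (Z : SectionFamily E σ) (i : S) (p : ℝ × ℂ) : W :=
  Z.toFun p.1 ((extChartAt 𝓘(ℝ, ℂ) i).symm p.2)

variable [IsManifold 𝓘(ℂ, ℂ) ω S] (Z : SectionFamily E σ) {i : S}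

theorem SectionFamily.contMDiffOn_inChartAt (i : S) :
    ContMDiffOn 𝓘(ℝ, ℝ × ℂ) 𝓘(ℝ, E) ∞ (Z.inChartAt i)
      (Prod.snd ⁻¹' (extChartAt 𝓘(ℝ, ℂ) i).target) := by
  have h1 : ContMDiff 𝓘(ℝ, ℝ × ℂ) 𝓘(ℝ, ℝ) ∞ (Prod.fst : ℝ × ℂ → ℝ) := contDiff_fst.contMDiff
  have h2 : ContMDiff 𝓘(ℝ, ℝ × ℂ) 𝓘(ℝ, ℂ) ∞ (Prod.snd : ℝ × ℂ → ℂ) := contDiff_snd.contMDiff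
  have h3 : ContMDiffOn 𝓘(ℝ, ℝ × ℂ) 𝓘(ℝ, ℂ) ∞
      (fun p : ℝ × ℂ => (extChartAt 𝓘(ℝ, ℂ) i).symm p.2)
      (Prod.snd ⁻¹' (extChartAt 𝓘(ℝ, ℂ) i).target) :=
    (contMDiffOn_extChartAt_symm i).comp h2.contMDiffOn fun p hp => hp
  exact Z.smooth.comp_contMDiffOn (h1.contMDiffOn.prodMk h3)

theorem SectionFamily.mdifferentiableAt_inChartAt {y : ℂ} (hy : y ∈ (extChartAt 𝓘(ℝ, ℂ) i).target)
    (r : ℝ) : MDifferentiableAt 𝓘(ℝ, ℝ × ℂ) 𝓘(ℝ, E) (Z.inChartAt i) (r, y) :=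
  ((Z.contMDiffOn_inChartAt i (r, y) hy).contMDiffAt
    (((isOpen_extChartAt_target i).preimage continuous_snd).mem_nhds hy)).mdifferentiableAt (by simp)

theorem SectionFamily.mfderiv_inChartAt_fst {y : ℂ} (hy : y ∈ (extChartAt 𝓘(ℝ, ℂ) i).target)
    (r : ℝ) : mfderiv 𝓘(ℝ, ℝ × ℂ) 𝓘(ℝ, E) (Z.inChartAt i) (r, y) ((1, 0) : ℝ × ℂ) =
      Z.velocity r ((extChartAt 𝓘(ℝ, ℂ) i).symm y) := by
  have h1 : HasFDerivAt (fun r : ℝ => (r, y)) (ContinuousLinearMap.inl ℝ ℝ ℂ) r :=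
    hasFDerivAt_prodMk_left r y
  have h2 := mfderiv_comp_apply r (Z.mdifferentiableAt_inChartAt hy r)
    h1.hasMFDerivAt.mdifferentiableAt (1 : ℝ)
  rw [h1.hasMFDerivAt.mfderiv] at h2
  exact h2.symm

theorem SectionFamily.mfderiv_inChartAt_snd {y : ℂ} (hy : y ∈ (extChartAt 𝓘(ℝ, ℂ) i).target)
    (r : ℝ) (v : ℂ) : mfderiv 𝓘(ℝ, ℝ × ℂ) 𝓘(ℝ, E) (Z.inChartAt i) (r, y) ((0, v) : ℝ × ℂ) =
      mfderiv 𝓘(ℝ, ℂ) 𝓘(ℝ, E) (Z.toFun r) ((extChartAt 𝓘(ℝ, ℂ) i).symm y) (chartD i y v) := by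
  have h1 : HasFDerivAt (fun y : ℂ => (r, y)) (ContinuousLinearMap.inr ℝ ℝ ℂ) y :=
    hasFDerivAt_prodMk_right r y
  have h2 := mfderiv_comp_apply y (Z.mdifferentiableAt_inChartAt hy r)
    h1.hasMFDerivAt.mdifferentiableAt v
  rw [h1.hasMFDerivAt.mfderiv] at h2
  have hd1 : MDifferentiableAt 𝓘(ℝ, ℂ) 𝓘(ℝ, ℂ) (extChartAt 𝓘(ℝ, ℂ) i).symm y := by
    have h1 := mdifferentiableWithinAt_extChartAt_symm (I := 𝓘(ℝ, ℂ)) (x := i) (z := y) hy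
    rwa [modelWithCornersSelf_coe, range_id, mdifferentiableWithinAt_univ] at h1
  have hd2 : MDifferentiableAt 𝓘(ℝ, ℂ) 𝓘(ℝ, E) (Z.toFun r) ((extChartAt 𝓘(ℝ, ℂ) i).symm y) :=
    (Z.slice r).smooth.mdifferentiableAt (by simp)
  have h3 := mfderiv_comp_apply y hd2 hd1 v
  exact h2.symm.trans h3

/-- The 1-form `Θ(∂_r Z, dZ ·)` along the section `Z(0, ·)`. -/
noncomputable def SectionFamily.contraction (Θ : DForm E W 2) (t : S) : ℂ →ₗ[ℝ] ℝ where
  toFun u := Θ (Z.toFun 0 t) ![Z.velocity 0 t, mfderiv 𝓘(ℝ, ℂ) 𝓘(ℝ, E) (Z.toFun 0) t u]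
  map_add' u u' := by
    have h1 := (Θ (Z.toFun 0 t)).map_update_add ![Z.velocity 0 t, 0] 1
      (mfderiv 𝓘(ℝ, ℂ) 𝓘(ℝ, E) (Z.toFun 0) t u) (mfderiv 𝓘(ℝ, ℂ) 𝓘(ℝ, E) (Z.toFun 0) t u')
    have h2 : ∀ x y z : TangentSpace 𝓘(ℝ, E) (Z.toFun 0 t), Function.update ![x, y] 1 z = ![x, z] :=
      fun x y z => by ext i; fin_cases i <;> rfl
    rw [h2, h2, h2] at h1
    refine Eq.trans ?_ h1
    exact congrArg (fun z => Θ (Z.toFun 0 t) ![Z.velocity 0 t, z])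
      ((mfderiv 𝓘(ℝ, ℂ) 𝓘(ℝ, E) (Z.toFun 0) t).map_add u u')
  map_smul' c u := by
    have h1 := (Θ (Z.toFun 0 t)).map_update_smul ![Z.velocity 0 t, 0] 1 c
      (mfderiv 𝓘(ℝ, ℂ) 𝓘(ℝ, E) (Z.toFun 0) t u)
    have h2 : ∀ x y z : TangentSpace 𝓘(ℝ, E) (Z.toFun 0 t), Function.update ![x, y] 1 z = ![x, z] :=
      fun x y z => by ext i; fin_cases i <;> rfl
    rw [h2, h2] at h1
    refine Eq.trans ?_ h1
    exact congrArg (fun z => Θ (Z.toFun 0 t) ![Z.velocity 0 t, z])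
      ((mfderiv 𝓘(ℝ, ℂ) 𝓘(ℝ, E) (Z.toFun 0) t).map_smul c u)

theorem SectionFamily.pullFlat_time (Θ : DForm E W 2) {y : ℂ}
    (hy : y ∈ (extChartAt 𝓘(ℝ, ℂ) i).target) (v : ℂ) :
    pullFlat (Z.inChartAt i) Θ (0, y) ![((1, 0) : ℝ × ℂ), (0, v)] =
      Z.contraction Θ ((extChartAt 𝓘(ℝ, ℂ) i).symm y) (chartD i y v) := by
  change Θ (Z.toFun 0 ((extChartAt 𝓘(ℝ, ℂ) i).symm y)) _ =
    Θ (Z.toFun 0 ((extChartAt 𝓘(ℝ, ℂ) i).symm y)) _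
  congr 1
  ext k
  fin_cases k
  · exact Z.mfderiv_inChartAt_fst hy 0
  · exact Z.mfderiv_inChartAt_snd hy 0 v

theorem SectionFamily.pullFlat_space (Θ : DForm E W 2) {y : ℂ}
    (hy : y ∈ (extChartAt 𝓘(ℝ, ℂ) i).target) (r : ℝ) :
    inChart (pullback (Z.toFun r) Θ) i y ![1, Complex.I] =
      pullFlat (Z.inChartAt i) Θ (r, y) ![((0, 1) : ℝ × ℂ), (0, Complex.I)] := by
  change Θ (Z.toFun r ((extChartAt 𝓘(ℝ, ℂ) i).symm y)) _ =
    Θ (Z.toFun r ((extChartAt 𝓘(ℝ, ℂ) i).symm y)) _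
  congr 1
  ext k
  fin_cases k
  · exact (Z.mfderiv_inChartAt_snd hy r 1).symm
  · exact (Z.mfderiv_inChartAt_snd hy r Complex.I).symm

theorem SectionFamily.pullFlat_three (Ω : DForm E W 3) {y : ℂ}
    (hy : y ∈ (extChartAt 𝓘(ℝ, ℂ) i).target) :
    pullFlat (Z.inChartAt i) Ω (0, y) ![((1, 0) : ℝ × ℂ), (0, 1), (0, Complex.I)] =
      Ω (Z.toFun 0 ((extChartAt 𝓘(ℝ, ℂ) i).symm y))
        ![Z.velocity 0 ((extChartAt 𝓘(ℝ, ℂ) i).symm y),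
          mfderiv 𝓘(ℝ, ℂ) 𝓘(ℝ, E) (Z.toFun 0) ((extChartAt 𝓘(ℝ, ℂ) i).symm y) (chartD i y 1),
          mfderiv 𝓘(ℝ, ℂ) 𝓘(ℝ, E) (Z.toFun 0) ((extChartAt 𝓘(ℝ, ℂ) i).symm y)
            (chartD i y Complex.I)] := by
  change Ω (Z.toFun 0 ((extChartAt 𝓘(ℝ, ℂ) i).symm y)) _ =
    Ω (Z.toFun 0 ((extChartAt 𝓘(ℝ, ℂ) i).symm y)) _
  congr 1
  ext k
  fin_cases k
  · exact Z.mfderiv_inChartAt_fst hy 0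
  · exact Z.mfderiv_inChartAt_snd hy 0 1
  · exact Z.mfderiv_inChartAt_snd hy 0 Complex.I

variable [IsManifold 𝓘(ℂ, E) ω W]

theorem SectionFamily.contDiffOn_contraction {Θ : DForm E W 2} (hΘ : IsSmoothForm Θ) (k : S) (v : ℂ) :
    ContDiffOn ℝ ∞ (fun y => Z.contraction Θ ((extChartAt 𝓘(ℝ, ℂ) k).symm y) (chartD k y v))
      (extChartAt 𝓘(ℝ, ℂ) k).target := by
  have h1 := contDiffOn_pullFlat_apply ((isOpen_extChartAt_target k).preimage continuous_snd)
    (Z.contMDiffOn_inChartAt k) hΘ ![((1, 0) : ℝ × ℂ), (0, v)]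
  have h2 : ContDiffOn ℝ ∞ (fun y : ℂ => ((0 : ℝ), y)) (extChartAt 𝓘(ℝ, ℂ) k).target :=
    (contDiff_const.prodMk contDiff_id).contDiffOn
  exact (h1.comp h2 fun y hy => hy).congr fun y hy => (Z.pullFlat_time Θ hy v).symm

/-- The homotopy formula for `Θ` along a family of sections. -/
theorem SectionFamily.fderiv_pullFlat {Θ : DForm E W 2} {Ω : DForm E W 3} (hΘ : IsSmoothForm Θ)
    (hdΘ : IsExtDeriv Θ Ω) {y : ℂ} (hy : y ∈ (extChartAt 𝓘(ℝ, ℂ) i).target) :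
    fderiv ℝ (fun p => pullFlat (Z.inChartAt i) Θ p ![((0, 1) : ℝ × ℂ), (0, Complex.I)]) (0, y)
      (1, 0) =
      Ω (Z.toFun 0 ((extChartAt 𝓘(ℝ, ℂ) i).symm y))
        ![Z.velocity 0 ((extChartAt 𝓘(ℝ, ℂ) i).symm y),
          mfderiv 𝓘(ℝ, ℂ) 𝓘(ℝ, E) (Z.toFun 0) ((extChartAt 𝓘(ℝ, ℂ) i).symm y) (chartD i y 1),
          mfderiv 𝓘(ℝ, ℂ) 𝓘(ℝ, E) (Z.toFun 0) ((extChartAt 𝓘(ℝ, ℂ) i).symm y)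
            (chartD i y Complex.I)] +
      (fderiv ℝ (fun y => Z.contraction Θ ((extChartAt 𝓘(ℝ, ℂ) i).symm y) (chartD i y Complex.I)) y 1 -
        fderiv ℝ (fun y => Z.contraction Θ ((extChartAt 𝓘(ℝ, ℂ) i).symm y) (chartD i y 1)) y
          Complex.I) := by
  have hU : IsOpen (Prod.snd ⁻¹' (extChartAt 𝓘(ℝ, ℂ) i).target : Set (ℝ × ℂ)) :=
    (isOpen_extChartAt_target i).preimage continuous_snd
  have hyU : ((0 : ℝ), y) ∈ (Prod.snd ⁻¹' (extChartAt 𝓘(ℝ, ℂ) i).target : Set (ℝ × ℂ)) := hy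
  obtain ⟨h1, h2⟩ := extDeriv_pullFlat hU (Z.contMDiffOn_inChartAt i) hyU hΘ hdΘ
  -- Evaluate `d(Z^*Θ) = Z^*Ω` on `∂_r` and the two coordinate directions; the components of `Z^*Θ`
  -- containing `∂_r` form the contraction 1-form.
  have h3 := extDeriv_two_apply h1 ((1, 0) : ℝ × ℂ) (0, 1) (0, Complex.I)
  rw [h2, Z.pullFlat_three Ω hy] at h3
  have h4 : ∀ v u : ℂ, fderiv ℝ (fun p => pullFlat (Z.inChartAt i) Θ p ![((1, 0) : ℝ × ℂ), (0, v)])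
      (0, y) (0, u) = fderiv ℝ (fun y => Z.contraction Θ ((extChartAt 𝓘(ℝ, ℂ) i).symm y)
        (chartD i y v)) y u := by
    intro v u
    have h5 := ((contDiffOn_pullFlat_apply hU (Z.contMDiffOn_inChartAt i) hΘ
      ![((1, 0) : ℝ × ℂ), (0, v)]).contDiffAt (hU.mem_nhds hyU)).differentiableAt (by simp)
    have h6 := h5.hasFDerivAt.comp y (hasFDerivAt_prodMk_right (𝕜 := ℝ) (0 : ℝ) y)
    have h7 : (fun y => Z.contraction Θ ((extChartAt 𝓘(ℝ, ℂ) i).symm y) (chartD i y v)) =ᶠ[𝓝 y]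
        ((fun p => pullFlat (Z.inChartAt i) Θ p ![((1, 0) : ℝ × ℂ), (0, v)]) ∘ fun y => (0, y)) := by
      filter_upwards [(isOpen_extChartAt_target i).mem_nhds hy] with z hz
      exact (Z.pullFlat_time Θ hz v).symm
    rw [h7.fderiv_eq, h6.fderiv]
    rfl
  rw [h4, h4] at h3
  rw [h3]
  ring

end Family

/-! ### The first variation of the action -/

section Action

variable {E : Type*} [NormedAddCommGroup E] [NormedSpace ℂ E] [FiniteDimensional ℂ E]
  {W : Type*} [TopologicalSpace W] [ChartedSpace E W] [IsManifold 𝓘(ℂ, E) ω W]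
  {S : Type*} [TopologicalSpace S] [ChartedSpace ℂ S] [IsManifold 𝓘(ℂ, ℂ) ω S]
  [T2Space S] [CompactSpace S] {σ : W → S}
  {hσ : MDifferentiable 𝓘(ℂ, E) 𝓘(ℂ, ℂ) σ} {Ω : DForm E W 3} {h : ConformalMetric S}
  {G : CompatibleMetric hσ Ω h} {P : Connection E σ}

theorem hasDerivAt_action {Θ : DForm E W 2} (hΘ : IsSmoothForm Θ) (γ : SectionFamily E σ) :
    HasDerivAt (fun r => action Θ (γ.slice r))
      (∑ i ∈ chartFinset S, ∫ y in (extChartAt 𝓘(ℝ, ℂ) i).target,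
        chartPartition S i ((extChartAt 𝓘(ℝ, ℂ) i).symm y) *
          fderiv ℝ (fun p => pullFlat (γ.inChartAt i) Θ p ![((0, 1) : ℝ × ℂ), (0, Complex.I)])
            (0, y) (1, 0)) 0 := by
  have h1 : ∀ r, action Θ (γ.slice r) = ∑ i ∈ chartFinset S,
      ∫ y in (extChartAt 𝓘(ℝ, ℂ) i).target,
        chartPartition S i ((extChartAt 𝓘(ℝ, ℂ) i).symm y) *
          pullFlat (γ.inChartAt i) Θ (r, y) ![((0, 1) : ℝ × ℂ), (0, Complex.I)] := fun r => by
    refine (finsum_chart_eq_sum fun i y =>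
      inChart (pullback (γ.toFun r) Θ) i y ![1, Complex.I]).trans ?_
    refine Finset.sum_congr rfl fun i _ =>
      setIntegral_congr_fun (isOpen_extChartAt_target i).measurableSet fun y hy => ?_
    simp only [γ.pullFlat_space Θ hy]
  simp only [h1]
  refine HasDerivAt.fun_sum fun i _ => ?_
  refine hasDerivAt_setIntegral_mul
    (c := fun y => chartPartition S i ((extChartAt 𝓘(ℝ, ℂ) i).symm y))
    (a := fun p => pullFlat (γ.inChartAt i) Θ p ![((0, 1) : ℝ × ℂ), (0, Complex.I)]) (isOpen_extChartAt_target i) (isCompact_chartCompact i)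
    (chartCompact_subset i) (contDiffOn_chartPartition i i).continuousOn (fun y hy => ?_) ?_
  · exact image_eq_zero_of_notMem_tsupport (f := chartPartition S i) (notMem_tsupport_of_diff hy)
  · exact contDiffOn_pullFlat_apply ((isOpen_extChartAt_target i).preimage continuous_snd)
      (γ.contMDiffOn_inChartAt i) hΘ _

/-- The second coordinate vector is `j` times the first, so the area density is the conformal
factor. -/
theorem inChart_smul_areaForm (h : ConformalMetric S) (q : S → ℝ) {i : S} {y : ℂ}
    (hy : y ∈ (extChartAt 𝓘(ℝ, ℂ) i).target) :
    inChart (fun t => q t • h.areaForm t) i y ![1, Complex.I] =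
      q ((extChartAt 𝓘(ℝ, ℂ) i).symm y) *
        h.inner ((extChartAt 𝓘(ℝ, ℂ) i).symm y) (chartD i y 1) (chartD i y 1) := by
  set t := (extChartAt 𝓘(ℝ, ℂ) i).symm y
  have e : chartD i y Complex.I = cplx ℂ t (chartD i y 1) := by
    have := chartD_mul hy Complex.I 1
    rw [mul_one] at this
    exact this
  change q t * h.inner t (cplx ℂ t (chartD i y 1)) (chartD i y Complex.I) = _
  rw [e]
  exact congrArg (q t * ·) (h.conformal t _ _)

theorem l2Inner_eq_sum (G : CompatibleMetric hσ Ω h) (Z : SmoothSection E σ)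
    (X Y : ∀ t : S, Vert E σ (Z.toFun t)) :
    l2Inner G Z X Y = ∑ i ∈ chartFinset S, ∫ y in (extChartAt 𝓘(ℝ, ℂ) i).target,
      chartPartition S i ((extChartAt 𝓘(ℝ, ℂ) i).symm y) *
        (G.g (Z.toFun ((extChartAt 𝓘(ℝ, ℂ) i).symm y)) (X ((extChartAt 𝓘(ℝ, ℂ) i).symm y))
          (Y ((extChartAt 𝓘(ℝ, ℂ) i).symm y)) *
        h.inner ((extChartAt 𝓘(ℝ, ℂ) i).symm y) (chartD i y 1) (chartD i y 1)) := by
  refine (finsum_chart_eq_sum fun i y => inChart (fun t => G.g (Z.toFun t) (X t) (Y t) •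
    h.areaForm t) i y ![1, Complex.I]).trans ?_
  refine Finset.sum_congr rfl fun i _ =>
    setIntegral_congr_fun (isOpen_extChartAt_target i).measurableSet fun y hy => ?_
  exact congrArg (chartPartition S i ((extChartAt 𝓘(ℝ, ℂ) i).symm y) * ·)
    (inChart_smul_areaForm h (fun t => G.g (Z.toFun t) (X t) (Y t)) hy)

/-- The homotopy formula integrated over the surface: its `Ω`-term is the `L²`-density by
`g_jNabla`, and its exact term drops out by Stokes. -/
theorem hasDerivAt_action_l2Inner (hΩ : IsCRMS σ Ω)
    (hs : ∀ w, Function.Surjective (mfderiv 𝓘(ℝ, E) 𝓘(ℝ, ℂ) σ w))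
    {α : ∀ w : W, Vert E σ w} (hα : IsCurvatureTerm G P α) {Θ : DForm E W 2} (hΘ : IsSmoothForm Θ)
    (hdΘ : IsExtDeriv Θ Ω) (γ : SectionFamily E σ) :
    HasDerivAt (fun r => action Θ (γ.slice r)) (l2Inner G (γ.slice 0)
      (fun t => jNabla G P (γ.slice 0) t - α (γ.toFun 0 t))
      (fun t => ⟨γ.velocity 0 t, γ.velocity_mem_vert hσ 0 t⟩)) 0 := by
  convert hasDerivAt_action hΘ γ using 1
  rw [l2Inner_eq_sum]
  -- The vanishing Stokes sum is added to the `L²`-product, so that the two sides can be compared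
  -- chart by chart.
  refine ((add_zero _).symm.trans (congrArg (_ + ·)
    (finsum_integral_curl_eq_zero (γ.contDiffOn_contraction hΘ)).symm)).trans ?_
  refine Finset.sum_add_distrib.symm.trans (Finset.sum_congr rfl fun i _ => ?_)
  have hT := isOpen_extChartAt_target (I := 𝓘(ℝ, ℂ)) i
  have hU : IsOpen (Prod.snd ⁻¹' (extChartAt 𝓘(ℝ, ℂ) i).target : Set (ℝ × ℂ)) :=
    hT.preimage continuous_snd
  have hline : ContinuousOn (fun y : ℂ => ((0 : ℝ), y)) (extChartAt 𝓘(ℝ, ℂ) i).target :=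
    (continuous_const.prodMk continuous_id).continuousOn
  have hint : ∀ q : ℂ → ℝ, ContinuousOn q (extChartAt 𝓘(ℝ, ℂ) i).target →
      IntegrableOn (fun y => chartPartition S i ((extChartAt 𝓘(ℝ, ℂ) i).symm y) * q y)
        (extChartAt 𝓘(ℝ, ℂ) i).target := fun q hq =>
    integrableOn_of_eq_zero_off_compact (isCompact_chartCompact i) (chartCompact_subset i)
      hT.measurableSet ((contDiffOn_chartPartition i i).continuousOn.mul hq) fun y hy => by
        rw [image_eq_zero_of_notMem_tsupport (f := chartPartition S i) (notMem_tsupport_of_diff hy),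
          zero_mul]
  have hcurl : ∀ v u, ContinuousOn (fun y => fderiv ℝ (fun y => γ.contraction Θ
      ((extChartAt 𝓘(ℝ, ℂ) i).symm y) (chartD i y v)) y u) (extChartAt 𝓘(ℝ, ℂ) i).target := fun v u =>
    ((γ.contDiffOn_contraction hΘ i v).continuousOn_fderiv_of_isOpen hT (by simp)).clm_apply
      continuousOn_const
  have hda : ContinuousOn (fun y => fderiv ℝ (fun p => pullFlat (γ.inChartAt i) Θ p
      ![((0, 1) : ℝ × ℂ), (0, Complex.I)]) (0, y) (1, 0)) (extChartAt 𝓘(ℝ, ℂ) i).target :=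
    (((contDiffOn_pullFlat_apply hU (γ.contMDiffOn_inChartAt i) hΘ _).continuousOn_fderiv_of_isOpen
      hU (by simp)).clm_apply continuousOn_const).comp hline fun y hy => hy
  have hg : ∀ y ∈ (extChartAt 𝓘(ℝ, ℂ) i).target,
      G.g (γ.toFun 0 ((extChartAt 𝓘(ℝ, ℂ) i).symm y))
        (jNabla G P (γ.slice 0) ((extChartAt 𝓘(ℝ, ℂ) i).symm y) -
          α (γ.toFun 0 ((extChartAt 𝓘(ℝ, ℂ) i).symm y)))
        ⟨γ.velocity 0 ((extChartAt 𝓘(ℝ, ℂ) i).symm y), γ.velocity_mem_vert hσ 0 _⟩ *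
        h.inner ((extChartAt 𝓘(ℝ, ℂ) i).symm y) (chartD i y 1) (chartD i y 1) =
      fderiv ℝ (fun p => pullFlat (γ.inChartAt i) Θ p ![((0, 1) : ℝ × ℂ), (0, Complex.I)])
        (0, y) (1, 0) -
      (fderiv ℝ (fun y => γ.contraction Θ ((extChartAt 𝓘(ℝ, ℂ) i).symm y) (chartD i y Complex.I)) y 1 -
        fderiv ℝ (fun y => γ.contraction Θ ((extChartAt 𝓘(ℝ, ℂ) i).symm y) (chartD i y 1)) y
          Complex.I) := by
    intro y hy
    rw [γ.fderiv_pullFlat hΘ hdΘ hy, add_sub_cancel_right, mul_comm, G.symm]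
    refine (g_jNabla hΩ hs hα (γ.slice 0) ((extChartAt 𝓘(ℝ, ℂ) i).symm y) (chartD i y 1) _).trans ?_
    have e : chartD i y Complex.I = cplx ℂ ((extChartAt 𝓘(ℝ, ℂ) i).symm y) (chartD i y 1) := by
      have := chartD_mul hy Complex.I 1
      rw [mul_one] at this
      exact this
    rw [e]
  refine (congrArg (· + _) (setIntegral_congr_fun hT.measurableSet fun y hy =>
    congrArg (chartPartition S i ((extChartAt 𝓘(ℝ, ℂ) i).symm y) * ·) (hg y hy))).trans ?_
  refine (integral_add (hint _ (hda.sub ((hcurl _ _).sub (hcurl _ _))))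
    (hint _ ((hcurl _ _).sub (hcurl _ _)))).symm.trans ?_
  refine setIntegral_congr_fun hT.measurableSet fun y _ => ?_
  simp only [Pi.sub_apply]
  ring

theorem isGradient_jNabla (hΩ : IsCRMS σ Ω)
    (hs : ∀ w, Function.Surjective (mfderiv 𝓘(ℝ, E) 𝓘(ℝ, ℂ) σ w))
    {α : ∀ w : W, Vert E σ w} (hα : IsCurvatureTerm G P α) {Θ : DForm E W 2} (hΘ : IsSmoothForm Θ)
    (hdΘ : IsExtDeriv Θ Ω) (Z : SmoothSection E σ) :
    IsGradient G Θ Z (fun t => jNabla G P Z t - α (Z.toFun t)) := by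
  refine ⟨jNabla_sub_smooth hΩ hs hα Z, fun Y _ γ hγ => ?_⟩
  -- Equality in the tangent bundle includes the base points, so the family determines `Z`;
  -- substituting it makes the two velocity fields comparable without transport.
  obtain rfl : γ.slice 0 = Z :=
    SmoothSection.eq_of_toFun_eq (funext fun t => congrArg Bundle.TotalSpace.proj (hγ t))
  have hY : Y = fun t => ⟨γ.velocity 0 t, γ.velocity_mem_vert hσ 0 t⟩ := by
    funext t
    exact Subtype.ext (eq_of_heq (Bundle.TotalSpace.mk.inj (hγ t)).2).symm
  rw [hY]
  exact hasDerivAt_action_l2Inner hΩ hs hα hΘ hdΘ γ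

end Action

/-! ### Uniqueness of the gradient -/

section Variations

variable {E : Type*} [NormedAddCommGroup E] [NormedSpace ℂ E]
  {W : Type*} [TopologicalSpace W] [ChartedSpace E W]
  {S : Type*} [TopologicalSpace S] [ChartedSpace ℂ S] {σ : W → S}
  [IsManifold 𝓘(ℂ, ℂ) ω S]

theorem exists_bump [T2Space S] {t₀ : S} {U : Set S} (hU : U ∈ 𝓝 t₀) :
    ∃ χ : S → ℝ, ContMDiff 𝓘(ℝ, ℂ) 𝓘(ℝ, ℝ) ∞ χ ∧ χ t₀ = 1 ∧ (∀ t, 0 ≤ χ t) ∧ (∀ t, χ t ≤ 1) ∧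
      tsupport χ ⊆ U := by
  obtain ⟨f, hf, -⟩ := (SmoothBumpFunction.nhds_basis_support (I := 𝓘(ℝ, ℂ)) hU).mem_iff.1
    (Filter.univ_mem)
  exact ⟨f, f.contMDiff, f.eq_one, fun _ => f.nonneg, fun _ => f.le_one, hf⟩

/-- Rescaling the parameter of a family of sections by a function on the base. -/
noncomputable def SectionFamily.scale (γ : SectionFamily E σ) {χ : S → ℝ}
    (hχ : ContMDiff 𝓘(ℝ, ℂ) 𝓘(ℝ, ℝ) ∞ χ) : SectionFamily E σ where
  toFun r t := γ.toFun (χ t * r) t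
  smooth := by
    have h1 : ContMDiff (𝓘(ℝ, ℝ).prod 𝓘(ℝ, ℂ)) 𝓘(ℝ, ℝ) ∞ (fun p : ℝ × S => χ p.2 * p.1) :=
      (hχ.comp contMDiff_snd).mul contMDiff_fst
    exact γ.smooth.comp (h1.prodMk contMDiff_snd)
  isSection r t := γ.isSection _ t

theorem SectionFamily.scale_velocity (γ : SectionFamily E σ) {χ : S → ℝ}
    (hχ : ContMDiff 𝓘(ℝ, ℂ) 𝓘(ℝ, ℝ) ∞ χ) (t : S) :
    (⟨(γ.scale hχ).toFun 0 t, (γ.scale hχ).velocity 0 t⟩ : TangentBundle 𝓘(ℝ, E) W) =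
      ⟨γ.toFun 0 t, χ t • γ.velocity 0 t⟩ := by
  have hd : ∀ s, MDifferentiableAt 𝓘(ℝ, ℝ) 𝓘(ℝ, E) (fun r => γ.toFun r t) s := fun s =>
    (γ.smooth.comp (contMDiff_id.prodMk contMDiff_const) :
      ContMDiff 𝓘(ℝ, ℝ) 𝓘(ℝ, E) ∞ (fun r => γ.toFun r t)).mdifferentiableAt (by simp)
  have h1 : HasFDerivAt (fun r : ℝ => χ t * r) (χ t • ContinuousLinearMap.id ℝ ℝ) 0 :=
    (hasFDerivAt_id (0 : ℝ)).const_mul (χ t)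
  have h2 := mfderiv_comp_apply (0 : ℝ) (hd (χ t * 0)) h1.hasMFDerivAt.mdifferentiableAt (1 : ℝ)
  rw [h1.hasMFDerivAt.mfderiv] at h2
  have h3 : (γ.scale hχ).velocity 0 t = χ t • γ.velocity (χ t * 0) t :=
    h2.trans ((mfderiv 𝓘(ℝ, ℝ) 𝓘(ℝ, E) (fun r => γ.toFun r t) (χ t * 0)).map_smul (χ t) (1 : ℝ))
  have h4 : ∀ s, s = 0 → (⟨γ.toFun s t, χ t • γ.velocity s t⟩ : TangentBundle 𝓘(ℝ, E) W) =
      ⟨γ.toFun 0 t, χ t • γ.velocity 0 t⟩ := by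
    rintro s rfl; rfl
  rw [h3]
  exact h4 _ (mul_zero _)

theorem SectionFamily.smoothAlongAt_velocity [IsManifold 𝓘(ℂ, E) ω W] (γ : SectionFamily E σ)
    (t : S) : SmoothAlongAt 𝓘(ℝ, ℂ) (γ.toFun 0) (γ.velocity 0) t := by
  set φ := extChartAt 𝓘(ℝ, ℂ) t
  have hU : IsOpen (Prod.snd ⁻¹' φ.target : Set (ℝ × ℂ)) :=
    (isOpen_extChartAt_target t).preimage continuous_snd
  have hy : ((0 : ℝ), φ t) ∈ (Prod.snd ⁻¹' φ.target : Set (ℝ × ℂ)) := mem_extChartAt_target t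
  have h1 := smoothAlongAt_mfderiv hU (γ.contMDiffOn_inChartAt t) hy ((1, 0) : ℝ × ℂ)
  have h2 : ContMDiffAt 𝓘(ℝ, ℂ) 𝓘(ℝ, ℝ × ℂ) ∞ (fun t' : S => ((0 : ℝ), φ t')) t :=
    contMDiffAt_const.prodMk_space contMDiffAt_extChartAt
  refine ContMDiffAt.congr_of_eventuallyEq (h1.comp (k₀ := t) h2) ?_
  filter_upwards [extChartAt_source_mem_nhds (I := 𝓘(ℝ, ℂ)) t] with t' ht'
  have h3 : φ.symm (φ t') = t' := φ.left_inv ht'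
  have h4 : mfderiv 𝓘(ℝ, ℝ × ℂ) 𝓘(ℝ, E) (γ.inChartAt t) (0, φ t') ((1, 0) : ℝ × ℂ) =
      γ.velocity 0 (φ.symm (φ t')) := γ.mfderiv_inChartAt_fst (φ.map_source ht') 0
  have h5 : ∀ s, s = t' → (⟨γ.toFun 0 t', γ.velocity 0 t'⟩ : TangentBundle 𝓘(ℝ, E) W) =
      ⟨γ.toFun 0 s, γ.velocity 0 s⟩ := by
    rintro s rfl; rfl
  refine (h5 _ h3).trans ?_
  rw [← h4]
  rfl

/-- Every vertical tangent vector is the velocity of a family of sections. -/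
theorem exists_family [T2Space S] {B : Type*} [NormedAddCommGroup B] [NormedSpace ℝ B]
    {F : Type*} [TopologicalSpace F] [ChartedSpace B F] [IsManifold 𝓘(ℝ, B) ∞ F]
    (hσ : MDifferentiable 𝓘(ℂ, E) 𝓘(ℂ, ℂ) σ)
    (hb : IsSmoothFiberBundle E B F σ) (Z : SmoothSection E σ) (t₀ : S) (v : Vert E σ (Z.toFun t₀)) :
    ∃ γ : SectionFamily E σ, γ.slice 0 = Z ∧
      (⟨γ.toFun 0 t₀, γ.velocity 0 t₀⟩ : TangentBundle 𝓘(ℝ, E) W) = ⟨Z.toFun t₀, v⟩ := by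
  classical
  obtain ⟨e, he, hs1, hs2⟩ := hb t₀
  have hw : (Z.toFun t₀) ∈ e.source := e.mem_source.2 (by rw [Z.isSection]; exact he)
  have he' : ContinuousAt e (Z.toFun t₀) :=
    ((hs1 _ hw).contMDiffAt (e.open_source.mem_nhds hw)).continuousAt
  set ψ := extChartAt 𝓘(ℝ, B) (e (Z.toFun t₀)).2 with hψ
  let L : S × B → W := fun p => e.toOpenPartialHomeomorph.symm (p.1, ψ.symm p.2)
  have hLO : IsOpen (e.baseSet ×ˢ ψ.target) :=
    e.open_baseSet.prod (isOpen_extChartAt_target _)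
  have hL : ContMDiffOn (𝓘(ℝ, ℂ).prod 𝓘(ℝ, B)) 𝓘(ℝ, E) ∞ L (e.baseSet ×ˢ ψ.target) := by
    refine hs2.comp (contMDiff_fst.contMDiffOn.prodMk
      ((contMDiffOn_extChartAt_symm (e (Z.toFun t₀)).2).comp contMDiff_snd.contMDiffOn fun p hp => hp.2)) ?_
    intro p hp
    exact e.mem_target.2 hp.1
  let q : W → B := fun w => ψ (e w).2
  have hq : ∀ w ∈ e.source, (e w).2 ∈ ψ.source → ContMDiffAt 𝓘(ℝ, E) 𝓘(ℝ, B) ∞ q w := by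
    intro w hw1 hw2
    have h1 : ContMDiffAt 𝓘(ℝ, E) 𝓘(ℝ, B) ∞ (fun w => (e w).2) w :=
      contMDiffAt_snd.comp w ((hs1 w hw1).contMDiffAt (e.open_source.mem_nhds hw1))
    exact (contMDiffAt_extChartAt' (by rwa [hψ, extChartAt_source] at hw2)).comp w h1
  have hLq : ∀ w ∈ e.source, (e w).2 ∈ ψ.source → L (σ w, q w) = w := by
    intro w hw1 hw2
    change e.toOpenPartialHomeomorph.symm (σ w, ψ.symm (ψ (e w).2)) = w
    rw [ψ.left_inv hw2, e.mk_proj_snd hw1]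
    exact e.toOpenPartialHomeomorph.left_inv hw1
  have hσL : ∀ p ∈ e.baseSet ×ˢ ψ.target, σ (L p) = p.1 := fun p hp => e.proj_symm_apply' hp.1
  have hw2 : (e (Z.toFun t₀)).2 ∈ ψ.source := mem_extChartAt_source _
  let z : S → B := fun t => q (Z.toFun t)
  obtain ⟨ε, hε, hball⟩ := Metric.isOpen_iff.1 (isOpen_extChartAt_target (I := 𝓘(ℝ, B)) (e (Z.toFun t₀)).2)
    (z t₀) (ψ.map_source hw2)
  have hnear : ∀ᶠ t in 𝓝 t₀, t ∈ e.baseSet ∧ (e (Z.toFun t)).2 ∈ ψ.source ∧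
      dist (z t) (z t₀) < ε / 2 := by
    have hZ : ContinuousAt Z.toFun t₀ := Z.smooth.continuous.continuousAt
    have h1 : ContinuousAt (fun t => (e (Z.toFun t)).2) t₀ := (ContinuousAt.comp (g := e) he' hZ).snd
    have h2 : ContinuousAt z t₀ := ContinuousAt.comp (g := q) (hq (Z.toFun t₀) hw hw2).continuousAt hZ
    filter_upwards [e.open_baseSet.mem_nhds he,
      h1.eventually ((isOpen_extChartAt_source _).mem_nhds hw2),
      h2.eventually (Metric.ball_mem_nhds _ (half_pos hε))] with t a1 a2 a3
    exact ⟨a1, a2, a3⟩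
  obtain ⟨U, hU, hUo, ht₀⟩ := eventually_nhds_iff.1 hnear
  obtain ⟨χ, hχ, hχ1, hχ0, hχle, hχs⟩ := exists_bump (hUo.mem_nhds ht₀)
  let y : B := mfderiv 𝓘(ℝ, E) 𝓘(ℝ, B) q (Z.toFun t₀) v
  -- Over `U` the section stays within `ε/2` of the centre `z t₀` in the fibre chart, so the
  -- displacement may use the other `ε/2`.
  let δ : ℝ := ε / (2 * (‖y‖ + 1))
  have hy1 : 0 < ‖y‖ + 1 := by positivity
  have hδ : 0 < δ := by positivity
  have hδy : δ * ‖y‖ < ε / 2 := by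
    have h1 : δ * (‖y‖ + 1) = ε / 2 := by
      simp only [δ]; field_simp
    nlinarith
  -- A family must exist for all real `r`. The function `δ sin(r/δ)` has derivative `1` at `0` but
  -- is bounded by `δ`, so the perturbed section never leaves the fibre chart.
  let ζ : ℝ → S → B := fun r t => z t + (χ t * (δ * Real.sin (r / δ))) • y
  have hζT : ∀ r, ∀ t ∈ U, ζ r t ∈ ψ.target := by
    intro r t ht
    refine hball ?_
    have h1 : dist (ζ r t) (z t) < ε / 2 := by
      rw [dist_eq_norm]
      simp only [ζ, add_sub_cancel_left, norm_smul, norm_mul, Real.norm_eq_abs]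
      refine lt_of_le_of_lt ?_ hδy
      refine mul_le_mul_of_nonneg_right ?_ (norm_nonneg _)
      have a1 : |χ t| ≤ 1 := by rw [abs_of_nonneg (hχ0 t)]; exact hχle t
      have a2 := Real.abs_sin_le_one (r / δ)
      calc |χ t| * (|δ| * |Real.sin (r / δ)|) ≤ 1 * (δ * 1) := by
            rw [abs_of_pos hδ]
            gcongr
        _ = δ := by ring
    calc dist (ζ r t) (z t₀) ≤ dist (ζ r t) (z t) + dist (z t) (z t₀) := dist_triangle _ _ _
      _ < ε / 2 + ε / 2 := add_lt_add h1 (hU t ht).2.2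
      _ = ε := by ring
  have hsrc : ∀ t ∈ U, Z.toFun t ∈ e.source := fun t ht =>
    e.mem_source.2 (by rw [Z.isSection]; exact (hU t ht).1)
  have hζ0 : ∀ r, ∀ t ∈ U, χ t * (δ * Real.sin (r / δ)) = 0 → L (t, ζ r t) = Z.toFun t := by
    intro r t ht h0
    have h1 := hLq _ (hsrc t ht) (hU t ht).2.1
    rw [Z.isSection] at h1
    simpa only [ζ, h0, zero_smul, add_zero] using h1
  -- The two branches agree off the support of `χ`, which lies in `U`, so the family is smooth
  -- across the boundary of `U`.
  let f : ℝ → S → W := fun r t => if t ∈ U then L (t, ζ r t) else Z.toFun t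
  have hfU : ∀ r, ∀ t ∈ U, f r t = L (t, ζ r t) := fun r t ht => if_pos ht
  have hf0 : ∀ t, f 0 t = Z.toFun t := by
    intro t
    by_cases ht : t ∈ U
    · rw [hfU 0 t ht]
      exact hζ0 0 t ht (by simp)
    · exact if_neg ht
  have hfs : ∀ r, ∀ t ∉ tsupport χ, f r t = Z.toFun t := by
    intro r t ht
    by_cases htU : t ∈ U
    · rw [hfU r t htU]
      exact hζ0 r t htU (by rw [image_eq_zero_of_notMem_tsupport ht, zero_mul])
    · exact if_neg htU
  have hsin : ContDiff ℝ ∞ (fun r : ℝ => δ * Real.sin (r / δ)) :=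
    contDiff_const.mul (Real.contDiff_sin.comp (contDiff_id.div_const δ))
  let γ : SectionFamily E σ :=
    { toFun := f
      smooth := by
        rintro ⟨r, t⟩
        by_cases ht : t ∈ U
        · have h1 : ContMDiffAt (𝓘(ℝ, ℝ).prod 𝓘(ℝ, ℂ)) 𝓘(ℝ, B) ∞ (fun p : ℝ × S => ζ p.1 p.2) (r, t) := by
            have a1 : ContMDiffAt 𝓘(ℝ, ℂ) 𝓘(ℝ, B) ∞ z t :=
              (hq _ (hsrc t ht) (hU t ht).2.1).comp t Z.smooth.contMDiffAt
            have a2 : ContMDiff (𝓘(ℝ, ℝ).prod 𝓘(ℝ, ℂ)) 𝓘(ℝ, ℝ) ∞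
                (fun p : ℝ × S => χ p.2 * (δ * Real.sin (p.1 / δ))) :=
              (hχ.comp contMDiff_snd).mul (hsin.contMDiff.comp contMDiff_fst)
            exact (a1.comp (r, t) contMDiffAt_snd).add (a2.contMDiffAt.smul contMDiffAt_const)
          have h2 : ContMDiffAt (𝓘(ℝ, ℝ).prod 𝓘(ℝ, ℂ)) 𝓘(ℝ, E) ∞
              (fun p : ℝ × S => L (p.2, ζ p.1 p.2)) (r, t) :=
            (hL.contMDiffAt (hLO.mem_nhds ⟨(hU t ht).1, hζT r t ht⟩)).comp (r, t)
              (contMDiffAt_snd.prodMk h1)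
          refine h2.congr_of_eventuallyEq ?_
          filter_upwards [(hUo.preimage continuous_snd).mem_nhds (show (r, t) ∈ Prod.snd ⁻¹' U from ht)]
            with p hp
          exact hfU p.1 p.2 hp
        · have ht' : t ∉ tsupport χ := fun h => ht (hχs h)
          refine (Z.smooth.contMDiffAt.comp (r, t) contMDiffAt_snd).congr_of_eventuallyEq ?_
          filter_upwards [((isClosed_tsupport χ).isOpen_compl.preimage continuous_snd).mem_nhds
            (show (r, t) ∈ Prod.snd ⁻¹' (tsupport χ)ᶜ from ht')] with p hp
          exact hfs p.1 p.2 hp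
      isSection := by
        intro r t
        by_cases ht : t ∈ U
        · rw [hfU r t ht]
          exact hσL (t, ζ r t) ⟨(hU t ht).1, hζT r t ht⟩
        · have : f r t = Z.toFun t := if_neg ht
          rw [this, Z.isSection] }
  refine ⟨γ, ?_, ?_⟩
  · exact SmoothSection.eq_of_toFun_eq (funext hf0)
  -- The curve at `t₀` is `L ∘ c`, while `L ∘ Q` is the identity near `Z(t₀)`. Both `c'(0)` and
  -- `dQ(v)` equal `(0, y)`, the latter because `v` is vertical, so the velocity is `v`.
  · let Q : W → S × B := fun w => (σ w, q w)
    let c : ℝ → S × B := fun r => (t₀, ζ r t₀)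
    have hcurve : (fun r => γ.toFun r t₀) = L ∘ c := funext fun r => hfU r t₀ ht₀
    have hc0 : c 0 = Q (Z.toFun t₀) := by
      refine Prod.ext (Z.isSection t₀).symm ?_
      simp [c, Q, ζ, z]
    have hqd : MDifferentiableAt 𝓘(ℝ, E) 𝓘(ℝ, B) q (Z.toFun t₀) := (hq (Z.toFun t₀) hw hw2).mdifferentiableAt (by simp)
    have hQd : HasMFDerivAt 𝓘(ℝ, E) (𝓘(ℝ, ℂ).prod 𝓘(ℝ, B)) Q (Z.toFun t₀) _ :=
      (mdifferentiable_real hσ (Z.toFun t₀)).hasMFDerivAt.prodMk hqd.hasMFDerivAt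
    have hζd : HasDerivAt (fun r => ζ r t₀) ((1 : ℝ) • y) 0 := by
      have h1 : HasDerivAt (fun r : ℝ => χ t₀ * (δ * Real.sin (r / δ))) 1 0 := by
        have a1 := (((hasDerivAt_id (0 : ℝ)).div_const δ).sin.const_mul δ).const_mul (χ t₀)
        refine a1.congr_deriv ?_
        rw [hχ1]
        simp [hδ.ne']
      exact (h1.smul_const y).const_add (z t₀)
    have hcd : HasMFDerivAt 𝓘(ℝ, ℝ) (𝓘(ℝ, ℂ).prod 𝓘(ℝ, B)) c 0 _ :=
      (hasMFDerivAt_const t₀ (0 : ℝ)).prodMk hζd.hasFDerivAt.hasMFDerivAt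
    have hLd : MDifferentiableAt (𝓘(ℝ, ℂ).prod 𝓘(ℝ, B)) 𝓘(ℝ, E) L (Q (Z.toFun t₀)) := by
      refine (hL.contMDiffAt (hLO.mem_nhds ⟨?_, ψ.map_source hw2⟩)).mdifferentiableAt (by simp)
      exact (e.mem_source.1 hw : σ (Z.toFun t₀) ∈ e.baseSet)
    have e1 : (⟨γ.toFun 0 t₀, γ.velocity 0 t₀⟩ : TangentBundle 𝓘(ℝ, E) W) =
        tangentMap 𝓘(ℝ, ℝ) 𝓘(ℝ, E) (L ∘ c) ⟨0, (1 : ℝ)⟩ := by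
      rw [← hcurve]; rfl
    have hLQ : L ∘ Q =ᶠ[𝓝 (Z.toFun t₀)] id := by
      have h1 : ContinuousAt (fun w => (e w).2) (Z.toFun t₀) := he'.snd
      filter_upwards [e.open_source.mem_nhds hw,
        h1.eventually ((isOpen_extChartAt_source _).mem_nhds hw2)] with w a1 a2
      exact hLq w a1 a2
    have e2 : (⟨(Z.toFun t₀), v⟩ : TangentBundle 𝓘(ℝ, E) W) =
        tangentMap 𝓘(ℝ, E) 𝓘(ℝ, E) (L ∘ Q) ⟨(Z.toFun t₀), v⟩ := by
      have h1 : tangentMap 𝓘(ℝ, E) 𝓘(ℝ, E) (L ∘ Q) ⟨(Z.toFun t₀), v⟩ =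
          tangentMap 𝓘(ℝ, E) 𝓘(ℝ, E) (id : W → W) ⟨(Z.toFun t₀), v⟩ := by
        have a1 := hLQ.eq_of_nhds
        have a2 := hLQ.mfderiv_eq (I := 𝓘(ℝ, E)) (I' := 𝓘(ℝ, E))
        exact Bundle.TotalSpace.ext a1 (heq_of_eq (congrArg (fun A : E →L[ℝ] E =>
          A (v : TangentSpace 𝓘(ℝ, E) (Z.toFun t₀))) a2))
      rw [h1, tangentMap_id]
      rfl
    refine e1.trans (Eq.trans ?_ e2.symm)
    rw [tangentMap_comp_at _ (by rw [hc0]; exact hLd) hcd.mdifferentiableAt,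
      tangentMap_comp_at _ hLd hQd.mdifferentiableAt]
    congr 1
    have e3 : ∀ p p' : S × B, p = p' → ∀ u : ℂ × B,
        (⟨p, u⟩ : TangentBundle (𝓘(ℝ, ℂ).prod 𝓘(ℝ, B)) (S × B)) = ⟨p', u⟩ := by
      rintro p _ rfl u; rfl
    have e4 : tangentMap 𝓘(ℝ, ℝ) (𝓘(ℝ, ℂ).prod 𝓘(ℝ, B)) c ⟨0, (1 : ℝ)⟩ =
        ⟨c 0, ((0, y) : ℂ × B)⟩ := by
      refine Bundle.TotalSpace.ext rfl (heq_of_eq ?_)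
      change mfderiv 𝓘(ℝ, ℝ) (𝓘(ℝ, ℂ).prod 𝓘(ℝ, B)) c 0 (1 : ℝ) = ((0, y) : ℂ × B)
      rw [hcd.mfderiv]
      exact Prod.ext rfl ((one_smul ℝ _).trans (one_smul ℝ y))
    have e5 : tangentMap 𝓘(ℝ, E) (𝓘(ℝ, ℂ).prod 𝓘(ℝ, B)) Q ⟨(Z.toFun t₀), v⟩ =
        ⟨Q (Z.toFun t₀), ((0, y) : ℂ × B)⟩ := by
      refine Bundle.TotalSpace.ext rfl (heq_of_eq ?_)
      change mfderiv 𝓘(ℝ, E) (𝓘(ℝ, ℂ).prod 𝓘(ℝ, B)) Q (Z.toFun t₀) v = ((0, y) : ℂ × B)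
      rw [hQd.mfderiv]
      have hv : mfderiv 𝓘(ℝ, E) 𝓘(ℝ, ℂ) σ (Z.toFun t₀) v = 0 := v.2
      exact Prod.ext hv rfl
    rw [e4, e5]
    exact e3 _ _ hc0 _

end Variations

/-! ### Positivity of the `L²`-product and the test variation -/

section Uniqueness

variable {E : Type*} [NormedAddCommGroup E] [NormedSpace ℂ E] [FiniteDimensional ℂ E]
  {W : Type*} [TopologicalSpace W] [ChartedSpace E W] [IsManifold 𝓘(ℂ, E) ω W]
  {S : Type*} [TopologicalSpace S] [ChartedSpace ℂ S] [IsManifold 𝓘(ℂ, ℂ) ω S]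
  {σ : W → S}
  {hσ : MDifferentiable 𝓘(ℂ, E) 𝓘(ℂ, ℂ) σ} {Ω : DForm E W 3} {h : ConformalMetric S}
  {G : CompatibleMetric hσ Ω h} (P : Connection E σ) {Z : SmoothSection E σ}
  {X X' Y : ∀ t : S, Vert E σ (Z.toFun t)}

include P in
theorem continuous_g (hX : Z.SmoothAlong X) (hY : Z.SmoothAlong Y) :
    Continuous fun t => G.g (Z.toFun t) (X t) (Y t) :=
  continuous_iff_continuousAt.2 fun t =>
    (G.contMDiffAt_g P (f := Z.toFun) (X := X) (Y := Y) (hX t) (hY t)).continuousAt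

theorem ConformalMetric.inner_self_nonneg (h : ConformalMetric S) (t : S)
    (ρ : TangentSpace 𝓘(ℝ, ℂ) t) : 0 ≤ h.inner t ρ ρ := by
  by_cases h0 : ρ = 0
  · rw [h0, map_zero]
  · exact (h.pos' h0).le

theorem continuousOn_conformalFactor (h : ConformalMetric S) (i : S) :
    ContinuousOn (fun y => h.inner ((extChartAt 𝓘(ℝ, ℂ) i).symm y) (chartD i y 1) (chartD i y 1))
      (extChartAt 𝓘(ℝ, ℂ) i).target := by
  intro y hy
  have h1 := smoothAlongAt_mfderiv (isOpen_extChartAt_target i)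
    (contMDiffOn_extChartAt_symm (I := 𝓘(ℝ, ℂ)) (n := ∞) i) hy (1 : ℂ)
  exact (h.contMDiffAt_inner h1 h1).continuousAt.continuousWithinAt

theorem SmoothSection.SmoothAlong.sub (hX : Z.SmoothAlong X) (hX' : Z.SmoothAlong X') :
    Z.SmoothAlong (fun t => X t - X' t) := by
  intro t
  have h1 : SmoothAlongAt 𝓘(ℝ, ℂ) Z.toFun
      (fun t => (X t : TangentSpace 𝓘(ℝ, E) (Z.toFun t))) t := hX t
  have h2 : SmoothAlongAt 𝓘(ℝ, ℂ) Z.toFun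
      (fun t => (X' t : TangentSpace 𝓘(ℝ, E) (Z.toFun t))) t := hX' t
  exact h1.sub h2

variable [T2Space S] [CompactSpace S]

include P in
theorem continuousOn_l2density (hX : Z.SmoothAlong X) (hY : Z.SmoothAlong Y) (i : S) :
    ContinuousOn (fun y => chartPartition S i ((extChartAt 𝓘(ℝ, ℂ) i).symm y) *
      (G.g (Z.toFun ((extChartAt 𝓘(ℝ, ℂ) i).symm y)) (X ((extChartAt 𝓘(ℝ, ℂ) i).symm y))
        (Y ((extChartAt 𝓘(ℝ, ℂ) i).symm y)) *
      h.inner ((extChartAt 𝓘(ℝ, ℂ) i).symm y) (chartD i y 1) (chartD i y 1)))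
      (extChartAt 𝓘(ℝ, ℂ) i).target :=
  (contDiffOn_chartPartition i i).continuousOn.mul
    (((continuous_g (G := G) P hX hY).comp_continuousOn (continuousOn_extChartAt_symm i)).mul
      (continuousOn_conformalFactor h i))

include P in
theorem integrableOn_l2density (hX : Z.SmoothAlong X) (hY : Z.SmoothAlong Y) (i : S) :
    IntegrableOn (fun y => chartPartition S i ((extChartAt 𝓘(ℝ, ℂ) i).symm y) *
      (G.g (Z.toFun ((extChartAt 𝓘(ℝ, ℂ) i).symm y)) (X ((extChartAt 𝓘(ℝ, ℂ) i).symm y))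
        (Y ((extChartAt 𝓘(ℝ, ℂ) i).symm y)) *
      h.inner ((extChartAt 𝓘(ℝ, ℂ) i).symm y) (chartD i y 1) (chartD i y 1)))
      (extChartAt 𝓘(ℝ, ℂ) i).target :=
  integrableOn_of_eq_zero_off_compact (isCompact_chartCompact i) (chartCompact_subset i)
    (isOpen_extChartAt_target i).measurableSet (continuousOn_l2density P hX hY i) fun y hy => by
      rw [image_eq_zero_of_notMem_tsupport (f := chartPartition S i) (notMem_tsupport_of_diff hy),
        zero_mul]

include P in
theorem l2Inner_sub_left (hX : Z.SmoothAlong X) (hX' : Z.SmoothAlong X') (hY : Z.SmoothAlong Y) :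
    l2Inner G Z (fun t => X t - X' t) Y = l2Inner G Z X Y - l2Inner G Z X' Y := by
  simp only [l2Inner_eq_sum]
  rw [← Finset.sum_sub_distrib]
  refine Finset.sum_congr rfl fun i _ => ?_
  refine Eq.trans ?_ (integral_sub (integrableOn_l2density P hX hY i)
    (integrableOn_l2density P hX' hY i))
  refine integral_congr_ae (Eventually.of_forall fun y => ?_)
  simp only [map_sub, LinearMap.sub_apply]
  ring

include P in
-- Some partition function is nonzero at `t₀`. In its chart the density is continuous, nonnegative
-- and nonzero at the image of `t₀`, so its support there is a nonempty open set of positive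
-- measure.
theorem l2Inner_pos (hX : Z.SmoothAlong X) (hY : Z.SmoothAlong Y)
    (hnn : ∀ t, 0 ≤ G.g (Z.toFun t) (X t) (Y t)) {t₀ : S} (hpos : 0 < G.g (Z.toFun t₀) (X t₀) (Y t₀)) :
    0 < l2Inner G Z X Y := by
  rw [l2Inner_eq_sum]
  obtain ⟨i, hi, hi0⟩ : ∃ i ∈ chartFinset S, chartPartition S i t₀ ≠ 0 :=
    Finset.exists_ne_zero_of_sum_ne_zero (by rw [chartPartition_sum]; exact one_ne_zero)
  have hnn' : ∀ i : S, ∀ y ∈ (extChartAt 𝓘(ℝ, ℂ) i).target,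
      0 ≤ chartPartition S i ((extChartAt 𝓘(ℝ, ℂ) i).symm y) *
      (G.g (Z.toFun ((extChartAt 𝓘(ℝ, ℂ) i).symm y)) (X ((extChartAt 𝓘(ℝ, ℂ) i).symm y))
        (Y ((extChartAt 𝓘(ℝ, ℂ) i).symm y)) *
      h.inner ((extChartAt 𝓘(ℝ, ℂ) i).symm y) (chartD i y 1) (chartD i y 1)) := by
    intro i y _
    refine mul_nonneg ((chartPartition S).nonneg i _) (mul_nonneg (hnn _) (h.inner_self_nonneg _ _))
  refine Finset.sum_pos' (fun i _ => setIntegral_nonneg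
    (isOpen_extChartAt_target i).measurableSet (hnn' i)) ⟨i, hi, ?_⟩
  have hT := isOpen_extChartAt_target (I := 𝓘(ℝ, ℂ)) i
  rw [setIntegral_pos_iff_support_of_nonneg_ae
    ((ae_restrict_mem hT.measurableSet).mono (hnn' i)) (integrableOn_l2density P hX hY i)]
  have hopen := (continuousOn_l2density (G := G) P hX hY i).isOpen_inter_preimage hT
    (isOpen_ne (x := (0 : ℝ)))
  rw [inter_comm] at hopen
  refine hopen.measure_pos volume ?_
  have ht : t₀ ∈ (extChartAt 𝓘(ℝ, ℂ) i).source :=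
    chartPartition_subordinate i (by_contra fun h1 => hi0 (image_eq_zero_of_notMem_tsupport h1))
  have e1 := (extChartAt 𝓘(ℝ, ℂ) i).left_inv ht
  have hy := (extChartAt 𝓘(ℝ, ℂ) i).map_source ht
  refine ⟨extChartAt 𝓘(ℝ, ℂ) i t₀, ?_, hy⟩
  have hD : (chartD i (extChartAt 𝓘(ℝ, ℂ) i t₀) 1 :
      TangentSpace 𝓘(ℝ, ℂ) ((extChartAt 𝓘(ℝ, ℂ) i).symm (extChartAt 𝓘(ℝ, ℂ) i t₀))) ≠ 0 := by
    intro h0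
    have h1 := toChart_ofChart (M := S) (x₀ := i) (x := t₀) (by rwa [extChartAt_source] at ht) (1 : ℂ)
    have h2 : ofChart i t₀ (1 : ℂ) = 0 := h0
    rw [h2, map_zero] at h1
    exact zero_ne_one h1
  refine mul_ne_zero (by rwa [e1]) (mul_ne_zero ?_ (h.pos' hD).ne')
  rw [e1]
  exact hpos.ne'

include P in
-- If the difference of two gradients is nonzero at `t₀`, take a family whose velocity at `t₀` is
-- that difference. It need not agree with the difference elsewhere: rescaling time by a bump
-- function supported where their `g`-product is positive makes the product nonnegative everywhere.
-- The `L²`-product is then positive, although both gradients predict the same derivative of the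
-- action.
theorem IsGradient.unique {B : Type*} [NormedAddCommGroup B] [NormedSpace ℝ B]
    {F : Type*} [TopologicalSpace F] [ChartedSpace B F] [IsManifold 𝓘(ℝ, B) ∞ F]
    (hb : IsSmoothFiberBundle E B F σ) {Θ : DForm E W 2}
    (hX : IsGradient G Θ Z X) (hX' : IsGradient G Θ Z X') (t₀ : S) : X t₀ = X' t₀ := by
  by_contra hne
  obtain ⟨γ₁, rfl, hv⟩ := exists_family hσ hb Z t₀ (X t₀ - X' t₀)
  let Y₁ : ∀ t, Vert E σ (γ₁.toFun 0 t) := fun t =>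
    ⟨γ₁.velocity 0 t, γ₁.velocity_mem_vert hσ 0 t⟩
  have hY₁ : (γ₁.slice 0).SmoothAlong Y₁ := γ₁.smoothAlongAt_velocity
  have hY₁0 : Y₁ t₀ = X t₀ - X' t₀ :=
    Subtype.ext (eq_of_heq (Bundle.TotalSpace.mk.inj hv).2)
  have hD := hX.1.sub hX'.1
  have hcont := continuous_g (G := G) P hD hY₁
  have hpos : 0 < G.g (γ₁.toFun 0 t₀) (X t₀ - X' t₀) (Y₁ t₀) := by
    rw [hY₁0]
    exact G.pos _ _ (sub_ne_zero.2 hne)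
  obtain ⟨χ, hχ, hχ1, hχ0, -, hχs⟩ := exists_bump ((isOpen_Ioi.preimage hcont).mem_nhds hpos)
  let Y : ∀ t, Vert E σ (γ₁.toFun 0 t) := fun t => χ t • Y₁ t
  have hY : (γ₁.slice 0).SmoothAlong Y := fun t =>
    SmoothAlongAt.smul (hχ t) (γ₁.smoothAlongAt_velocity t)
  have h1 := hX.2 Y hY (γ₁.scale hχ) (γ₁.scale_velocity hχ)
  have h2 := hX'.2 Y hY (γ₁.scale hχ) (γ₁.scale_velocity hχ)
  have h3 := l2Inner_sub_left (G := G) P hX.1 hX'.1 hY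
  rw [h1.unique h2, sub_self] at h3
  refine (l2Inner_pos (G := G) P hD hY (fun t => ?_) (t₀ := t₀) ?_).ne' h3
  · change 0 ≤ G.g (γ₁.toFun 0 t) (X t - X' t) (χ t • Y₁ t)
    rw [map_smul, smul_eq_mul]
    by_cases ht : t ∈ tsupport χ
    · exact mul_nonneg (hχ0 t) (le_of_lt (hχs ht))
    · rw [image_eq_zero_of_notMem_tsupport ht, zero_mul]
  · change 0 < G.g (γ₁.toFun 0 t₀) (X t₀ - X' t₀) (χ t₀ • Y₁ t₀)
    rw [hχ1, one_smul]
    exact hpos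

end Uniqueness

/-! ### Gradient lines and the perturbed Fueter equation -/

section Main

variable {E : Type*} [NormedAddCommGroup E] [NormedSpace ℂ E] [FiniteDimensional ℂ E]
  {W : Type*} [TopologicalSpace W] [ChartedSpace E W] [IsManifold 𝓘(ℂ, E) ω W]
  {S : Type*} [TopologicalSpace S] [ChartedSpace ℂ S] [IsManifold 𝓘(ℂ, ℂ) ω S]
  {σ : W → S}
  {hσ : MDifferentiable 𝓘(ℂ, E) 𝓘(ℂ, ℂ) σ} {Ω : DForm E W 3} {h : ConformalMetric S}
  {G : CompatibleMetric hσ Ω h} {P : Connection E σ}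

theorem jNabla_eq_jNablaAt (hΩ : IsCRMS σ Ω)
    (hs : ∀ w, Function.Surjective (mfderiv 𝓘(ℝ, E) 𝓘(ℝ, ℂ) σ w)) (Z : SmoothSection E σ) (t : S)
    {ρ : TangentSpace 𝓘(ℝ, ℂ) t} (hρ : h.inner t ρ ρ = 1) :
    jNabla G P Z t = jNablaAt G P Z t ρ :=
  jNablaAt_eq_of_norm_eq G hΩ hs P Z t _ _ ((exists_unit h t).choose_spec.trans hρ.symm)

theorem vertI_injective (hσ : MDifferentiable 𝓘(ℂ, E) 𝓘(ℂ, ℂ) σ) (w : W) :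
    Function.Injective (vertI hσ w) := by
  intro u v huv
  have h1 := congrArg (vertI hσ w) huv
  rwa [vertI_vertI, vertI_vertI, neg_inj] at h1

theorem fueterOperator_adapted_eq_iff (hΩ : IsCRMS σ Ω)
    (hs : ∀ w, Function.Surjective (mfderiv 𝓘(ℝ, E) 𝓘(ℝ, ℂ) σ w)) (Z : SectionFamily E σ) (s : ℝ)
    (t : S) {ρ : TangentSpace 𝓘(ℝ, ℂ) t} (hρ : h.inner t ρ ρ = 1) (a : Vert E σ (Z.toFun s t)) :
    fueterOperator G P Z s t ![(1, 0), (0, ρ), (0, cplx ℂ t ρ)] = vertI hσ (Z.toFun s t) a ↔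
      Z.nabla P s t (1, 0) + jNabla G P (Z.slice s) t = a := by
  rw [fueterOperator_adapted G hΩ hs, (vertI_injective hσ _).eq_iff,
    jNabla_eq_jNablaAt hΩ hs (Z.slice s) t hρ]

variable [T2Space S] [CompactSpace S] {B : Type*} [NormedAddCommGroup B] [NormedSpace ℝ B]
  {F : Type*} [TopologicalSpace F] [ChartedSpace B F] [IsManifold 𝓘(ℝ, B) ∞ F]

theorem isGradient_iff (hb : IsSmoothFiberBundle E B F σ) (hΩ : IsCRMS σ Ω)
    {α : ∀ w : W, Vert E σ w} (hα : IsCurvatureTerm G P α) {Θ : DForm E W 2} (hΘ : IsSmoothForm Θ)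
    (hdΘ : IsExtDeriv Θ Ω) (Z : SmoothSection E σ) (X : ∀ t : S, Vert E σ (Z.toFun t)) :
    IsGradient G Θ Z X ↔ ∀ t, X t = jNabla G P Z t - α (Z.toFun t) := by
  have h1 := isGradient_jNabla hΩ (mfderiv_surjective hσ hb) hα hΘ hdΘ Z
  refine ⟨fun hX t => hX.unique P hb h1 t, fun hX => ?_⟩
  rwa [funext hX]

/-- The velocity `∂_s Z` is vertical, hence equal to `∇_s Z`, and the gradient is known explicitly
and uniquely at every slice. -/
theorem isNegGradientLine_iff (hb : IsSmoothFiberBundle E B F σ) (hΩ : IsCRMS σ Ω)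
    {α : ∀ w : W, Vert E σ w} (hα : IsCurvatureTerm G P α) {Θ : DForm E W 2} (hΘ : IsSmoothForm Θ)
    (hdΘ : IsExtDeriv Θ Ω) (Z : SectionFamily E σ) :
    IsNegGradientLine G Θ Z ↔ ∀ (s : ℝ) (t : S),
      Z.nabla P s t (1, 0) + jNabla G P (Z.slice s) t = α (Z.toFun s t) := by
  refine forall_congr' fun s => ?_
  have key : ∀ t (x : Vert E σ (Z.toFun s t)),
      Z.velocity s t = -(x : TangentSpace 𝓘(ℝ, E) (Z.toFun s t)) ↔ Z.nabla P s t (1, 0) = -x :=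
    fun t x => by
      rw [← Z.nabla_ds hσ P s t, ← Submodule.coe_neg]
      exact Subtype.coe_injective.eq_iff
  constructor
  · rintro ⟨X, hX, hv⟩ t
    rw [(key t _).1 (hv t), (isGradient_iff hb hΩ hα hΘ hdΘ (Z.slice s) X).1 hX t]
    abel
  · intro h1
    refine ⟨_, (isGradient_iff hb hΩ hα hΘ hdΘ (Z.slice s) _).2 fun t => rfl, fun t => ?_⟩
    refine (key t _).2 ?_
    rw [eq_sub_of_add_eq (h1 t)]
    abel

end Main

end CRMS

open CRMS in
theorem mainTheorem3
    {E : Type*} [NormedAddCommGroup E] [NormedSpace ℂ E] [FiniteDimensional ℂ E]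
    {W : Type*} [TopologicalSpace W] [ChartedSpace E W] [IsManifold 𝓘(ℂ, E) ω W]
    {S : Type*} [TopologicalSpace S] [ChartedSpace ℂ S] [IsManifold 𝓘(ℂ, ℂ) ω S]
    [T2Space S] [CompactSpace S]
    {B : Type*} [NormedAddCommGroup B] [NormedSpace ℝ B]
    {F : Type*} [TopologicalSpace F] [ChartedSpace B F] [IsManifold 𝓘(ℝ, B) ∞ F]
    (σ : W → S) (hσ : MDifferentiable 𝓘(ℂ, E) 𝓘(ℂ, ℂ) σ) (hbundle : IsSmoothFiberBundle E B F σ)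
    (Ω : DForm E W 3) (hΩ : IsCRMS σ Ω)
    (Θ : DForm E W 2) (hΘ : IsSmoothForm Θ) (hdΘ : IsExtDeriv Θ Ω)
    (h : ConformalMetric S) (G : CompatibleMetric hσ Ω h) (P : Connection E σ) :
    -- `𝔍_∇ Z(ρ)` depends only on the length of `ρ`
    (∀ (Z : SmoothSection E σ) (t : S) (ρ ρ' : TangentSpace 𝓘(ℝ, ℂ) t),
      h.inner t ρ ρ = h.inner t ρ' ρ' → jNablaAt G P Z t ρ = jNablaAt G P Z t ρ') ∧
    -- the zero-order term `α` and the operator `𝔍_∇`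
    (∃ α : ∀ w : W, Vert E σ w, IsCurvatureTerm G P α ∧
      SmoothFieldOn (fun w => (α w : TangentSpace 𝓘(ℝ, E) w)) Set.univ ∧
      ∃ D : ∀ (Z : SmoothSection E σ) (t : S), Vert E σ (Z.toFun t),
        (∀ Z : SmoothSection E σ, Z.SmoothAlong (D Z)) ∧
        (∀ (Z : SmoothSection E σ) (t : S) (ρ : TangentSpace 𝓘(ℝ, ℂ) t),
          h.inner t ρ ρ = 1 → D Z t = jNablaAt G P Z t ρ) ∧
        -- `grad 𝒜(Z) = 𝔍_∇ Z - α(Z)`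
        (∀ (Z : SmoothSection E σ) (X : ∀ t : S, Vert E σ (Z.toFun t)),
          IsGradient G Θ Z X ↔ ∀ t : S, X t = D Z t - α (Z.toFun t)) ∧
        -- the negative gradient lines
        (∀ Z : SectionFamily E σ,
          (IsNegGradientLine G Θ Z ↔ ∀ (s : ℝ) (t : S),
            Z.nabla P s t (1, 0) + D (Z.slice s) t = α (Z.toFun s t)) ∧
          (IsNegGradientLine G Θ Z ↔ ∀ (s : ℝ) (t : S) (ρ : TangentSpace 𝓘(ℝ, ℂ) t),
            h.inner t ρ ρ = 1 →
            fueterOperator G P Z s t ![(1, 0), (0, ρ), (0, cplx ℂ t ρ)] =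
              vertI hσ (Z.toFun s t) (α (Z.toFun s t))) ∧
          (IsNegGradientLine G Θ Z ↔ ∀ (s : ℝ) (t : S)
            (v : Fin 3 → ℝ × TangentSpace 𝓘(ℝ, ℂ) t), IsOrthonormalFrame h t v →
            fueterOperator G P Z s t v = vertI hσ (Z.toFun s t) (α (Z.toFun s t))))) ∧
    -- the Fueter operator does not depend on the orthonormal frame
    (∀ (Z : SectionFamily E σ) (s : ℝ) (t : S) (v v' : Fin 3 → ℝ × TangentSpace 𝓘(ℝ, ℂ) t),
      IsOrthonormalFrame h t v → IsOrthonormalFrame h t v' →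
      fueterOperator G P Z s t v = fueterOperator G P Z s t v') ∧
    -- `Ĩ(v)` is an almost complex structure on `V_w` for unit vectors `v = (a, ρ)`
    (∀ (w : W) (a : ℝ) (ρ : TangentSpace 𝓘(ℝ, ℂ) (σ w)), a ^ 2 + h.inner (σ w) ρ ρ = 1 →
      fueterStructure G w a ρ * fueterStructure G w a ρ = -1) := by
  have hs := mfderiv_surjective hσ hbundle
  obtain ⟨α, hα⟩ := exists_curvatureTerm G P hs
  have hα' := hα.smooth hbundle hΩ
  refine ⟨jNablaAt_eq_of_norm_eq G hΩ hs P,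
    ⟨α, hα, hα', jNabla G P, jNabla_smooth hΩ hs hα hα',
      fun Z t ρ hρ => jNabla_eq_jNablaAt hΩ hs Z t hρ,
      isGradient_iff hbundle hΩ hα hΘ hdΘ, fun Z => ?_⟩,
    fun Z s t v v' hv hv' => fueterOperator_eq_of_orthonormal G hΩ hs P Z s t v v' hv hv',
    fueterStructure_sq G hΩ hs⟩
  have h1 := isNegGradientLine_iff hbundle hΩ hα hΘ hdΘ Z
  refine ⟨h1, h1.trans ⟨fun h2 s t ρ hρ => ?_, fun h2 s t => ?_⟩,
    h1.trans ⟨fun h2 s t v hv => ?_, fun h2 s t => ?_⟩⟩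
  · exact (fueterOperator_adapted_eq_iff hΩ hs Z s t hρ _).2 (h2 s t)
  · obtain ⟨ρ, hρ⟩ := exists_unit h t
    exact (fueterOperator_adapted_eq_iff hΩ hs Z s t hρ _).1 (h2 s t ρ hρ)
  · obtain ⟨ρ, hρ⟩ := exists_unit h t
    -- Frame independence reduces an arbitrary frame to an adapted one, which exists because every
    -- tangent space contains a unit vector.
    rw [fueterOperator_eq_of_orthonormal G hΩ hs P Z s t v _ hv (isOrthonormalFrame_adapted t ρ hρ)]
    exact (fueterOperator_adapted_eq_iff hΩ hs Z s t hρ _).2 (h2 s t)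
  · obtain ⟨ρ, hρ⟩ := exists_unit h t
    exact (fueterOperator_adapted_eq_iff hΩ hs Z s t hρ _).1
      (h2 s t _ (isOrthonormalFrame_adapted t ρ hρ))
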